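/- Let $X\subseteq\mathbb{P}^N$ be a smooth projective variety over $\mathbb{C}$ (an integral closed subscheme, smooth over $\mathbb{C}$), and write $\mathcal{O}_X(1)=\mathcal{O}_{\mathbb{P}^N}(1)|_X$, $\mathcal{F}(m)=\mathcal{F}\otimes\mathcal{O}_X(1)^{\otimes m}$. Assume that $X$ is projectively normal, i.e. $H^0(\mathcal{O}_{\mathbb{P}^N}(m))\to H^0(\mathcal{O}_X(m))$ is surjective for all $m\ge 0$, and arithmetically Cohen--Macaulay, i.e. moreover $H^i(\mathcal{O}_X(j))=0$ for all $1\le i\le\dim X-1$ and all $j\in\mathbb{Z}$. Let $\mathcal{E}\neq 0$ be a vector bundle on $X$ that is Ulrich with respect to $\mathcal{O}_X(1)$, i.e. $H^j(\mathcal{E}(-j))=0$ for all $j>0$ and $H^j(\mathcal{E}(-j-1))=0$ for all $0\le j<\dim X$. Let $R(H)=\bigoplus_{m\ge 0}H^0(\mathcal{O}_X(m))$ be the homogeneous coordinate ring of $X$ and let $\Gamma_*(\mathcal{E})=\bigoplus_{m\ge 0}H^0(\mathcal{E}(m))$, a graded $R(H)$-module. Then $\Gamma_*(\mathcal{E})$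 is a Koszul $R(H)$-module if and only if $R(H)$ is a Koszul algebra. Here a graded module $M$ over $R=R(H)$ is called Koszul if it has a linear graded free resolution $\cdots\to E_1\to E_0\to M\to 0$ with $E_i=R(-i)^{\oplus\beta_i}$ for all $i\ge 0$, and $R$ is called a Koszul algebra if $\mathbb{C}=R/R_+$, concentrated in degree $0$, is a Koszul $R$-module. -/

import Mathlib

open CategoryTheory AlgebraicGeometry TopologicalSpace

noncomputable section

namespace UlrichKoszul

/-! ### Koszul modules and Koszul algebras -/

section Koszul

variable {R : Type} [CommRing R] (𝒜 : ℕ → AddSubgroup R)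
  {M : Type} [AddCommGroup M] [Module R M] (ℳ : ℕ → AddSubgroup M)

/-- A linear graded free resolution `⋯ → E₂ → E₁ → E₀ → M → 0` with `Eᵢ = R(-i)^{⊕ ι i}`.
The basis of `Eᵢ` sits in degree `i`; so a map `R(-i-1)^{⊕ ι (i+1)} → R(-i)^{⊕ ι i}` preserves
degrees iff its matrix entries lie in the degree one part of `R`, and the augmentation preserves
degrees iff it sends the basis of `E₀` to the degree zero part of `M`. All matrix entries being
of degree one, such a resolution is automatically minimal. If `R₀` is a field, `R` is
Noetherian and `M` is finitely generated, then the basis sets `ι i` are automatically finite. -/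
structure LinearResolution where
  /-- the basis of the `i`-th free module -/
  ι : ℕ → Type
  /-- the differentials -/
  d : ∀ i, (ι (i + 1) →₀ R) →ₗ[R] (ι i →₀ R)
  /-- the augmentation -/
  ε : (ι 0 →₀ R) →ₗ[R] M
  d_degree : ∀ i (b : ι (i + 1)) (c : ι i), d i (Finsupp.single b 1) c ∈ 𝒜 1
  ε_degree : ∀ b : ι 0, ε (Finsupp.single b 1) ∈ ℳ 0
  ε_surjective : Function.Surjective ε
  exact_zero : Function.Exact (d 0) ε
  exact_succ : ∀ i, Function.Exact (d (i + 1)) (d i)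

/-- The graded module `M = ⨁ ℳ m` over the graded ring `R = ⨁ 𝒜 m` is Koszul. -/
def IsKoszulModule : Prop := Nonempty (LinearResolution 𝒜 ℳ)

/-- The ideal `R₊` of elements of positive degree. -/
def irrelevantIdeal : Ideal R := Ideal.span {a | ∃ m : ℕ, 0 < m ∧ a ∈ 𝒜 m}

/-- The grading of a module that is concentrated in degree zero. -/
def concentratedInDegreeZero (M : Type) [AddCommGroup M] (m : ℕ) : AddSubgroup M :=
  if m = 0 then ⊤ else ⊥

/-- The graded algebra `R` is Koszul: its residue field `R / R₊ = R₀`, concentrated in degree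
zero, is a Koszul module over `R`. -/
def IsKoszulAlgebra : Prop :=
  IsKoszulModule 𝒜 (concentratedInDegreeZero (R ⧸ irrelevantIdeal 𝒜))

end Koszul

/-! ### Projective space -/

/-- The standard grading of `S = ℂ[x₀, …, x_N]`. -/
@[reducible] def polyGrading (N : ℕ) : ℕ → Submodule ℂ (MvPolynomial (Fin (N + 1)) ℂ) :=
  MvPolynomial.homogeneousSubmodule (Fin (N + 1)) ℂ

instance (N : ℕ) : GradedAlgebra (polyGrading N) := MvPolynomial.gradedAlgebra

/-- Projective space `ℙ^N` over `ℂ`. -/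
abbrev projSpace (N : ℕ) : Scheme.{0} := Proj (polyGrading N)

/-- The structure morphism `ℙ^N ⟶ Spec ℂ`. -/
def projSpaceToSpec (N : ℕ) : projSpace N ⟶ Spec (CommRingCat.of ℂ) :=
  Proj.toSpecZero (polyGrading N) ≫
    Spec.map (CommRingCat.ofHom (algebraMap ℂ (polyGrading N 0)))

/-- The standard affine open `{x_k ≠ 0}` of `ℙ^N`. -/
abbrev stdOpen (N : ℕ) (k : Fin (N + 1)) : (projSpace N).Opens :=
  Proj.basicOpen (polyGrading N) (MvPolynomial.X k)

/-- The regular function `F / x_k ^ m` on `{x_k ≠ 0}`, for a form `F` of degree `m`. -/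
def dehomog {N : ℕ} (k : Fin (N + 1)) (m : ℕ) (F : polyGrading N m) :
    Γ(projSpace N, stdOpen N k) :=
  (Proj.awayToSection (polyGrading N) (MvPolynomial.X k)).hom
    (HomogeneousLocalization.Away.mk (polyGrading N) (d := 1)
      (MvPolynomial.isHomogeneous_X ℂ k) m F.1 (by simp))

/-- The coordinate `x_l` as a form of degree one. -/
def coord {N : ℕ} (l : Fin (N + 1)) : polyGrading N 1 :=
  ⟨MvPolynomial.X l, MvPolynomial.isHomogeneous_X ℂ l⟩

theorem dehomog_val {N : ℕ} (k : Fin (N + 1)) (m : ℕ) (F : polyGrading N m)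
    (p : stdOpen N k) :
    have : p.1.asHomogeneousIdeal.toIdeal.IsPrime := p.1.isPrime
    ((dehomog k m F).1 p).val = Localization.mk F.1
      (⟨MvPolynomial.X k, p.2⟩ ^ m : p.1.asHomogeneousIdeal.toIdeal.primeCompl) := by
  intro
  change (HomogeneousLocalization.mapId _ _ _).val = _
  rfl

/-- The restriction of `x_l / x_k` to `{x_k ≠ 0} ∩ {x_l ≠ 0}`. -/
def ratio {N : ℕ} (k l : Fin (N + 1)) : Γ(projSpace N, stdOpen N k ⊓ stdOpen N l) :=
  ((projSpace N).presheaf.map (homOfLE inf_le_left).op).hom (dehomog k 1 (coord l))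

/-- The restriction of `x_k / x_l` to `{x_k ≠ 0} ∩ {x_l ≠ 0}`. -/
def ratioInv {N : ℕ} (k l : Fin (N + 1)) : Γ(projSpace N, stdOpen N k ⊓ stdOpen N l) :=
  ((projSpace N).presheaf.map (homOfLE inf_le_right).op).hom (dehomog l 1 (coord k))

theorem ratio_mul_ratioInv {N : ℕ} (k l : Fin (N + 1)) : ratio k l * ratioInv k l = 1 := by
  apply Subtype.ext
  funext p
  apply HomogeneousLocalization.val_injective
  have : p.1.asHomogeneousIdeal.toIdeal.IsPrime := p.1.isPrime
  have h1 := dehomog_val k 1 (coord l) ⟨p.1, p.2.1⟩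
  have h2 := dehomog_val l 1 (coord k) ⟨p.1, p.2.2⟩
  change ((dehomog k 1 (coord l)).1 ⟨p.1, p.2.1⟩ * (dehomog l 1 (coord k)).1 ⟨p.1, p.2.2⟩).val
    = (1 : HomogeneousLocalization _ _).val
  rw [HomogeneousLocalization.val_mul, HomogeneousLocalization.val_one]
  refine (congrArg₂ (· * ·) h1 h2).trans ?_
  rw [Localization.mk_mul, ← Localization.mk_one, Localization.mk_eq_mk_iff,
    Localization.r_iff_exists]
  refine ⟨1, ?_⟩
  simp only [coord, pow_one, Submonoid.coe_one, one_mul, mul_one, Submonoid.coe_mul]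
  exact mul_comm _ _

theorem localization_aux {A : Type} [CommRing A] (M : Submonoid A) (a b : M) (c : A) (m : ℕ) :
    Localization.mk (b : A) (a ^ 1) ^ m * Localization.mk c (b ^ m) = Localization.mk c (a ^ m) := by
  rw [Localization.mk_pow, Localization.mk_mul, Localization.mk_eq_mk_iff,
    Localization.r_iff_exists]
  refine ⟨1, ?_⟩
  push_cast
  ring

theorem dehomog_compat {N : ℕ} (k l : Fin (N + 1)) (m : ℕ) (F : polyGrading N m) :
    ((projSpace N).presheaf.map (homOfLE (inf_le_left : stdOpen N k ⊓ stdOpen N l ≤ _)).op).hom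
        (dehomog k m F) =
      ratio k l ^ m *
        ((projSpace N).presheaf.map (homOfLE inf_le_right).op).hom (dehomog l m F) := by
  apply Subtype.ext
  funext p
  apply HomogeneousLocalization.val_injective
  have : p.1.asHomogeneousIdeal.toIdeal.IsPrime := p.1.isPrime
  have h1 := dehomog_val k m F ⟨p.1, p.2.1⟩
  have h2 := dehomog_val l m F ⟨p.1, p.2.2⟩
  have h3 := dehomog_val k 1 (coord l) ⟨p.1, p.2.1⟩
  have h4 : ((ratio k l ^ m).1 p) = ((ratio k l).1 p) ^ m := rfl
  change ((dehomog k m F).1 ⟨p.1, p.2.1⟩).val =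
    ((ratio k l ^ m).1 p * (dehomog l m F).1 ⟨p.1, p.2.2⟩).val
  rw [h4, HomogeneousLocalization.val_mul, HomogeneousLocalization.val_pow]
  refine h1.trans (Eq.trans ?_ (congrArg₂ (· * ·) (congrArg (· ^ m) h3) h2).symm)
  exact (localization_aux _ ⟨MvPolynomial.X k, p.2.1⟩ ⟨MvPolynomial.X l, p.2.2⟩ F.1 m).symm

/-- The unit `x_l / x_k` on `{x_k ≠ 0} ∩ {x_l ≠ 0}`. -/
def ratioUnit {N : ℕ} (k l : Fin (N + 1)) : (Γ(projSpace N, stdOpen N k ⊓ stdOpen N l))ˣ where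
  val := ratio k l
  inv := ratioInv k l
  val_inv := ratio_mul_ratioInv k l
  inv_val := by rw [mul_comm]; exact ratio_mul_ratioInv k l

/-! ### Twists by the hyperplane bundle

For `f : X ⟶ ℙ^N` and an `𝒪_X`-module `E`, the twist `E(m) = E ⊗ f^* 𝒪(m)` is glued from the
restrictions of `E` to the open sets `{x_k ≠ 0}` by means of the transition functions
`(x_l / x_k) ^ m`: a section of `E(m)` is a family `s` of sections `s k` of `E` over `{x_k ≠ 0}`
such that `x_k ^ m s k = x_l ^ m s l`, that is, `s k = (x_l / x_k) ^ m s l`. -/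

section Twist

variable {N : ℕ} {X : Scheme.{0}} (f : X ⟶ projSpace N) (E : X.Modules)

/-- The open subset `{x_k ≠ 0}` of `X`. -/
abbrev chart (k : Fin (N + 1)) : X.Opens := f ⁻¹ᵁ stdOpen N k

/-- The open subset `{x_k ≠ 0} ∩ {x_l ≠ 0}` of `X`. -/
abbrev overlap (k l : Fin (N + 1)) : X.Opens := f ⁻¹ᵁ (stdOpen N k ⊓ stdOpen N l)

theorem overlap_le_left (V : X.Opens) (k l : Fin (N + 1)) :
    V ⊓ overlap f k l ≤ V ⊓ chart f k :=
  inf_le_inf_left V fun _ hx ↦ hx.1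

theorem overlap_le_right (V : X.Opens) (k l : Fin (N + 1)) :
    V ⊓ overlap f k l ≤ V ⊓ chart f l :=
  inf_le_inf_left V fun _ hx ↦ hx.2

/-- The unit `x_l / x_k` on `{x_k ≠ 0} ∩ {x_l ≠ 0}`. -/
def overlapUnit (k l : Fin (N + 1)) : (Γ(X, overlap f k l))ˣ :=
  Units.map (f.app (stdOpen N k ⊓ stdOpen N l)).hom.toMonoidHom (ratioUnit k l)

/-- The function `(x_l / x_k) ^ m` on `V ∩ {x_k ≠ 0} ∩ {x_l ≠ 0}`. -/
def transition (m : ℤ) (V : X.Opens) (k l : Fin (N + 1)) :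
    Γ(X, V ⊓ overlap f k l) :=
  (X.presheaf.map (homOfLE inf_le_right).op).hom
    ((overlapUnit f k l ^ m : (Γ(X, overlap f k l))ˣ) : Γ(X, overlap f k l))

theorem transition_zero (V : X.Opens) (k l : Fin (N + 1)) : transition f 0 V k l = 1 := by
  simp [transition]

theorem transition_add (a b : ℤ) (V : X.Opens) (k l : Fin (N + 1)) :
    transition f (a + b) V k l = transition f a V k l * transition f b V k l := by
  simp only [transition, zpow_add, Units.val_mul, map_mul]

theorem map_transition (m : ℤ) {V W : X.Opens} (h : W ≤ V) (k l : Fin (N + 1)) :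
    X.presheaf.map (homOfLE (inf_le_inf_right _ h)).op (transition f m V k l) =
      transition f m W k l := by
  simp only [transition]
  change (X.presheaf.map _ ≫ X.presheaf.map _).hom _ = _
  rw [← Functor.map_comp]
  rfl

/-- Restriction of sections of `E`. -/
def resMod {U V : X.Opens} (h : V ≤ U) : Γ(E, U) →+ Γ(E, V) :=
  (E.presheaf.map (homOfLE h).op).hom

/-- Restriction of regular functions. -/
def resFun {U V : X.Opens} (h : V ≤ U) : Γ(X, U) →+* Γ(X, V) :=
  (X.presheaf.map (homOfLE h).op).hom

theorem resMod_smul {U V : X.Opens} (h : V ≤ U) (a : Γ(X, U)) (s : Γ(E, U)) :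
    resMod E h (a • s) = resFun h a • resMod E h s :=
  Scheme.Modules.map_smul E (homOfLE h) a s

theorem resMod_resMod {U V W : X.Opens} (h : V ≤ U) (h' : W ≤ V) (s : Γ(E, U)) :
    resMod E h' (resMod E h s) = resMod E (h'.trans h) s := by
  change (E.presheaf.map _ ≫ E.presheaf.map _).hom s = _
  rw [← Functor.map_comp]
  rfl

theorem resFun_resFun {U V W : X.Opens} (h : V ≤ U) (h' : W ≤ V) (a : Γ(X, U)) :
    resFun h' (resFun h a) = resFun (h'.trans h) a := by
  change (X.presheaf.map _ ≫ X.presheaf.map _).hom a = _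
  rw [← Functor.map_comp]
  rfl

theorem resMod_self {U : X.Opens} (h : U ≤ U) (s : Γ(E, U)) : resMod E h s = s := by
  change (E.presheaf.map (𝟙 _)).hom s = _
  rw [CategoryTheory.Functor.map_id]
  rfl

/-- The sections of `E(m)` over `V`. -/
def twistSections (m : ℤ) (V : X.Opens) : AddSubgroup (∀ k, Γ(E, V ⊓ chart f k)) where
  carrier := {s | ∀ k l,
    resMod E (overlap_le_left f V k l) (s k) =
      transition f m V k l • resMod E (overlap_le_right f V k l) (s l)}
  zero_mem' k l := by simp
  add_mem' hs ht k l := by simp [hs k l, ht k l]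
  neg_mem' hs k l := by simp [hs k l]

theorem mem_twistSections {m : ℤ} {V : X.Opens} {s : ∀ k, Γ(E, V ⊓ chart f k)} :
    s ∈ twistSections f E m V ↔ ∀ k l,
      resMod E (overlap_le_left f V k l) (s k) =
        transition f m V k l • resMod E (overlap_le_right f V k l) (s l) := Iff.rfl

theorem restrict_mem {m : ℤ} {V W : X.Opens} (h : W ≤ V) {s : ∀ k, Γ(E, V ⊓ chart f k)}
    (hs : s ∈ twistSections f E m V) :
    (fun k ↦ resMod E (inf_le_inf_right (chart f k) h) (s k)) ∈ twistSections f E m W := by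
  intro k l
  have := congrArg (resMod E (inf_le_inf_right (overlap f k l) h)) (hs k l)
  rw [resMod_smul, resMod_resMod, resMod_resMod] at this
  rw [resMod_resMod, resMod_resMod, this]
  congr 1
  exact map_transition f m h k l

/-- The presheaf of abelian groups underlying `E(m)`. -/
def twistPresheaf (m : ℤ) : TopCat.Presheaf AddCommGrpCat.{0} X where
  obj V := AddCommGrpCat.of (twistSections f E m V.unop)
  map i := AddCommGrpCat.ofHom
    { toFun := fun s ↦ ⟨_, restrict_mem f E i.unop.le s.2⟩
      map_zero' := by ext; simp
      map_add' := fun s t ↦ by ext; simp }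
  map_id V := by
    ext s k
    exact resMod_self E _ _
  map_comp i j := by
    ext s k
    exact (resMod_resMod E _ _ _).symm

theorem resMod_eq_of_cover {ι : Type} {V : X.Opens} (W : ι → X.Opens) (hW : ∀ a, W a ≤ V)
    (hV : V ≤ iSup W) {s t : Γ(E, V)} (h : ∀ a, resMod E (hW a) s = resMod E (hW a) t) : s = t :=
  TopCat.Sheaf.eq_of_locally_eq' ⟨E.presheaf, E.isSheaf⟩ W V (fun a ↦ homOfLE (hW a)) hV s t h

theorem exists_glue {ι : Type} {V : X.Opens} (W : ι → X.Opens) (hW : ∀ a, W a ≤ V)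
    (hV : V ≤ iSup W) (s : ∀ a, Γ(E, W a))
    (h : ∀ a b, resMod E (inf_le_left : W a ⊓ W b ≤ W a) (s a) =
      resMod E (inf_le_right : W a ⊓ W b ≤ W b) (s b)) :
    ∃ t : Γ(E, V), ∀ a, resMod E (hW a) t = s a := by
  obtain ⟨t, ht, -⟩ := TopCat.Sheaf.existsUnique_gluing' ⟨E.presheaf, E.isSheaf⟩ W V
    (fun a ↦ homOfLE (hW a)) hV s h
  exact ⟨t, ht⟩

theorem twistPresheaf_isSheaf (m : ℤ) : (twistPresheaf f E m).IsSheaf := by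
  rw [TopCat.Presheaf.isSheaf_iff_isSheafUniqueGluing]
  intro ι W sf hsf
  have hsf' : ∀ a b k, resMod E (inf_le_inf_right (chart f k) inf_le_left) ((sf a).1 k) =
      resMod E (inf_le_inf_right (chart f k) (inf_le_right : W a ⊓ W b ≤ W b)) ((sf b).1 k) :=
    fun a b k ↦ congrFun (congrArg Subtype.val (hsf a b)) k
  have hle : ∀ k a, W a ⊓ chart f k ≤ iSup W ⊓ chart f k :=
    fun k a ↦ inf_le_inf_right _ (le_iSup W a)
  have hcov : ∀ O : X.Opens, iSup W ⊓ O ≤ ⨆ a, W a ⊓ O := fun O ↦ by rw [iSup_inf_eq]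
  have key : ∀ k, ∃ t : Γ(E, iSup W ⊓ chart f k), ∀ a, resMod E (hle k a) t = (sf a).1 k := by
    intro k
    refine exists_glue E (fun a ↦ W a ⊓ chart f k) (hle k) (hcov _) (fun a ↦ (sf a).1 k) ?_
    intro a b
    have e : (W a ⊓ chart f k) ⊓ (W b ⊓ chart f k) ≤ (W a ⊓ W b) ⊓ chart f k :=
      le_of_eq (inf_inf_distrib_right _ _ _).symm
    have := congrArg (resMod E e) (hsf' a b k)
    rwa [resMod_resMod, resMod_resMod] at this
  choose t ht using key
  have htm : t ∈ twistSections f E m (iSup W) := by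
    intro k l
    refine resMod_eq_of_cover E (fun a ↦ W a ⊓ overlap f k l)
      (fun a ↦ inf_le_inf_right _ (le_iSup W a)) (hcov _) fun a ↦ ?_
    have h1 := (sf a).2 k l
    rw [← ht k a, ← ht l a, resMod_resMod, resMod_resMod] at h1
    rw [resMod_smul, resMod_resMod, resMod_resMod, h1]
    congr 1
    exact (map_transition f m (le_iSup W a) k l).symm
  refine ⟨⟨t, htm⟩, fun a ↦ Subtype.ext (funext fun k ↦ ht k a), ?_⟩
  intro u hu
  apply Subtype.ext
  funext k
  refine resMod_eq_of_cover E (fun a ↦ W a ⊓ chart f k) (hle k) (hcov _) fun a ↦ ?_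
  rw [ht k a]
  exact congrFun (congrArg Subtype.val (hu a)) k

/-- The twist `E(m)` as a sheaf of abelian groups on `X`. -/
def twist (m : ℤ) : TopCat.Sheaf AddCommGrpCat.{0} X :=
  ⟨twistPresheaf f E m, twistPresheaf_isSheaf f E m⟩

/-- The cohomology group `H^j(X, E(m))`. -/
abbrev twistCohomology (m : ℤ) (j : ℕ) : Type := Sheaf.H (twist f E m) j

/-! ### The graded ring `R(H)` and the graded module `Γ_*(E)` -/

/-- The ambient ring of the groups `H⁰(X, 𝒪_X(m))`. -/
abbrev ChartRing : Type := ∀ k, Γ(X, ⊤ ⊓ chart f k)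

/-- The ambient module of the groups `H⁰(X, E(m))`. -/
abbrev ChartModule : Type := ∀ k, Γ(E, ⊤ ⊓ chart f k)

instance : Module (ChartRing f) (ChartModule f E) := Pi.module'

/-- The group `H⁰(X, 𝒪_X(m))`, as a subgroup of the ring `ChartRing f`. -/
def ringPiece (m : ℕ) : AddSubgroup (ChartRing f) where
  carrier := {a | ∀ k l,
    resFun (overlap_le_left f ⊤ k l) (a k) =
      transition f m ⊤ k l * resFun (overlap_le_right f ⊤ k l) (a l)}
  zero_mem' k l := by simp
  add_mem' hs ht k l := by simp [hs k l, ht k l, mul_add]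
  neg_mem' hs k l := by simp [hs k l]

/-- The sheaf `𝒪_X` as a module over itself. -/
abbrev structureModule (X : Scheme.{0}) : X.Modules := SheafOfModules.unit X.ringCatSheaf

theorem mem_ringPiece_iff (m : ℕ) (a : ChartRing f) :
    a ∈ ringPiece f m ↔ (a : ChartModule f (structureModule X)) ∈
      twistSections f (structureModule X) m ⊤ := Iff.rfl

/-- The group `H⁰(X, E(m))`, as a subgroup of `ChartModule f E`. -/
def modulePiece (m : ℕ) : AddSubgroup (ChartModule f E) := twistSections f E m ⊤

/-- The restriction to `X` of a form `F` of degree `m` on `ℙ^N`, as a section of `𝒪_X(m)`: the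
family of the functions `F / x_k ^ m`. -/
def restrictForm (m : ℕ) (F : polyGrading N m) : ringPiece f m :=
  ⟨fun k ↦ resFun inf_le_right ((f.app (stdOpen N k)).hom (dehomog k m F)), fun k l ↦ by
    have h := congrArg (resFun (X := X) (V := ⊤ ⊓ overlap f k l) inf_le_right)
      (congrArg (f.app (stdOpen N k ⊓ stdOpen N l)).hom (dehomog_compat k l m F))
    have nat : ∀ {V : (projSpace N).Opens} (hV : stdOpen N k ⊓ stdOpen N l ≤ V)
        (a : Γ(projSpace N, V)),
        (f.app (stdOpen N k ⊓ stdOpen N l)).hom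
          (((projSpace N).presheaf.map (homOfLE hV).op).hom a) =
        resFun (X := X) (fun _ hx ↦ hV hx) ((f.app V).hom a) := fun hV a ↦
      congrArg (fun φ ↦ φ.hom a) (f.naturality (homOfLE hV).op)
    rw [map_mul, map_mul, nat, nat, map_pow] at h
    refine (resFun_resFun _ _ _).trans (((resFun_resFun _ _ _).symm.trans h).trans
      (congrArg₂ (· * ·) ?_ ((resFun_resFun _ _ _).trans (resFun_resFun _ _ _).symm)))
    simp only [transition, zpow_natCast, Units.val_pow_eq_pow_val]
    rfl⟩

instance : SetLike.GradedMonoid (ringPiece f) where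
  one_mem k l := by simp [transition_zero]
  mul_mem a b x y hx hy k l := by
    simp only [Pi.mul_apply, map_mul, hx k l, hy k l, Nat.cast_add, transition_add]
    ring

instance : SetLike.GradedSMul (ringPiece f) (modulePiece f E) where
  smul_mem {a b x y} hx hy k l := by
    change resMod E _ (x k • y k) = _ • resMod E _ (x l • y l)
    rw [resMod_smul, resMod_smul, hx k l, hy k l, vadd_eq_add, Nat.cast_add, transition_add,
      smul_smul, smul_smul]
    congr 1
    ring

/-- The graded ring `R(H) = ⨁_{m ≥ 0} H⁰(X, 𝒪_X(m))`. -/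
abbrev sectionRing : Type := DirectSum ℕ fun m ↦ ringPiece f m

/-- The graded `R(H)`-module `Γ_*(E) = ⨁_{m ≥ 0} H⁰(X, E(m))`. -/
abbrev sectionModule : Type := DirectSum ℕ fun m ↦ modulePiece f E m

/-- The degree `m` part of `R(H)`. -/
def sectionRingGrading (m : ℕ) : AddSubgroup (sectionRing f) :=
  (DirectSum.of (fun m ↦ ringPiece f m) m).range

/-- The degree `m` part of `Γ_*(E)`. -/
def sectionModuleGrading (m : ℕ) : AddSubgroup (sectionModule f E) :=
  (DirectSum.of (fun m ↦ modulePiece f E m) m).range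

/-! ### Vector bundles, projectively normal, arithmetically Cohen-Macaulay, Ulrich -/

/-- `E` is a vector bundle: locally it is free of finite rank. -/
def IsVectorBundle (E : X.Modules) : Prop :=
  ∀ x : X, ∃ U : X.Opens, x ∈ U ∧ ∃ r : ℕ,
    Nonempty (E.restrict U.ι ≅ SheafOfModules.free (R := U.toScheme.ringCatSheaf) (Fin r))

/-- `X ⊆ ℙ^N` is projectively normal: `H⁰(ℙ^N, 𝒪(m)) = ℂ[x₀, …, x_N]_m → H⁰(X, 𝒪_X(m))` is
surjective for all `m ≥ 0`. -/
def IsProjectivelyNormal : Prop := ∀ m : ℕ, Function.Surjective (restrictForm f m)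

/-- `X ⊆ ℙ^N` is arithmetically Cohen-Macaulay: it is projectively normal and
`H^i(X, 𝒪_X(j)) = 0` for all `1 ≤ i ≤ dim X - 1` and all integers `j`. -/
structure IsACM : Prop where
  projectivelyNormal : IsProjectivelyNormal f
  cohomology_eq_zero : ∀ i : ℕ, 1 ≤ i → (i : WithBot ℕ∞) < topologicalKrullDim X →
    ∀ j : ℤ, Subsingleton (twistCohomology f (structureModule X) j i)

/-- `E` is Ulrich with respect to the hyperplane section: `H^j(X, E(-j)) = 0` for all `j > 0` and
`H^j(X, E(-j-1)) = 0` for all `0 ≤ j < dim X`. -/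
structure IsUlrich : Prop where
  regular : ∀ j : ℕ, 0 < j → Subsingleton (twistCohomology f E (-j) j)
  cohomology_eq_zero : ∀ j : ℕ, (j : WithBot ℕ∞) < topologicalKrullDim X →
    Subsingleton (twistCohomology f E (-j - 1) j)

end Twist
end UlrichKoszul

end

set_option linter.unusedSectionVars false

noncomputable section

namespace UlrichKoszul

/-! ### Modules graded by projections -/

section GradedAlgebra

variable {R : Type} [CommRing R] (𝒜 : ℕ → AddSubgroup R)

/-! Write R for R(H), M for Γ_*(E) and n for dim X. As ℂ is infinite, a general linear form avoids
any given finite set of points of X; choosing forms that avoid the generic points of successive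
intersections gives n + 1 linear forms without common zeros on X, each nonzero at the generic point
and hence a nonzerodivisor on R (`exists_parameters`).

At every point one of these forms is invertible, so their Koszul complex with coefficients in the
twists of E is an exact complex of sheaves. Dimension shifting along it propagates the two Ulrich
conditions: H^j(E(m)) = 0 for j > 0 and m ≥ -j (`extVanish_of_regular`), and for j < n and m ≤ -j -
1 (`extVanish_of_left`). For 0 < j < n these two ranges exhaust all twists. The same complex then
shows that the forms are a regular sequence on M (`isRegularOn_of_regular`) and generate everything
of positive degree from the degree below (`mem_imageOf_of_regular`). So the quotient Q of M by the
forms is a copy of H^0(E) in degree zero. It is not zero: a nonzero local section of E extends to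
some twist, because E is torsion-free, and M is generated in degree zero.

The rest is algebra over the fixed ring R, whose degree zero part is a field by projective
normality. Having a linear resolution means that every finite stage of the minimal resolution is
linear (`isKoszulModule_iff`). For x of degree one that is a nonzerodivisor on both R and M, each
stage is linear for M exactly when it is linear for M / xM (`IsRegularQuotient.isLinearUpTo_iff`);
morally, a minimal resolution of M / xM is the cone of x on one of M. Dividing by the forms one at a
time replaces M by Q. As R₊ kills Q, it is a nonempty direct sum of copies of R / R₊
(`isLinearUpTo_iff_of_concentrated`), so Q is Koszul if and only if R / R₊ is. -/

/-- A grading of an `R`-module, given by the projections onto its homogeneous parts. -/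
structure ModuleGrading (M : Type) [AddCommGroup M] [Module R M] where
  /-- the projection onto the part of degree `i` -/
  proj : ℕ → M →+ M
  proj_proj : ∀ i j m, proj i (proj j m) = if i = j then proj j m else 0
  exists_sum : ∀ m, ∃ n, ∀ k ≥ n, ∑ i ∈ Finset.range k, proj i m = m
  proj_smul_add : ∀ {a : ℕ} {r : R}, r ∈ 𝒜 a → ∀ i m, proj (a + i) (r • m) = r • proj i m
  proj_smul_of_lt : ∀ {a : ℕ} {r : R}, r ∈ 𝒜 a → ∀ j < a, ∀ m, proj j (r • m) = 0

/-- A grading of the ring `R` whose part of degree zero is a field. -/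
structure RingGrading extends ModuleGrading 𝒜 R where
  mem_iff : ∀ {i r}, r ∈ 𝒜 i ↔ proj i r = r
  one_mem : (1 : R) ∈ 𝒜 0
  exists_inv : ∀ r ∈ 𝒜 0, r ≠ 0 → ∃ s ∈ 𝒜 0, r * s = 1

variable {𝒜}

namespace ModuleGrading

variable {M M' : Type} [AddCommGroup M] [Module R M] [AddCommGroup M'] [Module R M']
  (G : ModuleGrading 𝒜 M) (G' : ModuleGrading 𝒜 M')

theorem proj_self {i : ℕ} (m : M) : G.proj i (G.proj i m) = G.proj i m := by
  rw [G.proj_proj, if_pos rfl]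

theorem proj_of_ne {i j : ℕ} (h : i ≠ j) (m : M) : G.proj i (G.proj j m) = 0 := by
  rw [G.proj_proj, if_neg h]

theorem mem_of_proj_mem {S : Type} [SetLike S M] [AddSubmonoidClass S M] (N : S) {m : M}
    (h : ∀ i, G.proj i m ∈ N) : m ∈ N := by
  obtain ⟨n, hn⟩ := G.exists_sum m
  rw [← hn n le_rfl]
  exact sum_mem fun i _ ↦ h i

theorem ext_proj {m m' : M} (h : ∀ i, G.proj i m = G.proj i m') : m = m' := by
  rw [← sub_eq_zero]
  have := G.mem_of_proj_mem (⊥ : AddSubgroup M) (m := m - m') fun i ↦ by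
    rw [AddSubgroup.mem_bot, map_sub, h, sub_self]
  rwa [AddSubgroup.mem_bot] at this

/-- A surjection whose kernel is homogeneous transports a grading. -/
def ofSurjective (φ : M →ₗ[R] M') (hφ : Function.Surjective φ)
    (hker : ∀ i m, φ m = 0 → φ (G.proj i m) = 0) : ModuleGrading 𝒜 M' :=
  let P : ℕ → M' →+ M' := fun i ↦ φ.toAddMonoidHom.liftOfSurjective hφ
    ⟨φ.toAddMonoidHom.comp (G.proj i), fun m hm ↦ hker i m hm⟩
  have hP : ∀ i m, P i (φ m) = φ (G.proj i m) := fun i m ↦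
    φ.toAddMonoidHom.liftOfRightInverse_comp_apply _ (Function.rightInverse_surjInv hφ)
      ⟨φ.toAddMonoidHom.comp (G.proj i), fun m hm ↦ hker i m hm⟩ m
  { proj := P
    proj_proj := fun i j m ↦ by
      obtain ⟨m, rfl⟩ := hφ m
      rw [hP, hP, G.proj_proj]
      split_ifs <;> simp
    exists_sum := fun m ↦ by
      obtain ⟨m, rfl⟩ := hφ m
      obtain ⟨n, hn⟩ := G.exists_sum m
      refine ⟨n, fun k hk ↦ ?_⟩
      simp only [hP]
      rw [← map_sum, hn k hk]
    proj_smul_add := fun hr i m ↦ by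
      obtain ⟨m, rfl⟩ := hφ m
      rw [← map_smul, hP, hP, G.proj_smul_add hr, map_smul]
    proj_smul_of_lt := fun hr i hi m ↦ by
      obtain ⟨m, rfl⟩ := hφ m
      rw [← map_smul, hP, G.proj_smul_of_lt hr i hi, map_zero] }

theorem ofSurjective_proj (φ : M →ₗ[R] M') (hφ : Function.Surjective φ)
    (hker : ∀ i m, φ m = 0 → φ (G.proj i m) = 0) (i : ℕ) (m : M) :
    (G.ofSurjective φ hφ hker).proj i (φ m) = φ (G.proj i m) :=
  φ.toAddMonoidHom.liftOfRightInverse_comp_apply _ (Function.rightInverse_surjInv hφ)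
    ⟨φ.toAddMonoidHom.comp (G.proj i), fun m hm ↦ hker i m hm⟩ m

/-- The grading, shifted by one, of a homogeneous submodule without part of degree zero. -/
def restrictShift (N : Submodule R M) (hN : ∀ i, ∀ m ∈ N, G.proj i m ∈ N)
    (h0 : ∀ m ∈ N, G.proj 0 m = 0) : ModuleGrading 𝒜 N where
  proj i := ((G.proj (i + 1)).comp N.subtype.toAddMonoidHom).codRestrict N
    fun m ↦ hN _ _ m.2
  proj_proj i j m := by
    apply Subtype.ext
    change G.proj (i + 1) (G.proj (j + 1) m) = _
    rw [G.proj_proj]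
    by_cases h : i = j
    · subst h; simp
    · simp [h]
  exists_sum m := by
    obtain ⟨n, hn⟩ := G.exists_sum m
    refine ⟨n, fun k hk ↦ Subtype.ext ?_⟩
    have := hn (k + 1) (by omega)
    rw [Finset.sum_range_succ', h0 _ m.2, add_zero] at this
    rw [AddSubmonoidClass.coe_finsetSum]
    exact this
  proj_smul_add {a r} hr i m := Subtype.ext (G.proj_smul_add hr (i + 1) (m : M))
  proj_smul_of_lt {a r} hr j hj m := by
    apply Subtype.ext
    change G.proj (j + 1) (r • (m : M)) = 0
    rcases (Nat.succ_le_of_lt hj).lt_or_eq with h | h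
    · exact G.proj_smul_of_lt hr _ h _
    · subst h
      have := G.proj_smul_add hr 0 (m : M)
      rwa [h0 _ m.2, smul_zero] at this

/-- The grading of a direct sum of copies of a graded module. -/
def finsupp (J : Type) : ModuleGrading 𝒜 (J →₀ M) where
  proj i := Finsupp.mapRange.addMonoidHom (G.proj i)
  proj_proj i j m := by
    ext b
    simp only [Finsupp.mapRange.addMonoidHom_apply, Finsupp.mapRange_apply, G.proj_proj]
    split_ifs <;> simp
  exists_sum m := by
    induction m using Finsupp.induction_linear with
    | zero => exact ⟨0, fun k _ ↦ by simp⟩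
    | add m m' h h' =>
      obtain ⟨n, hn⟩ := h
      obtain ⟨n', hn'⟩ := h'
      refine ⟨max n n', fun k hk ↦ ?_⟩
      simp only [map_add]
      rw [Finset.sum_add_distrib, hn k (le_of_max_le_left hk), hn' k (le_of_max_le_right hk)]
    | single b m =>
      obtain ⟨n, hn⟩ := G.exists_sum m
      refine ⟨n, fun k hk ↦ ?_⟩
      simp only [Finsupp.mapRange.addMonoidHom_apply, Finsupp.mapRange_single]
      rw [← Finsupp.single_finsetSum, hn k hk]
  proj_smul_add {a r} hr i m := by ext b; simp [G.proj_smul_add hr]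
  proj_smul_of_lt {a r} hr j hj m := by ext b; simp [G.proj_smul_of_lt hr j hj]

@[simp] theorem finsupp_proj_apply (J : Type) (i : ℕ) (m : J →₀ M) (b : J) :
    (G.finsupp J).proj i m b = G.proj i (m b) := rfl

end ModuleGrading

namespace RingGrading

variable (ρ : RingGrading 𝒜)
include ρ

theorem proj_mem (i : ℕ) (r : R) : ρ.proj i r ∈ 𝒜 i := ρ.mem_iff.2 (ρ.proj_self r)

theorem mul_mem {a b : ℕ} {r s : R} (hr : r ∈ 𝒜 a) (hs : s ∈ 𝒜 b) : r * s ∈ 𝒜 (a + b) := by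
  rw [ρ.mem_iff] at hs ⊢
  have := ρ.proj_smul_add hr b s
  rwa [hs] at this

theorem proj_smul {M : Type} [AddCommGroup M] [Module R M] (G : ModuleGrading 𝒜 M) {m : M}
    (hm : G.proj 0 m = m) (i : ℕ) (r : R) : G.proj i (r • m) = ρ.proj i r • m := by
  obtain ⟨n, hn⟩ := ρ.exists_sum r
  have hr := hn (max n (i + 1)) (le_max_left _ _)
  conv_lhs => rw [← hr, Finset.sum_smul, map_sum]
  rw [Finset.sum_eq_single_of_mem i (Finset.mem_range.2 (by omega))]
  · have := G.proj_smul_add (ρ.proj_mem i r) 0 m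
    rwa [hm, add_zero] at this
  · intro j _ hj
    rcases lt_or_gt_of_ne hj with h | h
    · obtain ⟨c, rfl⟩ := Nat.exists_eq_add_of_lt h
      rw [add_assoc, G.proj_smul_add (ρ.proj_mem j r), ← hm, G.proj_of_ne (by omega), smul_zero]
    · exact G.proj_smul_of_lt (ρ.proj_mem j r) i h m

/-- Generators of degree zero make the map from the free module degree-preserving. Almost every
degree argument about relations goes through this. -/
theorem proj_linearCombination {M : Type} [AddCommGroup M] [Module R M] (G : ModuleGrading 𝒜 M)
    {ι : Type} {e : ι → M} (he : ∀ b, G.proj 0 (e b) = e b) (i : ℕ) (f : ι →₀ R) :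
    G.proj i (Finsupp.linearCombination R e f) =
      Finsupp.linearCombination R e ((ρ.finsupp ι).proj i f) := by
  induction f using Finsupp.induction_linear with
  | zero => simp
  | add f g hf hg => simp only [map_add, hf, hg]
  | single b r =>
    have : (ρ.finsupp ι).proj i (Finsupp.single b r) = Finsupp.single b (ρ.proj i r) :=
      Finsupp.mapRange_single (hf := map_zero _)
    rw [this, Finsupp.linearCombination_single, Finsupp.linearCombination_single,
      ρ.proj_smul G (he b)]

theorem finsupp_proj_eq_iff {ι : Type} {i : ℕ} {f : ι →₀ R} :
    (ρ.finsupp ι).proj i f = f ↔ ∀ b, f b ∈ 𝒜 i := by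
  simp only [DFunLike.ext_iff, ModuleGrading.finsupp_proj_apply, ρ.mem_iff]

end RingGrading

/-- A basis over `R₀` of the part of degree zero of a graded module. -/
structure IsDegreeZeroBasis {M : Type} [AddCommGroup M] [Module R M] (G : ModuleGrading 𝒜 M)
    {ι : Type} (e : ι → M) : Prop where
  deg : ∀ b, G.proj 0 (e b) = e b
  span : ∀ m, G.proj 0 m = m →
    ∃ f : ι →₀ R, (∀ b, f b ∈ 𝒜 0) ∧ Finsupp.linearCombination R e f = m
  indep : ∀ f : ι →₀ R, (∀ b, f b ∈ 𝒜 0) → Finsupp.linearCombination R e f = 0 → f = 0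

/-- The relations between the elements of a family. -/
abbrev syzygies (R : Type) [CommRing R] {M : Type} [AddCommGroup M] [Module R M] {ι : Type} (e : ι → M) :
    Submodule R (ι →₀ R) := LinearMap.ker (Finsupp.linearCombination R e)

/-! ### Truncated linearity of the minimal resolution, and its independence of bases -/

section Lin

variable (ρ : RingGrading 𝒜)

/-- The module of relations between the elements of a basis of the part of degree zero, graded
such that the relations with coefficients of degree one have degree zero. -/
def syzygyGrading {M : Type} [AddCommGroup M] [Module R M] {G : ModuleGrading 𝒜 M}
    {ι : Type} {e : ι → M} (he : IsDegreeZeroBasis G e) : ModuleGrading 𝒜 (syzygies R e) :=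
  (ρ.finsupp ι).restrictShift (syzygies R e)
    (fun i f hf ↦ by
      rw [LinearMap.mem_ker] at hf ⊢
      rw [← ρ.proj_linearCombination G he.deg, hf, map_zero])
    (fun f hf ↦ by
      rw [LinearMap.mem_ker] at hf
      refine he.indep _ (fun b ↦ ρ.proj_mem _ _) ?_
      rw [← ρ.proj_linearCombination G he.deg, hf, map_zero])

theorem coe_syzygyGrading_proj {M : Type} [AddCommGroup M] [Module R M] {G : ModuleGrading 𝒜 M}
    {ι : Type} {e : ι → M} (he : IsDegreeZeroBasis G e) (i : ℕ) (f : syzygies R e) :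
    ((syzygyGrading ρ he).proj i f : ι →₀ R) = (ρ.finsupp ι).proj (i + 1) f := rfl

/-- The graded module `M` is generated in degree zero. -/
def IsGeneratedInDegreeZero {M : Type} [AddCommGroup M] [Module R M] (G : ModuleGrading 𝒜 M) :
    Prop := Submodule.span R {m | G.proj 0 m = m} = ⊤

/-- The first `p` steps of the minimal free resolution of `M` are linear. -/
def IsLinearUpTo : ℕ → ∀ {M : Type} [AddCommGroup M] [Module R M], ModuleGrading 𝒜 M → Prop
  | 0, _, _, _, G => IsGeneratedInDegreeZero G
  | p + 1, M, _, _, G => IsGeneratedInDegreeZero G ∧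
      ∃ (ι : Type) (e : ι → M) (he : IsDegreeZeroBasis G e), IsLinearUpTo p (syzygyGrading ρ he)

variable {M M' : Type} [AddCommGroup M] [Module R M] [AddCommGroup M'] [Module R M']
  {G : ModuleGrading 𝒜 M} {G' : ModuleGrading 𝒜 M'}

theorem isGeneratedInDegreeZero_iff {ι : Type} {e : ι → M} (he : IsDegreeZeroBasis G e) :
    IsGeneratedInDegreeZero G ↔ Function.Surjective (Finsupp.linearCombination R e) := by
  rw [← LinearMap.range_eq_top, Finsupp.range_linearCombination, IsGeneratedInDegreeZero]
  suffices h : Submodule.span R {m | G.proj 0 m = m} = Submodule.span R (Set.range e) by rw [h]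
  apply le_antisymm
  · rw [Submodule.span_le]
    intro m hm
    obtain ⟨f, -, rfl⟩ := he.span m hm
    rw [← Finsupp.range_linearCombination]
    exact ⟨f, rfl⟩
  · apply Submodule.span_mono
    rintro _ ⟨b, rfl⟩
    exact he.deg b

-- The part of degree zero is a vector space over the field R₀. The zero ring also satisfies
-- `RingGrading`, vacuously, and has to be treated apart, with the empty family.
include ρ in
theorem exists_isDegreeZeroBasis (G : ModuleGrading 𝒜 M) :
    ∃ (ι : Type) (e : ι → M), IsDegreeZeroBasis G e := by
  let K : Subring R :=
    { carrier := 𝒜 0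
      mul_mem' := fun ha hb ↦ by simpa using ρ.mul_mem ha hb
      one_mem' := ρ.one_mem
      add_mem' := add_mem
      zero_mem' := zero_mem _
      neg_mem' := neg_mem }
  by_cases hR : Nontrivial R
  swap
  · have : Subsingleton R := not_nontrivial_iff_subsingleton.1 hR
    have : Subsingleton M := Module.subsingleton R M
    exact ⟨Empty, Empty.elim, nofun, fun m _ ↦ ⟨0, nofun, Subsingleton.elim _ _⟩,
      fun _ _ _ ↦ Subsingleton.elim _ _⟩
  have hK : IsField K :=
    { exists_pair_ne := ⟨0, 1, fun h ↦ zero_ne_one (congrArg Subtype.val h)⟩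
      mul_comm := mul_comm
      mul_inv_cancel := fun {a} ha ↦ by
        obtain ⟨s, hs, h⟩ := ρ.exists_inv a a.2 fun h ↦ ha (Subtype.ext h)
        exact ⟨⟨s, hs⟩, Subtype.ext h⟩ }
  let _ : Field K := hK.toField
  let M0 : Submodule K M :=
    { carrier := {m | G.proj 0 m = m}
      add_mem' := fun ha hb ↦ by
        rw [Set.mem_ofPred_eq] at ha hb ⊢
        rw [map_add, ha, hb]
      zero_mem' := map_zero _
      smul_mem' := fun c m hm ↦ by
        rw [Set.mem_ofPred_eq] at hm ⊢
        change G.proj 0 ((c : R) • m) = (c : R) • m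
        have := G.proj_smul_add (a := 0) (r := c) c.2 0 m
        rwa [hm] at this }
  let b := Module.Basis.ofVectorSpace K M0
  have hlin : ∀ g : Module.Basis.ofVectorSpaceIndex K M0 →₀ K,
      Finsupp.linearCombination R (fun i ↦ (b i : M))
        (Finsupp.mapRange.addMonoidHom K.subtype.toAddMonoidHom g) =
      (Finsupp.linearCombination K b g : M0) := by
    intro g
    induction g using Finsupp.induction_linear with
    | zero => simp
    | add f g hf hg => simp only [map_add, hf, hg, Submodule.coe_add]
    | single i c =>
      rw [Finsupp.linearCombination_single, Finsupp.mapRange.addMonoidHom_apply,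
        Finsupp.mapRange_single, Finsupp.linearCombination_single]
      rfl
  refine ⟨_, fun i ↦ b i, fun i ↦ (b i).2, fun m hm ↦ ?_, fun f hf h ↦ ?_⟩
  · refine ⟨Finsupp.mapRange.addMonoidHom K.subtype.toAddMonoidHom (b.repr ⟨m, hm⟩),
      fun i ↦ (b.repr ⟨m, hm⟩ i).2, ?_⟩
    rw [hlin, b.linearCombination_repr]
  · let g : Module.Basis.ofVectorSpaceIndex K M0 →₀ K :=
      Finsupp.onFinset f.support (fun i ↦ ⟨f i, hf i⟩) fun i hi ↦ by
        rw [Finsupp.mem_support_iff]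
        exact fun h ↦ hi (Subtype.ext h)
    have hg : Finsupp.mapRange.addMonoidHom K.subtype.toAddMonoidHom g = f := by
      ext i; rfl
    have h0 := hlin g
    rw [hg, h] at h0
    have h1 : g = 0 := b.linearIndependent (Subtype.ext (h0.symm.trans (by simp)))
    rw [← hg, h1, map_zero]

variable {ρ} in
theorem IsLinearUpTo.isGenerated {p : ℕ} (h : IsLinearUpTo ρ p G) : IsGeneratedInDegreeZero G := by
  cases p with
  | zero => exact h
  | succ p => exact h.1

theorem IsGeneratedInDegreeZero.of_surjective (h : IsGeneratedInDegreeZero G) (φ : M →ₗ[R] M')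
    (hs : Function.Surjective φ) (hφ : ∀ i m, φ (G.proj i m) = G'.proj i (φ m)) :
    IsGeneratedInDegreeZero G' := by
  rw [IsGeneratedInDegreeZero, eq_top_iff] at h ⊢
  rintro m' -
  obtain ⟨m, rfl⟩ := hs m'
  have h1 := Submodule.mem_map_of_mem (f := φ) (h (x := m) trivial)
  rw [Submodule.map_span] at h1
  refine Submodule.span_mono ?_ h1
  rintro _ ⟨m, hm, rfl⟩
  change G'.proj 0 (φ m) = φ m
  rw [← hφ, hm]

theorem linearCombination_comp (φ : M →ₗ[R] M') {ι : Type} (e : ι → M) (f : ι →₀ R) :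
    Finsupp.linearCombination R (φ ∘ e) f = φ (Finsupp.linearCombination R e f) :=
  (Finsupp.apply_linearCombination R φ e f).symm

/-- The image of a basis under the isomorphism has literally the same relations, so the induction
continues along an equality of submodules. -/
theorem IsLinearUpTo.of_equiv {p : ℕ} (h : IsLinearUpTo ρ p G) (φ : M ≃ₗ[R] M')
    (hφ : ∀ i m, φ (G.proj i m) = G'.proj i (φ m)) : IsLinearUpTo ρ p G' := by
  have h0 : IsGeneratedInDegreeZero G' := h.isGenerated.of_surjective φ.toLinearMap φ.surjective hφ
  induction p generalizing M M' with
  | zero => exact h0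
  | succ p ih =>
    obtain ⟨-, ι, e, he, hp⟩ := h
    have hlin := linearCombination_comp φ.toLinearMap e
    have he' : IsDegreeZeroBasis G' (φ.toLinearMap ∘ e) :=
      { deg := fun b ↦ by
          rw [Function.comp_apply]
          exact (hφ _ _).symm.trans (congrArg φ (he.deg b))
        span := fun m hm ↦ by
          obtain ⟨f, hf, hfm⟩ := he.span (φ.symm m) (φ.injective (by simp [hφ, hm]))
          refine ⟨f, hf, ?_⟩
          rw [hlin, hfm]
          exact φ.apply_symm_apply m
        indep := fun f hf h ↦ he.indep f hf (φ.injective (by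
          rw [map_zero, ← h, hlin]; rfl)) }
    have hs : syzygies R e = syzygies R (φ.toLinearMap ∘ e) := by
      ext f
      rw [LinearMap.mem_ker, LinearMap.mem_ker, hlin]
      exact (map_eq_zero_iff φ φ.injective).symm
    have hψ : ∀ i f, LinearEquiv.ofEq _ _ hs ((syzygyGrading ρ he).proj i f) =
        (syzygyGrading ρ he').proj i (LinearEquiv.ofEq _ _ hs f) := fun i f ↦ rfl
    exact ⟨h0, ι, _, he', ih hp (LinearEquiv.ofEq _ _ hs) hψ
      (hp.isGenerated.of_surjective _ (LinearEquiv.ofEq _ _ hs).surjective hψ)⟩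

/-- The modules of relations for two bases of the part of degree zero are isomorphic. -/
theorem exists_syzygies_equiv {ι ι' : Type} {e : ι → M} {e' : ι' → M}
    (he : IsDegreeZeroBasis G e) (he' : IsDegreeZeroBasis G e') :
    ∃ φ : syzygies R e ≃ₗ[R] syzygies R e',
      ∀ i f, φ ((syzygyGrading ρ he).proj i f) = (syzygyGrading ρ he').proj i (φ f) := by
  choose c hc hce using fun b ↦ he'.span (e b) (he.deg b)
  choose c' hc' hce' using fun b ↦ he.span (e' b) (he'.deg b)
  have key : ∀ {ι ι' : Type} {e : ι → M} {e' : ι' → M} (c : ι → ι' →₀ R)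
      (_ : ∀ b, Finsupp.linearCombination R e' (c b) = e b) (f : ι →₀ R),
      Finsupp.linearCombination R e' (Finsupp.linearCombination R c f) =
        Finsupp.linearCombination R e f := by
    intro ι ι' e e' c hc f
    rw [Finsupp.apply_linearCombination]
    congr 2
    exact funext hc
  -- The matrices `c` and `c'` have entries in R₀. Hence the round trip differs from the identity by
  -- vectors with entries in R₀ that are relations, and such relations are zero.
  have inv : ∀ {ι ι' : Type} {e : ι → M} {e' : ι' → M} (_ : IsDegreeZeroBasis G e)
      (c : ι → ι' →₀ R) (c' : ι' → ι →₀ R)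
      (_ : ∀ b, Finsupp.linearCombination R e' (c b) = e b) (_ : ∀ b a, c b a ∈ 𝒜 0)
      (_ : ∀ b, Finsupp.linearCombination R e (c' b) = e' b) (_ : ∀ b a, c' b a ∈ 𝒜 0)
      (f : ι →₀ R), Finsupp.linearCombination R c' (Finsupp.linearCombination R c f) = f := by
    intro ι ι' e e' he c c' hce hc hce' hc' f
    suffices h : Finsupp.linearCombination R c' ∘ₗ Finsupp.linearCombination R c =
      LinearMap.id from LinearMap.congr_fun h f
    ext1 b
    ext1
    simp only [LinearMap.comp_apply, Finsupp.lsingle_apply, Finsupp.linearCombination_single,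
      one_smul, LinearMap.id_apply]
    rw [← sub_eq_zero]
    refine he.indep _ (ρ.finsupp_proj_eq_iff.1 ?_) ?_
    · rw [map_sub, ρ.proj_linearCombination (ρ.finsupp ι) fun b ↦
        ρ.finsupp_proj_eq_iff.2 (hc' b), ρ.finsupp_proj_eq_iff.2 (hc b)]
      congr 1
      refine (ρ.finsupp_proj_eq_iff).2 fun a ↦ ?_
      classical rw [Finsupp.single_apply]
      split_ifs
      exacts [ρ.one_mem, zero_mem _]
    · rw [map_sub, key c' hce', hce, Finsupp.linearCombination_single, one_smul, sub_self]
  let Φ := (Finsupp.linearCombination R c).restrict (p := syzygies R e) (q := syzygies R e')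
    fun f hf ↦ by rw [LinearMap.mem_ker] at hf ⊢; rw [key c hce, hf]
  let Ψ := (Finsupp.linearCombination R c').restrict (p := syzygies R e') (q := syzygies R e)
    fun f hf ↦ by rw [LinearMap.mem_ker] at hf ⊢; rw [key c' hce', hf]
  refine ⟨LinearEquiv.ofLinearMap Φ Ψ ?_ ?_, fun i f ↦ ?_⟩
  · ext1 f
    exact Subtype.ext (inv he' c' c hce' hc' hce hc f)
  · ext1 f
    exact Subtype.ext (inv he c c' hce hc hce' hc' f)
  · apply Subtype.ext
    change Finsupp.linearCombination R c ((ρ.finsupp ι).proj (i + 1) f) =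
      (ρ.finsupp ι').proj (i + 1) (Finsupp.linearCombination R c f)
    rw [ρ.proj_linearCombination (ρ.finsupp ι') fun b ↦ ρ.finsupp_proj_eq_iff.2 (hc b)]

/-- The definition only asks for some basis; by `exists_syzygies_equiv` any prescribed one may be
used instead. -/
theorem isLinearUpTo_succ_iff {p : ℕ} {ι : Type} {e : ι → M} (he : IsDegreeZeroBasis G e) :
    IsLinearUpTo ρ (p + 1) G ↔
      IsGeneratedInDegreeZero G ∧ IsLinearUpTo ρ p (syzygyGrading ρ he) := by
  refine ⟨fun ⟨h0, ι', e', he', hp⟩ ↦ ⟨h0, ?_⟩, fun ⟨h0, hp⟩ ↦ ⟨h0, ι, e, he, hp⟩⟩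
  obtain ⟨φ, hφ⟩ := exists_syzygies_equiv ρ he' he
  exact hp.of_equiv ρ φ hφ

end Lin

end GradedAlgebra

end UlrichKoszul

end

noncomputable section

namespace UlrichKoszul

section GradedAlgebra

variable {R : Type} [CommRing R] {𝒜 : ℕ → AddSubgroup R} (ρ : RingGrading 𝒜)

/-! ### Direct sums of copies of a graded module -/

theorem syzygies_finsupp_mem_iff {N : Type} [AddCommGroup N] [Module R N] {J ι : Type} (e : ι → N)
    (f : J × ι →₀ R) :
    f ∈ syzygies R (fun a : J × ι ↦ Finsupp.single a.1 (e a.2)) ↔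
      ∀ j, f.curry j ∈ syzygies R e := by
  have h : ∀ f : J × ι →₀ R, ∀ j,
      Finsupp.linearCombination R (fun a : J × ι ↦ Finsupp.single a.1 (e a.2)) f j =
        Finsupp.linearCombination R e (f.curry j) := by
    intro f j
    induction f using Finsupp.induction_linear with
    | zero =>
      have : (0 : J × ι →₀ R).curry j = 0 := rfl
      rw [this, map_zero, map_zero, Finsupp.zero_apply]
    | add f g hf hg =>
      have : (f + g).curry j = f.curry j + g.curry j := Finsupp.ext fun b ↦ rfl
      rw [this, map_add, map_add, Finsupp.add_apply, hf, hg]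
    | single a r =>
      classical
      rw [Finsupp.curry_single, Finsupp.linearCombination_single, Finsupp.smul_apply,
        Finsupp.single_apply, Finsupp.single_apply]
      split_ifs <;> simp
  simp only [LinearMap.mem_ker, DFunLike.ext_iff, h, Finsupp.zero_apply]

theorem IsDegreeZeroBasis.finsupp {N : Type} [AddCommGroup N] [Module R N]
    {G : ModuleGrading 𝒜 N} {ι : Type} {e : ι → N} (he : IsDegreeZeroBasis G e) (J : Type) :
    IsDegreeZeroBasis (G.finsupp J) (fun a : J × ι ↦ Finsupp.single a.1 (e a.2)) where
  deg a := (Finsupp.mapRange_single (hf := map_zero _)).trans (by rw [he.deg])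
  span m hm := by
    have hm' : ∀ j, G.proj 0 (m j) = m j := fun j ↦ DFunLike.congr_fun hm j
    clear hm
    induction m using Finsupp.induction with
    | zero => exact ⟨0, by simp, by simp⟩
    | single_add j n m hj hn ih =>
      have hmj : m j = 0 := Finsupp.notMem_support_iff.1 hj
      obtain ⟨f, hf, rfl⟩ := ih fun i ↦ by
        by_cases hij : i = j
        · subst hij; rw [hmj, map_zero]
        · have := hm' i
          rwa [Finsupp.add_apply, Finsupp.single_eq_of_ne hij, zero_add] at this
      have hjn := hm' j
      rw [Finsupp.add_apply, Finsupp.single_eq_same, hmj, add_zero] at hjn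
      obtain ⟨g, hg, hgn⟩ := he.span n hjn
      refine ⟨g.embDomain ⟨fun b ↦ (j, b), fun _ _ h ↦ (Prod.ext_iff.1 h).2⟩ + f, fun a ↦ ?_, ?_⟩
      · rw [Finsupp.add_apply]
        refine add_mem ?_ (hf a)
        by_cases ha : a ∈ Set.range fun b ↦ (j, b)
        · obtain ⟨b, rfl⟩ := ha
          have := Finsupp.embDomain_apply_self
            ⟨fun b : ι ↦ (j, b), fun _ _ h ↦ (Prod.ext_iff.1 h).2⟩ g b
          exact this.symm ▸ hg b
        · rw [Finsupp.embDomain_of_notMem_range _ _ _ ha]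
          exact zero_mem _
      · rw [map_add, Finsupp.linearCombination_embDomain, ← hgn,
          ← Finsupp.lsingle_apply (R := R), Finsupp.apply_linearCombination]
        rfl
  indep f hf h := by
    have h' := (syzygies_finsupp_mem_iff e f).1 h
    ext ⟨j, b⟩
    have := he.indep (f.curry j) (fun b ↦ hf (j, b)) (h' j)
    exact DFunLike.congr_fun this b

theorem exists_syzygies_finsupp_equiv {N : Type} [AddCommGroup N] [Module R N]
    {G : ModuleGrading 𝒜 N} {ι : Type} {e : ι → N} (he : IsDegreeZeroBasis G e) (J : Type) :
    ∃ φ : syzygies R (fun a : J × ι ↦ Finsupp.single a.1 (e a.2)) ≃ₗ[R] (J →₀ syzygies R e),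
      ∀ i f, φ ((syzygyGrading ρ (he.finsupp J)).proj i f) =
        ((syzygyGrading ρ he).finsupp J).proj i (φ f) := by
  let φ : syzygies R (fun a : J × ι ↦ Finsupp.single a.1 (e a.2)) → (J →₀ syzygies R e) :=
    fun f ↦ Finsupp.onFinset f.1.curry.support
      (fun j ↦ ⟨f.1.curry j, (syzygies_finsupp_mem_iff e f.1).1 f.2 j⟩) fun j hj ↦ by
        rw [Finsupp.mem_support_iff]
        exact fun h ↦ hj (Subtype.ext h)
  have hφ : ∀ f j b, (φ f j : ι →₀ R) b = f.1 (j, b) := fun f j b ↦ rfl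
  let ψ : syzygies R (fun a : J × ι ↦ Finsupp.single a.1 (e a.2)) →ₗ[R] (J →₀ syzygies R e) :=
    { toFun := φ
      map_add' := fun f g ↦ by ext j b; rfl
      map_smul' := fun r f ↦ by ext j b; rfl }
  refine ⟨LinearEquiv.ofBijective ψ ⟨fun f g h ↦ ?_, fun g ↦ ?_⟩, fun i f ↦ ?_⟩
  · ext ⟨j, b⟩
    exact DFunLike.congr_fun (congrArg Subtype.val (DFunLike.congr_fun h j)) b
  · let g' : J →₀ ι →₀ R := Finsupp.mapRange.linearMap (syzygies R e).subtype g
    refine ⟨⟨Finsupp.uncurry g', ?_⟩, ?_⟩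
    · rw [syzygies_finsupp_mem_iff]
      intro j
      rw [Finsupp.curry_uncurry]
      exact (g j).2
    · ext j b
      exact (hφ _ j b).trans (DFunLike.congr_fun (DFunLike.congr_fun
        (Finsupp.curry_uncurry g') j) b)
  · ext j b
    rfl

/-- Relations of a direct sum are the direct sum of the relations, which drives the induction. An
index must exist so that a coordinate projection recovers the single copy. -/
theorem isLinearUpTo_finsupp_iff {N : Type} [AddCommGroup N] [Module R N] (G : ModuleGrading 𝒜 N)
    (J : Type) [Nonempty J] (p : ℕ) : IsLinearUpTo ρ p (G.finsupp J) ↔ IsLinearUpTo ρ p G := by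
  have h0 : ∀ {N : Type} [AddCommGroup N] [Module R N] (G : ModuleGrading 𝒜 N),
      IsGeneratedInDegreeZero (G.finsupp J) ↔ IsGeneratedInDegreeZero G := by
    intro N _ _ G
    constructor
    · intro h
      exact h.of_surjective (Finsupp.lapply (Classical.arbitrary J))
        (fun n ↦ ⟨Finsupp.single (Classical.arbitrary J) n, by simp⟩) fun i m ↦ rfl
    · intro h
      rw [IsGeneratedInDegreeZero, eq_top_iff] at h ⊢
      rintro m -
      induction m using Finsupp.induction_linear with
      | zero => exact zero_mem _
      | add f g hf hg => exact add_mem hf hg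
      | single j n =>
        have h1 := Submodule.mem_map_of_mem (f := Finsupp.lsingle (R := R) j) (h (x := n) trivial)
        rw [Submodule.map_span] at h1
        refine Submodule.span_mono ?_ h1
        rintro _ ⟨m, hm, rfl⟩
        exact (Finsupp.mapRange_single (hf := map_zero _)).trans (congrArg (Finsupp.single j) hm)
  induction p generalizing N with
  | zero => exact h0 G
  | succ p ih =>
    obtain ⟨ι, e, he⟩ := exists_isDegreeZeroBasis ρ G
    rw [isLinearUpTo_succ_iff ρ he, isLinearUpTo_succ_iff ρ (he.finsupp J), h0]
    refine and_congr_right fun _ ↦ ?_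
    refine Iff.trans ?_ (ih (syzygyGrading ρ he))
    obtain ⟨φ, hφ⟩ := exists_syzygies_finsupp_equiv ρ he J
    refine ⟨fun h ↦ h.of_equiv ρ φ hφ, fun h ↦ h.of_equiv ρ φ.symm fun i f ↦ ?_⟩
    rw [LinearEquiv.symm_apply_eq, hφ, LinearEquiv.apply_symm_apply]

/-! ### Linear resolutions -/

/-- This is minimality: matrix entries of degree one leave nothing in degree zero of the image. -/
theorem LinearResolution.proj_zero_d (ρ : RingGrading 𝒜) {M : Type} [AddCommGroup M] [Module R M]
    {ℳ : ℕ → AddSubgroup M} (F : LinearResolution 𝒜 ℳ) (i : ℕ) (g : F.ι (i + 1) →₀ R) :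
    (ρ.finsupp (F.ι i)).proj 0 (F.d i g) = 0 := by
  induction g using Finsupp.induction_linear with
  | zero => simp
  | add f g hf hg => rw [map_add, map_add, hf, hg, add_zero]
  | single b r =>
    rw [← mul_one r, ← smul_eq_mul, ← Finsupp.smul_single, map_smul]
    ext c
    rw [ModuleGrading.finsupp_proj_apply, Finsupp.smul_apply, smul_eq_mul, mul_comm,
      ← smul_eq_mul]
    exact ρ.proj_smul_of_lt (F.d_degree i b c) 0 one_pos r

theorem LinearResolution.linearCombination_eq {M : Type} [AddCommGroup M] [Module R M]
    {ℳ : ℕ → AddSubgroup M} (F : LinearResolution 𝒜 ℳ) :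
    Finsupp.linearCombination R (fun b ↦ F.ε (Finsupp.single b 1)) = F.ε := by
  ext b; simp

-- Independence comes from minimality: a relation with coefficients in R₀ is in the image of the
-- first differential, which has no part of degree zero.
include ρ in
theorem LinearResolution.isDegreeZeroBasis {M : Type} [AddCommGroup M] [Module R M]
    {ℳ : ℕ → AddSubgroup M} (F : LinearResolution 𝒜 ℳ) {G : ModuleGrading 𝒜 M}
    (hG : ∀ m ∈ ℳ 0, G.proj 0 m = m) :
    IsDegreeZeroBasis G fun b ↦ F.ε (Finsupp.single b 1) where
  deg b := hG _ (F.ε_degree b)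
  span m hm := by
    obtain ⟨f, rfl⟩ := F.ε_surjective m
    refine ⟨(ρ.finsupp _).proj 0 f, fun b ↦ ρ.proj_mem _ _, ?_⟩
    rw [← ρ.proj_linearCombination G fun b ↦ hG _ (F.ε_degree b), F.linearCombination_eq, hm]
  indep f hf h := by
    rw [F.linearCombination_eq] at h
    obtain ⟨g, rfl⟩ := (F.exact_zero f).1 h
    rw [← ρ.finsupp_proj_eq_iff, F.proj_zero_d ρ] at hf
    exact hf.symm

/-- Cutting off the first free module leaves a linear resolution of the module of relations in its
shifted grading, and one recurses on `p`. -/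
theorem LinearResolution.isLinearUpTo {M : Type} [AddCommGroup M] [Module R M]
    {ℳ : ℕ → AddSubgroup M} (F : LinearResolution 𝒜 ℳ) (G : ModuleGrading 𝒜 M)
    (hG : ∀ m ∈ ℳ 0, G.proj 0 m = m) (p : ℕ) : IsLinearUpTo ρ p G := by
  have he := F.isDegreeZeroBasis ρ hG
  have hε := F.linearCombination_eq
  have h0 : IsGeneratedInDegreeZero G := by
    rw [isGeneratedInDegreeZero_iff he, hε]
    exact F.ε_surjective
  cases p with
  | zero => exact h0
  | succ p =>
    rw [isLinearUpTo_succ_iff ρ he]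
    refine ⟨h0, ?_⟩
    have hd : ∀ g, F.d 0 g ∈ syzygies R fun b ↦ F.ε (Finsupp.single b 1) := fun g ↦ by
      rw [LinearMap.mem_ker, hε]
      exact (F.exact_zero _).2 ⟨g, rfl⟩
    let F' : LinearResolution 𝒜 fun i ↦ ((syzygyGrading ρ he).proj i).range :=
      { ι := fun i ↦ F.ι (i + 1)
        d := fun i ↦ F.d (i + 1)
        ε := (F.d 0).codRestrict _ hd
        d_degree := fun i ↦ F.d_degree (i + 1)
        ε_degree := fun b ↦ ⟨(F.d 0).codRestrict _ hd (Finsupp.single b 1), Subtype.ext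
          (ρ.finsupp_proj_eq_iff.2 (F.d_degree 0 b))⟩
        ε_surjective := fun f ↦ by
          have hf := f.2
          rw [LinearMap.mem_ker, hε] at hf
          obtain ⟨g, hg⟩ := (F.exact_zero _).1 hf
          exact ⟨g, Subtype.ext hg⟩
        exact_zero := fun f ↦ by
          rw [← F.exact_succ 0 f, ← Submodule.coe_eq_zero]
          rfl
        exact_succ := fun i ↦ F.exact_succ (i + 1) }
    have hG' : ∀ m ∈ ((syzygyGrading ρ he).proj 0).range, (syzygyGrading ρ he).proj 0 m = m := by
      rintro _ ⟨m, rfl⟩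
      exact ModuleGrading.proj_self _ m
    exact F'.isLinearUpTo _ hG' p
  termination_by p

/-! ### Splicing iterated modules of relations into a resolution -/

/-- A graded module, all of whose minimal free resolution is linear. -/
structure LinearModule where
  /-- the underlying module -/
  M : Type
  [addCommGroup : AddCommGroup M]
  [module : Module R M]
  /-- the grading -/
  G : ModuleGrading 𝒜 M
  linear : ∀ p, IsLinearUpTo ρ p G

namespace LinearModule

attribute [instance] addCommGroup module

variable {ρ} (S : LinearModule ρ)

/-- The index set of a basis of the part of degree zero. -/
def index : Type := (exists_isDegreeZeroBasis ρ S.G).choose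

/-- A basis of the part of degree zero. -/
def basis : S.index → S.M := (exists_isDegreeZeroBasis ρ S.G).choose_spec.choose

theorem isDegreeZeroBasis : IsDegreeZeroBasis S.G S.basis :=
  (exists_isDegreeZeroBasis ρ S.G).choose_spec.choose_spec

/-- The module of relations. -/
def next : LinearModule ρ where
  M := syzygies R S.basis
  G := syzygyGrading ρ S.isDegreeZeroBasis
  linear p := ((isLinearUpTo_succ_iff ρ S.isDegreeZeroBasis).1 (S.linear (p + 1))).2

/-- The iterated modules of relations. -/
def iterate : ℕ → LinearModule ρ
  | 0 => S
  | n + 1 => (iterate n).next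

theorem surjective : Function.Surjective (Finsupp.linearCombination R S.basis) :=
  (isGeneratedInDegreeZero_iff S.isDegreeZeroBasis).1 (S.linear 0)

/-- The differential of the minimal free resolution. -/
def differential : (S.next.index →₀ R) →ₗ[R] (S.index →₀ R) :=
  (syzygies R S.basis).subtype ∘ₗ Finsupp.linearCombination R (M := syzygies R S.basis) S.next.basis

theorem exact_augmentation :
    Function.Exact S.differential (Finsupp.linearCombination R S.basis) := by
  intro f
  constructor
  · intro hf
    obtain ⟨g, hg⟩ := S.next.surjective ⟨f, hf⟩
    exact ⟨g, congrArg Subtype.val hg⟩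
  · rintro ⟨g, rfl⟩
    exact (Finsupp.linearCombination R (M := syzygies R S.basis) S.next.basis g).2

theorem exact_differential : Function.Exact S.next.differential S.differential := by
  intro f
  rw [← S.next.exact_augmentation f]
  exact Submodule.coe_eq_zero

theorem differential_single_mem (b : S.next.index) (c : S.index) :
    S.differential (Finsupp.single b 1) c ∈ 𝒜 1 := by
  revert c
  refine ρ.finsupp_proj_eq_iff.1 ?_
  have h1 : Finsupp.linearCombination R (M := syzygies R S.basis) S.next.basis
      (Finsupp.single b 1) = S.next.basis b :=
    (Finsupp.linearCombination_single R _ _).trans (one_smul R _)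
  have h2 := congrArg Subtype.val (S.next.isDegreeZeroBasis.deg b)
  have h3 : S.differential (Finsupp.single b 1) = (S.next.basis b : syzygies R S.basis).1 :=
    congrArg Subtype.val h1
  rw [h3]
  exact h2

theorem augmentation_single_mem (ℳ : ℕ → AddSubgroup S.M) (h : ∀ m, S.G.proj 0 m = m → m ∈ ℳ 0)
    (b : S.index) : Finsupp.linearCombination R S.basis (Finsupp.single b 1) ∈ ℳ 0 := by
  rw [Finsupp.linearCombination_single, one_smul]
  exact h _ (S.isDegreeZeroBasis.deg b)

/-- The minimal free resolution. -/
def resolution (ℳ : ℕ → AddSubgroup S.M) (h : ∀ m, S.G.proj 0 m = m → m ∈ ℳ 0) :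
    LinearResolution 𝒜 ℳ where
  ι n := (S.iterate n).index
  d n := (S.iterate n).differential
  ε := Finsupp.linearCombination R S.basis
  d_degree n b := (S.iterate n).differential_single_mem b
  ε_degree := S.augmentation_single_mem ℳ h
  ε_surjective := S.surjective
  exact_zero := S.exact_augmentation
  exact_succ n := (S.iterate n).exact_differential

end LinearModule

/-- A given resolution has to be the minimal one; conversely, when every stage is linear, the
iterated modules of relations splice into a resolution. This reduces Koszulness to statements that
can be proved by induction on `p`. -/
theorem isKoszulModule_iff {M : Type} [AddCommGroup M] [Module R M] (ℳ : ℕ → AddSubgroup M)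
    (G : ModuleGrading 𝒜 M) (hG : ∀ m, m ∈ ℳ 0 ↔ G.proj 0 m = m) :
    IsKoszulModule 𝒜 ℳ ↔ ∀ p, IsLinearUpTo ρ p G :=
  ⟨fun ⟨F⟩ p ↦ F.isLinearUpTo ρ G (fun m hm ↦ (hG m).1 hm) p,
    fun h ↦ ⟨LinearModule.resolution (ρ := ρ) { M := M, G := G, linear := h } ℳ
      fun m hm ↦ (hG m).2 hm⟩⟩

end GradedAlgebra

end UlrichKoszul

end

noncomputable section

namespace UlrichKoszul

section GradedAlgebra

variable {R : Type} [CommRing R] {𝒜 : ℕ → AddSubgroup R} (ρ : RingGrading 𝒜)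

/-! ### Reduction modulo a regular element of degree one -/

/-- The graded module `M'` is the quotient of the graded module `M` by `x M`, where `x` is of
degree one and a nonzerodivisor on `M` and on `R`. -/
structure IsRegularQuotient (x : R) {M M' : Type} [AddCommGroup M] [Module R M] [AddCommGroup M']
    [Module R M'] (G : ModuleGrading 𝒜 M) (G' : ModuleGrading 𝒜 M') (φ : M →ₗ[R] M') : Prop where
  mem : x ∈ 𝒜 1
  ring_regular : ∀ r : R, x * r = 0 → r = 0
  regular : ∀ m : M, x • m = 0 → m = 0
  surjective : Function.Surjective φ
  map_proj : ∀ i m, φ (G.proj i m) = G'.proj i (φ m)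
  eq_zero_iff : ∀ m, φ m = 0 ↔ ∃ m', x • m' = m

namespace IsRegularQuotient

variable {x : R} {M M' : Type} [AddCommGroup M] [Module R M] [AddCommGroup M']
  [Module R M'] {G : ModuleGrading 𝒜 M} {G' : ModuleGrading 𝒜 M'} {φ : M →ₗ[R] M'}
  (h : IsRegularQuotient x G G' φ)
include h

theorem proj_zero_eq_zero {m : M} (hm : φ m = 0) : G.proj 0 m = 0 := by
  obtain ⟨m, rfl⟩ := (h.eq_zero_iff m).1 hm
  exact G.proj_smul_of_lt h.mem 0 one_pos m

theorem eq_iff (a b : M) : φ a = φ b ↔ ∃ m', a + x • m' = b := by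
  rw [eq_comm, ← sub_eq_zero, ← map_sub, h.eq_zero_iff]
  simp only [eq_sub_iff_add_eq']

theorem proj_succ_smul (i : ℕ) (m : M) : G.proj (i + 1) (x • m) = x • G.proj i m := by
  rw [add_comm, G.proj_smul_add h.mem]

/-- Multiples of `x` start in degree one, so passing to the quotient does not change the part of
degree zero. -/
theorem isDegreeZeroBasis {ι : Type} {e : ι → M} (he : IsDegreeZeroBasis G e) :
    IsDegreeZeroBasis G' (φ ∘ e) where
  deg b := by rw [Function.comp_apply, ← h.map_proj, he.deg]
  span m' hm' := by
    obtain ⟨m, rfl⟩ := h.surjective m'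
    obtain ⟨f, hf, hfm⟩ := he.span _ (G.proj_self (i := 0) m)
    exact ⟨f, hf, by rw [linearCombination_comp, hfm, h.map_proj, hm']⟩
  indep f hf h0 := by
    refine he.indep f hf ?_
    rw [linearCombination_comp] at h0
    have h1 := h.proj_zero_eq_zero h0
    rw [← h1, Finsupp.linearCombination_apply, Finsupp.sum, map_sum]
    refine Finset.sum_congr rfl fun b _ ↦ ?_
    have := G.proj_smul_add (hf b) 0 (e b)
    rw [he.deg, add_zero] at this
    exact this.symm

-- Graded Nakayama: an element of degree d + 1 is, modulo the span of the basis, `x` times an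
-- element of degree d, to which the induction applies.
include ρ in
theorem isGenerated_iff : IsGeneratedInDegreeZero G ↔ IsGeneratedInDegreeZero G' := by
  refine ⟨fun hG ↦ hG.of_surjective φ h.surjective h.map_proj, fun hG' ↦ ?_⟩
  obtain ⟨ι, e, he⟩ := exists_isDegreeZeroBasis ρ G
  rw [isGeneratedInDegreeZero_iff (h.isDegreeZeroBasis he)] at hG'
  rw [isGeneratedInDegreeZero_iff he, ← LinearMap.range_eq_top, eq_top_iff]
  have key : ∀ d m, G.proj d m = m → m ∈ LinearMap.range (Finsupp.linearCombination R e) := by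
    intro d
    induction d with
    | zero =>
      intro m hm
      obtain ⟨f, -, rfl⟩ := he.span m hm
      exact ⟨f, rfl⟩
    | succ d ih =>
      intro m hm
      obtain ⟨f, hf⟩ := hG' (φ m)
      rw [linearCombination_comp, ← sub_eq_zero, ← map_sub, ← neg_eq_zero, ← map_neg, neg_sub,
        h.eq_zero_iff] at hf
      obtain ⟨m', hm'⟩ := hf
      have h1 := congrArg (G.proj (d + 1)) hm'
      rw [h.proj_succ_smul, map_sub, hm, ρ.proj_linearCombination G he.deg] at h1
      rw [← sub_add_cancel m (Finsupp.linearCombination R e ((ρ.finsupp ι).proj (d + 1) f)), ← h1]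
      exact add_mem (Submodule.smul_mem _ _ (ih _ (G.proj_self m'))) ⟨_, rfl⟩
  exact fun m _ ↦ G.mem_of_proj_mem _ fun d ↦ key d _ (G.proj_self m)

omit h in
theorem quotient (G : ModuleGrading 𝒜 M) (hx : x ∈ 𝒜 1)
    (hR : ∀ r : R, x * r = 0 → r = 0) (hM : ∀ m : M, x • m = 0 → m = 0) :
    ∃ G' : ModuleGrading 𝒜 (M ⧸ LinearMap.range (LinearMap.lsmul R M x)),
      IsRegularQuotient x G G' (Submodule.mkQ _) := by
  have hker : ∀ i m, (LinearMap.range (LinearMap.lsmul R M x)).mkQ m = 0 →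
      (LinearMap.range (LinearMap.lsmul R M x)).mkQ (G.proj i m) = 0 := by
    intro i m hm
    rw [Submodule.mkQ_apply, Submodule.Quotient.mk_eq_zero] at hm ⊢
    obtain ⟨m, rfl⟩ := hm
    cases i with
    | zero => exact (G.proj_smul_of_lt hx 0 one_pos m) ▸ zero_mem _
    | succ i =>
      refine ⟨G.proj i m, ?_⟩
      have := G.proj_smul_add hx i m
      rw [add_comm] at this
      exact this.symm
  refine ⟨G.ofSurjective _ (Submodule.mkQ_surjective _) hker, hx, hR, hM,
    Submodule.mkQ_surjective _, fun i m ↦ (G.ofSurjective_proj _ _ _ i m).symm, fun m ↦ ?_⟩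
  rw [Submodule.mkQ_apply, Submodule.Quotient.mk_eq_zero]
  rfl

/-! ### Relations modulo a regular element -/

variable {ι : Type} {e : ι → M}

theorem smul_single_mem (b : ι) : Finsupp.single b x ∈ syzygies R (φ ∘ e) := by
  rw [LinearMap.mem_ker, Finsupp.linearCombination_single, Function.comp_apply, ← map_smul,
    h.eq_zero_iff]
  exact ⟨_, rfl⟩

omit h in
theorem mem_syzygies_comp {f : ι →₀ R} (hf : f ∈ syzygies R e) : f ∈ syzygies R (φ ∘ e) := by
  rw [LinearMap.mem_ker] at hf ⊢
  rw [linearCombination_comp, hf, map_zero]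

/-- The family consisting of relations `u` between the elements of `e` and of the relations
`x [e b]` modulo `x M`. -/
def sumFamily {κ : Type} (u : κ → syzygies R e) : κ ⊕ ι → syzygies R (φ ∘ e) :=
  Sum.elim (fun k ↦ ⟨(u k).1, mem_syzygies_comp (u k).2⟩)
    (fun b ↦ ⟨Finsupp.single b x, h.smul_single_mem b⟩)

theorem coe_linearCombination_sumFamily {κ : Type} (u : κ → syzygies R e) (f : κ ⊕ ι →₀ R) :
    (Finsupp.linearCombination R (h.sumFamily u) f : ι →₀ R) =
      Finsupp.linearCombination R u (Finsupp.sumFinsuppLEquivProdFinsupp R f).1 +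
        x • (Finsupp.sumFinsuppLEquivProdFinsupp R f).2 := by
  have hl : ∀ (k : κ) (r : R), Finsupp.sumFinsuppLEquivProdFinsupp R
      (Finsupp.single (Sum.inl k : κ ⊕ ι) r) = (Finsupp.single k r, 0) := fun k r ↦ by
    classical
    refine Prod.ext (Finsupp.ext fun a ↦ ?_) (Finsupp.ext fun a ↦ ?_)
    · rw [Finsupp.fst_sumFinsuppLEquivProdFinsupp]
      simp [Finsupp.single_apply]
    · rw [Finsupp.snd_sumFinsuppLEquivProdFinsupp]
      simp
  have hr : ∀ (k : ι) (r : R), Finsupp.sumFinsuppLEquivProdFinsupp R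
      (Finsupp.single (Sum.inr k : κ ⊕ ι) r) = (0, Finsupp.single k r) := fun k r ↦ by
    classical
    refine Prod.ext (Finsupp.ext fun a ↦ ?_) (Finsupp.ext fun a ↦ ?_)
    · rw [Finsupp.fst_sumFinsuppLEquivProdFinsupp]
      simp
    · rw [Finsupp.snd_sumFinsuppLEquivProdFinsupp]
      simp [Finsupp.single_apply]
  induction f using Finsupp.induction_linear with
  | zero => simp
  | add f g hf hg =>
    simp only [map_add, Submodule.coe_add, hf, hg, smul_add, Prod.fst_add, Prod.snd_add]
    abel
  | single a r =>
    rw [Finsupp.linearCombination_single]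
    rcases a with k | b
    · rw [hl, Finsupp.linearCombination_single, smul_zero, add_zero]
      rfl
    · rw [hr, map_zero, Submodule.coe_zero, zero_add, Finsupp.smul_single, smul_eq_mul, mul_comm]
      change r • Finsupp.single b x = _
      rw [Finsupp.smul_single, smul_eq_mul]

theorem smul_finsupp_eq_zero {f : ι →₀ R} (hf : x • f = 0) : f = 0 := by
  ext b
  exact h.ring_regular _ (DFunLike.congr_fun hf b)

/-- With Syz the relations of `e` and F the free module, this is Syz ∩ xF = x Syz, which is where
regularity of `x` on M enters. -/
theorem mem_syzygies_of_smul {f : ι →₀ R} (hf : x • f ∈ syzygies R e) : f ∈ syzygies R e := by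
  rw [LinearMap.mem_ker] at hf ⊢
  rw [map_smul] at hf
  exact h.regular _ hf

variable (he : IsDegreeZeroBasis G e)

-- A relation modulo `x M` evaluates to `x` times some combination of `e`; subtracting `x` times its
-- coefficients gives an honest relation. So the relations of the quotient are Syz + xF.
include he in
theorem exists_decomposition (hG : IsGeneratedInDegreeZero G) (b : syzygies R (φ ∘ e)) :
    ∃ (a : syzygies R e) (f : ι →₀ R), b.1 = a.1 + x • f := by
  have := b.2
  rw [LinearMap.mem_ker, linearCombination_comp, h.eq_zero_iff] at this
  obtain ⟨m, hm⟩ := this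
  rw [isGeneratedInDegreeZero_iff he] at hG
  obtain ⟨f, rfl⟩ := hG m
  refine ⟨⟨b.1 - x • f, ?_⟩, f, (sub_add_cancel _ _).symm⟩
  rw [LinearMap.mem_ker, map_sub, map_smul, hm, sub_self]

/-- In coefficient degree one the sum Syz + xF is direct: if `x f` is a relation of `e` with `f`
over R₀, then so is `f`, and a basis has no such relation but zero. -/
theorem isDegreeZeroBasis_sumFamily {κ : Type} {u : κ → syzygies R e}
    (hu : IsDegreeZeroBasis (syzygyGrading ρ he) u) :
    IsDegreeZeroBasis (syzygyGrading ρ (h.isDegreeZeroBasis he)) (h.sumFamily u) where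
  deg a := by
    apply Subtype.ext
    rcases a with k | b
    · exact congrArg (fun a : syzygies R e ↦ a.1) (hu.deg k)
    · refine ρ.finsupp_proj_eq_iff.2 fun c ↦ ?_
      change Finsupp.single b x c ∈ 𝒜 1
      classical
      rw [Finsupp.single_apply]
      split_ifs
      exacts [h.mem, zero_mem _]
  span b hb := by
    have hb' : (ρ.finsupp ι).proj 1 b.1 = b.1 := congrArg Subtype.val hb
    have hbx := b.2
    rw [LinearMap.mem_ker, linearCombination_comp, h.eq_zero_iff] at hbx
    obtain ⟨m, hm⟩ := hbx
    have hm1 := congrArg (G.proj 1) hm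
    rw [ρ.proj_linearCombination G he.deg, hb', ← zero_add 1, h.proj_succ_smul] at hm1
    obtain ⟨f, hf, hfm⟩ := he.span _ (G.proj_self (i := 0) m)
    have ha : b.1 - x • f ∈ syzygies R e := by
      rw [LinearMap.mem_ker, map_sub, map_smul, hfm, hm1, sub_self]
    have hxf : (ρ.finsupp ι).proj 1 (x • f) = x • f := by
      rw [ρ.finsupp_proj_eq_iff]
      intro b
      have := ρ.mul_mem h.mem (hf b)
      rwa [add_zero] at this
    obtain ⟨g, hg, hgu⟩ := hu.span ⟨_, ha⟩ (Subtype.ext (by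
      rw [coe_syzygyGrading_proj, map_sub, zero_add, hb', hxf]))
    refine ⟨(Finsupp.sumFinsuppLEquivProdFinsupp R).symm (g, f), fun a ↦ ?_, Subtype.ext ?_⟩
    · rcases a with k | b
      exacts [hg k, hf b]
    · rw [h.coe_linearCombination_sumFamily, LinearEquiv.apply_symm_apply, hgu]
      exact sub_add_cancel _ _
  indep f hf h0 := by
    have h1 := (h.coe_linearCombination_sumFamily u f).symm.trans (congrArg Subtype.val h0)
    rw [Submodule.coe_zero] at h1
    have h2 : (Finsupp.sumFinsuppLEquivProdFinsupp R f).2 = 0 := by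
      refine he.indep _ (fun b ↦ hf _) (h.mem_syzygies_of_smul ?_)
      rw [eq_neg_of_add_eq_zero_right h1]
      exact neg_mem (Subtype.mem _)
    rw [h2, smul_zero, add_zero] at h1
    have h3 := hu.indep _ (fun k ↦ hf _) (Subtype.ext h1)
    apply (Finsupp.sumFinsuppLEquivProdFinsupp R).injective
    rw [map_zero]
    exact Prod.ext h3 h2

variable {A' : Type} [AddCommGroup A'] [Module R A'] {H : ModuleGrading 𝒜 A'}
  {ψ : syzygies R e →ₗ[R] A'}

/-- Dividing Syz + xF by xF gives Syz / (Syz ∩ xF) = Syz / x Syz, and the extra generators `x [e b]`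
account exactly for xF. -/
theorem isGenerated_syzygies_iff (hG : IsGeneratedInDegreeZero G)
    (hψ : IsRegularQuotient x (syzygyGrading ρ he) H ψ) :
    IsGeneratedInDegreeZero (syzygyGrading ρ (h.isDegreeZeroBasis he)) ↔
      IsGeneratedInDegreeZero H := by
  obtain ⟨κ, u, hu⟩ := exists_isDegreeZeroBasis ρ (syzygyGrading ρ he)
  have hlin : ∀ f, Finsupp.linearCombination R (ψ ∘ u) f =
      ψ (Finsupp.linearCombination R u f) := linearCombination_comp ψ u
  have hz : ∀ a b, ψ a = ψ b ↔ ∃ a' : syzygies R e, a.1 + x • a'.1 = b.1 := fun a b ↦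
    (hψ.eq_iff a b).trans (exists_congr fun a' ↦ Subtype.ext_iff)
  rw [isGeneratedInDegreeZero_iff (h.isDegreeZeroBasis_sumFamily ρ he hu),
    isGeneratedInDegreeZero_iff (hψ.isDegreeZeroBasis hu)]
  constructor
  · intro hw a'
    obtain ⟨a, rfl⟩ := hψ.surjective a'
    obtain ⟨f, hf⟩ := hw ⟨a.1, mem_syzygies_comp a.2⟩
    have h1 := (h.coe_linearCombination_sumFamily u f).symm.trans (congrArg Subtype.val hf)
    refine ⟨(Finsupp.sumFinsuppLEquivProdFinsupp R f).1, ?_⟩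
    rw [hlin, hz]
    have h2 : x • (Finsupp.sumFinsuppLEquivProdFinsupp R f).2 ∈ syzygies R e := by
      rw [← eq_sub_iff_add_eq'] at h1
      rw [h1]
      exact sub_mem a.2 (Subtype.mem _)
    exact ⟨⟨_, h.mem_syzygies_of_smul h2⟩, h1⟩
  · intro hu' b
    obtain ⟨a, f, haf⟩ := h.exists_decomposition he hG b
    obtain ⟨g, hg⟩ := hu' (ψ a)
    rw [hlin, hz] at hg
    obtain ⟨c, hc⟩ := hg
    refine ⟨(Finsupp.sumFinsuppLEquivProdFinsupp R).symm (g, c.1 + f), Subtype.ext ?_⟩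
    rw [h.coe_linearCombination_sumFamily, LinearEquiv.apply_symm_apply, haf, smul_add, ← add_assoc,
      hc]

/-- In a relation ∑ f_k u_k + x g = 0 the part g is determined by f, as `x` is a nonzerodivisor on
R. Such a g exists exactly when ∑ f_k u_k lies in Syz ∩ xF = x Syz, that is, when f is a relation
modulo x Syz. The isomorphism forgets g. -/
theorem exists_syzygies_sumFamily_equiv
    (hψ : IsRegularQuotient x (syzygyGrading ρ he) H ψ) {κ : Type} {u : κ → syzygies R e}
    (hu : IsDegreeZeroBasis (syzygyGrading ρ he) u) :
    ∃ θ : syzygies R (h.sumFamily u) ≃ₗ[R] syzygies R (ψ ∘ u),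
      ∀ i f, θ ((syzygyGrading ρ (h.isDegreeZeroBasis_sumFamily ρ he hu)).proj i f) =
        (syzygyGrading ρ (hψ.isDegreeZeroBasis hu)).proj i (θ f) := by
  have hlin : ∀ f, Finsupp.linearCombination R (ψ ∘ u) f =
      ψ (Finsupp.linearCombination R u f) := linearCombination_comp ψ u
  have hz : ∀ a, ψ a = 0 ↔ ∃ a' : syzygies R e, x • a'.1 = a.1 := fun a ↦
    (hψ.eq_zero_iff a).trans (exists_congr fun a' ↦ Subtype.ext_iff)
  have hrel : ∀ f : syzygies R (h.sumFamily u),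
      (Finsupp.linearCombination R u (Finsupp.sumFinsuppLEquivProdFinsupp R f.1).1 : ι →₀ R) +
        x • (Finsupp.sumFinsuppLEquivProdFinsupp R f.1).2 = 0 := fun f ↦ by
    rw [← h.coe_linearCombination_sumFamily]
    exact congrArg Subtype.val f.2
  let θ : syzygies R (h.sumFamily u) →ₗ[R] syzygies R (ψ ∘ u) :=
    (LinearMap.fst R (κ →₀ R) (ι →₀ R) ∘ₗ
      (Finsupp.sumFinsuppLEquivProdFinsupp R).toLinearMap).restrict fun f hf ↦ by
        have h1 := hrel ⟨f, hf⟩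
        rw [LinearMap.mem_ker, hlin, hz]
        have h2 : x • (Finsupp.sumFinsuppLEquivProdFinsupp R f).2 ∈ syzygies R e := by
          rw [eq_neg_of_add_eq_zero_right h1]
          exact neg_mem (Subtype.mem _)
        refine ⟨⟨_, neg_mem (h.mem_syzygies_of_smul h2)⟩, ?_⟩
        rw [smul_neg]
        exact (eq_neg_of_add_eq_zero_left h1).symm
  have hθ : ∀ f, (θ f).1 = (Finsupp.sumFinsuppLEquivProdFinsupp R f.1).1 := fun f ↦ rfl
  refine ⟨LinearEquiv.ofBijective θ ⟨?_, fun g ↦ ?_⟩, fun i f ↦ ?_⟩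
  · intro f f' hff
    have h1 : (Finsupp.sumFinsuppLEquivProdFinsupp R f.1).1 =
      (Finsupp.sumFinsuppLEquivProdFinsupp R f'.1).1 := congrArg Subtype.val hff
    have h2 := (hrel f).trans (hrel f').symm
    rw [h1, add_right_inj, ← sub_eq_zero, ← smul_sub] at h2
    apply Subtype.ext
    apply (Finsupp.sumFinsuppLEquivProdFinsupp R).injective
    exact Prod.ext h1 (sub_eq_zero.1 (h.smul_finsupp_eq_zero h2))
  · have hg := g.2
    rw [LinearMap.mem_ker, hlin, hz] at hg
    obtain ⟨a, ha⟩ := hg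
    refine ⟨⟨(Finsupp.sumFinsuppLEquivProdFinsupp R).symm (g.1, -a.1), Subtype.ext ?_⟩,
      Subtype.ext ?_⟩
    · rw [h.coe_linearCombination_sumFamily, LinearEquiv.apply_symm_apply, ← ha, smul_neg]
      exact add_neg_cancel _
    · rw [hθ, LinearEquiv.apply_symm_apply]
  · apply Subtype.ext
    ext k
    rfl

-- The relations of M / xM are not Syz / x Syz, but the two are generated in degree zero
-- simultaneously and have isomorphic modules of relations, so they are linear to the same extent.
-- The induction hypothesis compares Syz with Syz / x Syz.
omit h he in
theorem isLinearUpTo_iff (p : ℕ) {M M' : Type} [AddCommGroup M] [Module R M] [AddCommGroup M']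
    [Module R M'] {G : ModuleGrading 𝒜 M} {G' : ModuleGrading 𝒜 M'} {φ : M →ₗ[R] M'}
    (h : IsRegularQuotient x G G' φ) : IsLinearUpTo ρ p G ↔ IsLinearUpTo ρ p G' := by
  induction p generalizing M M' with
  | zero => exact h.isGenerated_iff ρ
  | succ p ih =>
    obtain ⟨ι, e, he⟩ := exists_isDegreeZeroBasis ρ G
    rw [isLinearUpTo_succ_iff ρ he, isLinearUpTo_succ_iff ρ (h.isDegreeZeroBasis he),
      ← h.isGenerated_iff ρ]
    refine and_congr_right fun hG ↦ ?_
    -- Relations lie in a free module, so regularity of `x` on R suffices here.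
    obtain ⟨H, hH⟩ := quotient (syzygyGrading ρ he) h.mem h.ring_regular fun f hf ↦
      Subtype.ext (h.smul_finsupp_eq_zero (congrArg Subtype.val hf))
    rw [ih hH]
    have h0 := h.isGenerated_syzygies_iff ρ he hG hH
    cases p with
    | zero => exact h0.symm
    | succ p =>
      obtain ⟨κ, u, hu⟩ := exists_isDegreeZeroBasis ρ (syzygyGrading ρ he)
      rw [isLinearUpTo_succ_iff ρ (h.isDegreeZeroBasis_sumFamily ρ he hu),
        isLinearUpTo_succ_iff ρ (hH.isDegreeZeroBasis hu), h0]
      refine and_congr_right fun _ ↦ ?_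
      obtain ⟨θ, hθ⟩ := h.exists_syzygies_sumFamily_equiv ρ he hH hu
      refine ⟨fun h ↦ h.of_equiv ρ θ.symm fun i f ↦ ?_, fun h ↦ h.of_equiv ρ θ hθ⟩
      rw [LinearEquiv.symm_apply_eq, hθ, LinearEquiv.apply_symm_apply]

end IsRegularQuotient

end GradedAlgebra

end UlrichKoszul

end

noncomputable section

namespace UlrichKoszul

section GradedAlgebra

variable {R : Type} [CommRing R] {𝒜 : ℕ → AddSubgroup R} (ρ : RingGrading 𝒜)

/-! ### Reduction modulo a regular sequence of linear forms -/

/-- The submodule `x₁ M + ⋯ + x_r M`. -/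
def smulSpan (M : Type) [AddCommGroup M] [Module R M] : List R → Submodule R M
  | [] => ⊥
  | x :: l => smulSpan M l ⊔ LinearMap.range (LinearMap.lsmul R M x)

/-- The elements of the list `l` are of degree one, nonzerodivisors on `R`, and form a regular
sequence on `M`, when read from right to left. -/
def IsRegularList (𝒜 : ℕ → AddSubgroup R) (M : Type) [AddCommGroup M] [Module R M] :
    List R → Prop
  | [] => True
  | x :: l => IsRegularList 𝒜 M l ∧ x ∈ 𝒜 1 ∧ (∀ r : R, x * r = 0 → r = 0) ∧
      ∀ m : M, x • m ∈ smulSpan M l → m ∈ smulSpan M l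

variable {M : Type} [AddCommGroup M] [Module R M] (G : ModuleGrading 𝒜 M)

theorem smul_mem_smulSpan_cons (x : R) (l : List R) (m : M) : x • m ∈ smulSpan M (x :: l) :=
  Submodule.mem_sup_right ⟨m, rfl⟩

theorem mem_smulSpan_cons {x : R} {l : List R} {m : M} :
    m ∈ smulSpan M (x :: l) ↔ ∃ n ∈ smulSpan M l, ∃ m', n + x • m' = m := by
  simp only [smulSpan, Submodule.mem_sup, LinearMap.mem_range, LinearMap.lsmul_apply,
    exists_exists_eq_and]

theorem proj_mem_smulSpan {l : List R} (hl : IsRegularList 𝒜 M l) (i : ℕ) {m : M}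
    (hm : m ∈ smulSpan M l) : G.proj i m ∈ smulSpan M l := by
  induction l generalizing m with
  | nil =>
    rw [smulSpan, Submodule.mem_bot] at hm ⊢
    rw [hm, map_zero]
  | cons x l ih =>
    obtain ⟨n, hn, m', rfl⟩ := mem_smulSpan_cons.1 hm
    rw [map_add]
    refine add_mem (Submodule.mem_sup_left (ih hl.1 hn)) ?_
    cases i with
    | zero => exact G.proj_smul_of_lt hl.2.1 0 one_pos m' ▸ zero_mem _
    | succ i =>
      rw [add_comm, G.proj_smul_add hl.2.1]
      exact smul_mem_smulSpan_cons x l _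

theorem proj_zero_of_mem_smulSpan {l : List R} (hl : IsRegularList 𝒜 M l) {m : M}
    (hm : m ∈ smulSpan M l) : G.proj 0 m = 0 := by
  induction l generalizing m with
  | nil =>
    rw [smulSpan, Submodule.mem_bot] at hm
    rw [hm, map_zero]
  | cons x l ih =>
    obtain ⟨n, hn, m', rfl⟩ := mem_smulSpan_cons.1 hm
    rw [map_add, ih hl.1 hn, G.proj_smul_of_lt hl.2.1 0 one_pos m', add_zero]

/-- One form is divided out at a time: the quotient for `x :: l` is the quotient by `x` of the one
for `l`, on which `x` is a nonzerodivisor by assumption. -/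
theorem exists_quotient_grading {l : List R} (hl : IsRegularList 𝒜 M l) :
    ∃ G' : ModuleGrading 𝒜 (M ⧸ smulSpan M l),
      (∀ i m, G'.proj i ((smulSpan M l).mkQ m) = (smulSpan M l).mkQ (G.proj i m)) ∧
      ∀ p, IsLinearUpTo ρ p G ↔ IsLinearUpTo ρ p G' := by
  have hker : ∀ {l : List R} (_ : IsRegularList 𝒜 M l) (i : ℕ) (m : M),
      (smulSpan M l).mkQ m = 0 → (smulSpan M l).mkQ (G.proj i m) = 0 := fun hl i m hm ↦ by
    rw [Submodule.mkQ_apply, Submodule.Quotient.mk_eq_zero] at hm ⊢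
    exact proj_mem_smulSpan G hl i hm
  refine ⟨G.ofSurjective _ (Submodule.mkQ_surjective _) (hker hl),
    G.ofSurjective_proj _ (Submodule.mkQ_surjective _) (hker hl), fun p ↦ ?_⟩
  induction l with
  | nil =>
    have hφ : Function.Bijective (smulSpan M ([] : List R)).mkQ :=
      ⟨LinearMap.ker_eq_bot.1 (Submodule.ker_mkQ _), Submodule.mkQ_surjective _⟩
    have h : ∀ i m, LinearEquiv.ofBijective _ hφ (G.proj i m) =
      (G.ofSurjective _ (Submodule.mkQ_surjective _) (hker hl)).proj i
        (LinearEquiv.ofBijective _ hφ m) := fun i m ↦ (G.ofSurjective_proj _ _ _ i m).symm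
    refine ⟨fun hG ↦ hG.of_equiv ρ _ h, fun hG ↦ hG.of_equiv ρ (LinearEquiv.ofBijective _ hφ).symm
      fun i m ↦ ?_⟩
    rw [LinearEquiv.symm_apply_eq, h, LinearEquiv.apply_symm_apply]
  | cons x l ih =>
    rw [ih hl.1]
    have hle : smulSpan M l ≤ smulSpan M (x :: l) := le_sup_left
    refine IsRegularQuotient.isLinearUpTo_iff (x := x) (φ := Submodule.factor hle) ρ p
      ⟨hl.2.1, hl.2.2.1, ?_, Submodule.factor_surjective hle, ?_, ?_⟩
    · intro m
      obtain ⟨m, rfl⟩ := Submodule.mkQ_surjective _ m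
      rw [← map_smul, Submodule.mkQ_apply, Submodule.mkQ_apply, Submodule.Quotient.mk_eq_zero,
        Submodule.Quotient.mk_eq_zero]
      exact hl.2.2.2 m
    · intro i m
      obtain ⟨m, rfl⟩ := Submodule.mkQ_surjective _ m
      have h1 := G.ofSurjective_proj _ (Submodule.mkQ_surjective _) (hker hl.1) i m
      have h2 := G.ofSurjective_proj _ (Submodule.mkQ_surjective _) (hker hl) i m
      rw [h1]
      exact h2.symm
    · intro m
      obtain ⟨m, rfl⟩ := Submodule.mkQ_surjective _ m
      change (smulSpan M (x :: l)).mkQ m = 0 ↔ _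
      rw [Submodule.mkQ_apply, Submodule.Quotient.mk_eq_zero, mem_smulSpan_cons]
      constructor
      · rintro ⟨n, hn, m', rfl⟩
        refine ⟨(smulSpan M l).mkQ m', ?_⟩
        rw [map_add, map_smul, right_eq_add, Submodule.mkQ_apply, Submodule.Quotient.mk_eq_zero]
        exact hn
      · rintro ⟨m', hm'⟩
        obtain ⟨m', rfl⟩ := Submodule.mkQ_surjective _ m'
        rw [← map_smul, eq_comm, ← sub_eq_zero, ← map_sub, Submodule.mkQ_apply,
          Submodule.Quotient.mk_eq_zero] at hm'
        exact ⟨_, hm', m', sub_add_cancel _ _⟩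

/-! ### Modules concentrated in degree zero -/

include ρ in
theorem mem_irrelevantIdeal_iff {r : R} : r ∈ irrelevantIdeal 𝒜 ↔ ρ.proj 0 r = 0 := by
  constructor
  · intro h
    induction h using Submodule.span_induction with
    | mem a ha =>
      obtain ⟨m, hm, ha⟩ := ha
      have := ρ.proj_smul_of_lt ha 0 hm 1
      rwa [smul_eq_mul, mul_one] at this
    | zero => exact map_zero _
    | add a b _ _ ha hb => rw [map_add, ha, hb, add_zero]
    | smul s a _ ha =>
      refine ρ.ext_proj fun i ↦ ?_
      rw [map_zero]
      rcases Nat.eq_zero_or_pos i with rfl | hi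
      · rw [ρ.proj_self, smul_eq_mul, mul_comm]
        obtain ⟨n, hn⟩ := ρ.exists_sum a
        rw [← hn (n + 1) (by omega), Finset.sum_range_succ', ha, add_zero, Finset.sum_mul, map_sum]
        refine Finset.sum_eq_zero fun j _ ↦ ?_
        exact ρ.proj_smul_of_lt (ρ.proj_mem (j + 1) a) 0 (by omega) s
      · exact ρ.proj_of_ne hi.ne' _
  · intro h
    obtain ⟨n, hn⟩ := ρ.exists_sum r
    rw [← hn (n + 1) (by omega), Finset.sum_range_succ', h, add_zero]
    exact sum_mem fun i _ ↦ Ideal.subset_span ⟨i + 1, by omega, ρ.proj_mem _ _⟩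

/-- The residue field `R / R₊`, as a graded module. -/
def residueGrading : ModuleGrading 𝒜 (R ⧸ irrelevantIdeal 𝒜) :=
  ρ.ofSurjective (irrelevantIdeal 𝒜).mkQ (Submodule.mkQ_surjective _) fun i r hr ↦ by
    rw [Submodule.mkQ_apply, Submodule.Quotient.mk_eq_zero, mem_irrelevantIdeal_iff ρ] at hr ⊢
    rw [ρ.proj_proj]
    split_ifs with h
    · exact h ▸ hr
    · rfl

theorem residueGrading_proj (i : ℕ) (r : R) :
    (residueGrading ρ).proj i ((irrelevantIdeal 𝒜).mkQ r) =
      (irrelevantIdeal 𝒜).mkQ (ρ.proj i r) :=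
  ρ.ofSurjective_proj _ _ _ i r

theorem residueGrading_proj_zero (m : R ⧸ irrelevantIdeal 𝒜) :
    (residueGrading ρ).proj 0 m = m := by
  obtain ⟨r, rfl⟩ := Submodule.mkQ_surjective _ m
  rw [residueGrading_proj, ← sub_eq_zero, ← map_sub, Submodule.mkQ_apply,
    Submodule.Quotient.mk_eq_zero, mem_irrelevantIdeal_iff ρ, map_sub, ρ.proj_self, sub_self]

theorem isKoszulAlgebra_iff :
    IsKoszulAlgebra 𝒜 ↔ ∀ p, IsLinearUpTo ρ p (residueGrading ρ) :=
  isKoszulModule_iff ρ _ (residueGrading ρ) fun m ↦ by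
    simp only [concentratedInDegreeZero, if_true, residueGrading_proj_zero, AddSubgroup.mem_top]

/-- A basis over R₀ of a module killed by R₊ identifies it with a direct sum of copies of R / R₊.
Nontriviality makes the index set nonempty. -/
theorem isLinearUpTo_iff_of_concentrated (h0 : ∀ i m, G.proj (i + 1) m = 0) [Nontrivial M] (p : ℕ) :
    IsLinearUpTo ρ p G ↔ IsLinearUpTo ρ p (residueGrading ρ) := by
  have hp0 : ∀ m, G.proj 0 m = m := fun m ↦ G.ext_proj fun i ↦ by
    cases i with
    | zero => exact G.proj_self m
    | succ i => rw [h0, h0]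
  obtain ⟨J, e, he⟩ := exists_isDegreeZeroBasis ρ G
  have hs : Function.Surjective (Finsupp.linearCombination R e) := fun m ↦
    let ⟨f, _, hf⟩ := he.span m (hp0 m)
    ⟨f, hf⟩
  have hJ : Nonempty J := by
    by_contra hJ
    rw [not_nonempty_iff] at hJ
    have : Subsingleton M := hs.subsingleton
    exact not_subsingleton M this
  have hs' : Function.Surjective (Finsupp.mapRange.linearMap (α := J) (irrelevantIdeal 𝒜).mkQ) :=
    Finsupp.mapRange_surjective _ (map_zero _) (Submodule.mkQ_surjective _)
  -- Everything has degree zero, so a combination of `e` depends only on the degree zero parts of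
  -- its coefficients; by independence it vanishes only if these do, that is, if all coefficients
  -- lie in R₊.
  have hker : LinearMap.ker (Finsupp.linearCombination R e) =
      LinearMap.ker (Finsupp.mapRange.linearMap (α := J) (irrelevantIdeal 𝒜).mkQ) := by
    ext f
    have h1 : Finsupp.mapRange.linearMap (irrelevantIdeal 𝒜).mkQ f = 0 ↔
        (ρ.finsupp J).proj 0 f = 0 := by
      simp only [DFunLike.ext_iff, Finsupp.mapRange.linearMap_apply, Finsupp.mapRange_apply,
        Submodule.mkQ_apply, Finsupp.zero_apply, Submodule.Quotient.mk_eq_zero,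
        mem_irrelevantIdeal_iff ρ, ModuleGrading.finsupp_proj_apply]
    rw [LinearMap.mem_ker, LinearMap.mem_ker, h1, ← hp0 (Finsupp.linearCombination R e f),
      ρ.proj_linearCombination G he.deg]
    exact ⟨he.indep _ fun b ↦ ρ.proj_mem _ _, fun h ↦ by rw [h, map_zero]⟩
  let φ : M ≃ₗ[R] (J →₀ R ⧸ irrelevantIdeal 𝒜) :=
    (LinearMap.quotKerEquivOfSurjective _ hs).symm ≪≫ₗ Submodule.quotEquivOfEq _ _ hker ≪≫ₗ
      LinearMap.quotKerEquivOfSurjective _ hs'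
  have hφ : ∀ f, φ (Finsupp.linearCombination R e f) =
      Finsupp.mapRange.linearMap (irrelevantIdeal 𝒜).mkQ f := fun f ↦ by
    have : (LinearMap.quotKerEquivOfSurjective _ hs).symm (Finsupp.linearCombination R e f) =
        Submodule.Quotient.mk f := by
      rw [LinearEquiv.symm_apply_eq]
      rfl
    simp only [φ, LinearEquiv.trans_apply, this]
    rfl
  have hφ' : ∀ i m, φ (G.proj i m) = ((residueGrading ρ).finsupp J).proj i (φ m) := fun i m ↦ by
    obtain ⟨f, rfl⟩ := hs m
    rw [ρ.proj_linearCombination G he.deg, hφ, hφ]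
    ext b
    exact (residueGrading_proj ρ i (f b)).symm
  rw [← isLinearUpTo_finsupp_iff ρ (residueGrading ρ) J]
  refine ⟨fun h ↦ h.of_equiv ρ φ hφ', fun h ↦ h.of_equiv ρ φ.symm fun i m ↦ ?_⟩
  rw [LinearEquiv.symm_apply_eq, hφ', LinearEquiv.apply_symm_apply]

-- The algebraic core: dividing by the list leaves only degree zero by `hgen`, and what is left is
-- nonzero because the submodule divided out has no part of degree zero.
include ρ in
theorem isKoszulModule_iff_isKoszulAlgebra (ℳ : ℕ → AddSubgroup M)
    (hℳ : ∀ m, m ∈ ℳ 0 ↔ G.proj 0 m = m) {l : List R} (hl : IsRegularList 𝒜 M l)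
    (hgen : ∀ i m, G.proj (i + 1) m ∈ smulSpan M l) (hne : ∃ m ∈ ℳ 0, m ≠ 0) :
    IsKoszulModule 𝒜 ℳ ↔ IsKoszulAlgebra 𝒜 := by
  obtain ⟨G', hG', hp⟩ := exists_quotient_grading ρ G hl
  have : Nontrivial (M ⧸ smulSpan M l) := by
    obtain ⟨m, hm, hm0⟩ := hne
    refine ⟨(smulSpan M l).mkQ m, 0, fun h ↦ hm0 ?_⟩
    rw [Submodule.mkQ_apply, Submodule.Quotient.mk_eq_zero] at h
    rw [← (hℳ m).1 hm, proj_zero_of_mem_smulSpan G hl h]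
  rw [isKoszulModule_iff ρ ℳ G hℳ, isKoszulAlgebra_iff ρ]
  refine forall_congr' fun p ↦ (hp p).trans (isLinearUpTo_iff_of_concentrated ρ G' ?_ p)
  intro i m
  obtain ⟨m, rfl⟩ := Submodule.mkQ_surjective _ m
  rw [hG', Submodule.mkQ_apply, Submodule.Quotient.mk_eq_zero]
  exact hgen i m

end GradedAlgebra

end UlrichKoszul

end

noncomputable section

namespace UlrichKoszul

section Koszul

open Limits ZeroObject Abelian

/-! ### Koszul complexes in abelian categories -/

variable (𝒮 : Type 1) [Category.{0} 𝒮] [Abelian 𝒮] (L : Type)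

/-- For every `m` a chain complex `X _ m`, together with commuting operators of degree one in `m`
that are indexed by `L`. -/
structure MulComplex where
  /-- the objects -/
  X : ℕ → ℤ → 𝒮
  /-- the differentials -/
  d : ∀ i m, X (i + 1) m ⟶ X i m
  /-- the operators -/
  mul : L → ∀ i m, X i (m - 1) ⟶ X i m
  d_d : ∀ i m, d (i + 1) m ≫ d i m = 0
  mul_mul : ∀ x y i m, mul x i (m - 1) ≫ mul y i m = mul y i (m - 1) ≫ mul x i m
  mul_d : ∀ x i m, mul x (i + 1) m ≫ d i m = d i (m - 1) ≫ mul x i m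

variable {𝒮 L}

/-- The cone of the operator `x`. -/
def MulComplex.cone (C : MulComplex 𝒮 L) (x : L) : MulComplex 𝒮 L where
  X
    | 0, m => C.X 0 m
    | i + 1, m => C.X (i + 1) m ⊞ C.X i (m - 1)
  d
    | 0, m => biprod.desc (C.d 0 m) (C.mul x 0 m)
    -- On elements, (a, b) ↦ (d a + x b, -d b); the sign makes the two terms x d b cancel in the
    -- square.
    | i + 1, m => biprod.desc (C.d (i + 1) m ≫ biprod.inl)
        (C.mul x (i + 1) m ≫ biprod.inl - C.d i (m - 1) ≫ biprod.inr)
  mul y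
    | 0, m => C.mul y 0 m
    | i + 1, m => biprod.map (C.mul y (i + 1) m) (C.mul y i (m - 1))
  d_d
    | 0, m => by
      apply biprod.hom_ext' <;> simp [C.d_d, C.mul_d]
    | i + 1, m => by
      apply biprod.hom_ext' <;>
        simp [Preadditive.sub_comp, reassoc_of% C.d_d, reassoc_of% C.mul_d]
  mul_mul
    | y, z, 0, m => C.mul_mul y z 0 m
    | y, z, i + 1, m => by
      apply biprod.hom_ext' <;> simp [reassoc_of% C.mul_mul y z]
  mul_d
    | y, 0, m => by
      apply biprod.hom_ext' <;> simp [C.mul_d, C.mul_mul y x]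
    | y, i + 1, m => by
      apply biprod.hom_ext' <;>
        simp [reassoc_of% C.mul_d, reassoc_of% C.mul_mul y x, Preadditive.sub_comp,
          Preadditive.comp_sub]

variable (T : ℤ → 𝒮) (mulT : L → ∀ m, T (m - 1) ⟶ T m)
  (hT : ∀ x y m, mulT x (m - 1) ≫ mulT y m = mulT y (m - 1) ≫ mulT x m)

/-- A graded object with commuting operators, in homological degree zero. -/
def MulComplex.single : MulComplex 𝒮 L where
  X
    | 0, m => T m
    | _ + 1, _ => 0
  d _ _ := 0
  mul x
    | 0, m => mulT x m
    | _ + 1, _ => 0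
  d_d _ _ := zero_comp
  mul_mul
    | x, y, 0, m => hT x y m
    | _, _, _ + 1, _ => rfl
  mul_d _ _ _ := by rw [comp_zero, zero_comp]

/-- The Koszul complex of a list of operators. -/
def koszulComplex : List L → MulComplex 𝒮 L
  | [] => MulComplex.single T mulT hT
  | x :: l => (koszulComplex l).cone x

/-! ### Contracting homotopies -/

/-- A homotopy between zero and the operator `x`. -/
structure MulComplex.Contraction (C : MulComplex 𝒮 L) (x : L) where
  /-- the homotopy -/
  h : ∀ i m, C.X i (m - 1) ⟶ C.X (i + 1) m
  h_d_zero : ∀ m, h 0 m ≫ C.d 0 m = C.mul x 0 m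
  h_d : ∀ i m, h (i + 1) m ≫ C.d (i + 1) m + C.d i (m - 1) ≫ h i m = C.mul x (i + 1) m
  -- Compatibility with all operators is what allows the homotopy to be extended to further cones.
  h_mul : ∀ y i m, h i (m - 1) ≫ C.mul y (i + 1) m = C.mul y i (m - 1) ≫ h i m

/-- The operator `x` is nullhomotopic on its cone. -/
def MulComplex.contractionCone (C : MulComplex 𝒮 L) (x : L) : (C.cone x).Contraction x where
  h
    | 0, m => (biprod.inr : C.X 0 (m - 1) ⟶ C.X 1 m ⊞ C.X 0 (m - 1))
    | i + 1, m => (biprod.fst ≫ biprod.inr :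
        C.X (i + 1) (m - 1) ⊞ C.X i (m - 1 - 1) ⟶ C.X (i + 2) m ⊞ C.X (i + 1) (m - 1))
  h_d_zero m := by
    change biprod.inr ≫ biprod.desc (C.d 0 m) (C.mul x 0 m) = C.mul x 0 m
    simp
  h_d
    | 0, m => by
      have : ((biprod.fst ≫ biprod.inr) ≫ biprod.desc (C.d 1 m ≫ biprod.inl)
        (C.mul x 1 m ≫ biprod.inl - C.d 0 (m - 1) ≫ biprod.inr) +
        biprod.desc (C.d 0 (m - 1)) (C.mul x 0 (m - 1)) ≫ biprod.inr :
          C.X 1 (m - 1) ⊞ C.X 0 (m - 1 - 1) ⟶ C.X 1 m ⊞ C.X 0 (m - 1)) =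
        biprod.map (C.mul x 1 m) (C.mul x 0 (m - 1)) := by
        apply biprod.hom_ext' <;> simp [Preadditive.comp_add]
      exact this
    | i + 1, m => by
      have : ((biprod.fst ≫ biprod.inr) ≫ biprod.desc (C.d (i + 2) m ≫ biprod.inl)
        (C.mul x (i + 2) m ≫ biprod.inl - C.d (i + 1) (m - 1) ≫ biprod.inr) +
        biprod.desc (C.d (i + 1) (m - 1) ≫ biprod.inl) (C.mul x (i + 1) (m - 1) ≫ biprod.inl -
          C.d i (m - 1 - 1) ≫ biprod.inr) ≫ biprod.fst ≫ biprod.inr :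
          C.X (i + 2) (m - 1) ⊞ C.X (i + 1) (m - 1 - 1) ⟶
          C.X (i + 2) m ⊞ C.X (i + 1) (m - 1)) =
        biprod.map (C.mul x (i + 2) m) (C.mul x (i + 1) (m - 1)) := by
        apply biprod.hom_ext' <;> simp [Preadditive.comp_add, Preadditive.sub_comp]
      exact this
  h_mul
    | y, 0, m => by
      change biprod.inr ≫ biprod.map (C.mul y 1 m) (C.mul y 0 (m - 1)) =
        C.mul y 0 (m - 1) ≫ biprod.inr
      simp
    | y, i + 1, m => by
      change (biprod.fst ≫ biprod.inr) ≫ biprod.map (C.mul y (i + 2) m) (C.mul y (i + 1) (m - 1)) =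
        biprod.map (C.mul y (i + 1) (m - 1)) (C.mul y i (m - 1 - 1)) ≫ biprod.fst ≫ biprod.inr
      simp

/-- A nullhomotopic operator is nullhomotopic on every cone. -/
def MulComplex.Contraction.cone {C : MulComplex 𝒮 L} {y : L} (c : C.Contraction y) (x : L) :
    (C.cone x).Contraction y where
  h
    | 0, m => (c.h 0 m ≫ biprod.inl : C.X 0 (m - 1) ⟶ C.X 1 m ⊞ C.X 0 (m - 1))
    -- The sign on the second summand matches the sign of the differential there: the mixed terms
    -- cancel by `h_mul`.
    | i + 1, m => (biprod.map (c.h (i + 1) m) (-c.h i (m - 1)) :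
        C.X (i + 1) (m - 1) ⊞ C.X i (m - 1 - 1) ⟶ C.X (i + 2) m ⊞ C.X (i + 1) (m - 1))
  h_d_zero m := by
    change (c.h 0 m ≫ biprod.inl) ≫ biprod.desc (C.d 0 m) (C.mul x 0 m) = C.mul y 0 m
    simp [c.h_d_zero]
  h_d
    | 0, m => by
      have : (biprod.map (c.h 1 m) (-c.h 0 (m - 1)) ≫ biprod.desc (C.d 1 m ≫ biprod.inl)
        (C.mul x 1 m ≫ biprod.inl - C.d 0 (m - 1) ≫ biprod.inr) +
        biprod.desc (C.d 0 (m - 1)) (C.mul x 0 (m - 1)) ≫ c.h 0 m ≫ biprod.inl :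
          C.X 1 (m - 1) ⊞ C.X 0 (m - 1 - 1) ⟶ C.X 1 m ⊞ C.X 0 (m - 1)) =
        biprod.map (C.mul y 1 m) (C.mul y 0 (m - 1)) := by
        apply biprod.hom_ext'
        · simp [Preadditive.comp_add, ← c.h_d, Preadditive.add_comp]
        · simp [Preadditive.comp_add, Preadditive.comp_sub, ← c.h_d_zero, reassoc_of% c.h_mul]
      exact this
    | i + 1, m => by
      have : (biprod.map (c.h (i + 2) m) (-c.h (i + 1) (m - 1)) ≫
        biprod.desc (C.d (i + 2) m ≫ biprod.inl)
        (C.mul x (i + 2) m ≫ biprod.inl - C.d (i + 1) (m - 1) ≫ biprod.inr) +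
        biprod.desc (C.d (i + 1) (m - 1) ≫ biprod.inl) (C.mul x (i + 1) (m - 1) ≫ biprod.inl -
          C.d i (m - 1 - 1) ≫ biprod.inr) ≫ biprod.map (c.h (i + 1) m) (-c.h i (m - 1)) :
          C.X (i + 2) (m - 1) ⊞ C.X (i + 1) (m - 1 - 1) ⟶
          C.X (i + 2) m ⊞ C.X (i + 1) (m - 1)) =
        biprod.map (C.mul y (i + 2) m) (C.mul y (i + 1) (m - 1)) := by
        apply biprod.hom_ext'
        · simp [Preadditive.comp_add, ← c.h_d, Preadditive.add_comp]
        · simp [Preadditive.comp_add, Preadditive.comp_sub, Preadditive.sub_comp,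
            Preadditive.add_comp, ← c.h_d, reassoc_of% c.h_mul]
          abel
      exact this
  h_mul
    | z, 0, m => by
      change (c.h 0 (m - 1) ≫ biprod.inl) ≫ biprod.map (C.mul z 1 m) (C.mul z 0 (m - 1)) =
        C.mul z 0 (m - 1) ≫ c.h 0 m ≫ biprod.inl
      simp [reassoc_of% c.h_mul]
    | z, i + 1, m => by
      change biprod.map (c.h (i + 1) (m - 1)) (-c.h i (m - 1 - 1)) ≫
        biprod.map (C.mul z (i + 2) m) (C.mul z (i + 1) (m - 1)) =
        biprod.map (C.mul z (i + 1) (m - 1)) (C.mul z i (m - 1 - 1)) ≫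
          biprod.map (c.h (i + 1) m) (-c.h i (m - 1))
      apply biprod.hom_ext' <;> simp [reassoc_of% c.h_mul]

/-- An operator becomes nullhomotopic when its own cone is taken, and the cones taken afterwards
preserve this. -/
theorem nonempty_contraction {l : List L} {x : L} (hx : x ∈ l) :
    Nonempty ((koszulComplex T mulT hT l).Contraction x) := by
  induction l with
  | nil => simp at hx
  | cons y l ih =>
    rcases List.mem_cons.1 hx with rfl | hx
    · exact ⟨MulComplex.contractionCone _ _⟩
    · exact ⟨(ih hx).some.cone y⟩

end Koszul

end UlrichKoszul

end

noncomputable section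

namespace UlrichKoszul

section Koszul

open Limits ZeroObject Abelian

variable {𝒮 : Type 1} [Category.{0} 𝒮] [Abelian 𝒮] {L : Type}

/-! ### Sections of Koszul complexes -/

section Sections

variable (F : 𝒮 ⥤ AddCommGrpCat.{0}) [F.Additive]

/-- The map on sections. -/
abbrev secMap {A B : 𝒮} (φ : A ⟶ B) : F.obj A →+ F.obj B := (F.map φ).hom

theorem secMap_comp {A B C : 𝒮} (φ : A ⟶ B) (ψ : B ⟶ C) (s : F.obj A) :
    secMap F (φ ≫ ψ) s = secMap F ψ (secMap F φ s) := by
  rw [secMap, F.map_comp]; rfl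

theorem secMap_add {A B : 𝒮} (φ ψ : A ⟶ B) (s : F.obj A) :
    secMap F (φ + ψ) s = secMap F φ s + secMap F ψ s := by
  rw [secMap, F.map_add]; rfl

theorem secMap_sub {A B : 𝒮} (φ ψ : A ⟶ B) (s : F.obj A) :
    secMap F (φ - ψ) s = secMap F φ s - secMap F ψ s := by
  rw [secMap, F.map_sub]; rfl

theorem secMap_id {A : 𝒮} (s : F.obj A) : secMap F (𝟙 A) s = s := by
  rw [secMap, F.map_id]; rfl

theorem secMap_zero {A B : 𝒮} (s : F.obj A) : secMap F (0 : A ⟶ B) s = 0 := by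
  rw [secMap, F.map_zero]; rfl

theorem secMap_fst_inl {A B : 𝒮} (s : F.obj A) :
    secMap F (biprod.fst : A ⊞ B ⟶ A) (secMap F biprod.inl s) = s := by
  rw [← secMap_comp, biprod.inl_fst, secMap_id]

theorem secMap_snd_inl {A B : 𝒮} (s : F.obj A) :
    secMap F (biprod.snd : A ⊞ B ⟶ B) (secMap F biprod.inl s) = 0 := by
  rw [← secMap_comp, biprod.inl_snd, secMap_zero]

theorem secMap_fst_inr {A B : 𝒮} (s : F.obj B) :
    secMap F (biprod.fst : A ⊞ B ⟶ A) (secMap F biprod.inr s) = 0 := by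
  rw [← secMap_comp, biprod.inr_fst, secMap_zero]

theorem secMap_snd_inr {A B : 𝒮} (s : F.obj B) :
    secMap F (biprod.snd : A ⊞ B ⟶ B) (secMap F biprod.inr s) = s := by
  rw [← secMap_comp, biprod.inr_snd, secMap_id]

theorem exists_biprod_sec {A B : 𝒮} (s : F.obj (A ⊞ B)) :
    ∃ (a : F.obj A) (b : F.obj B), secMap F biprod.inl a + secMap F biprod.inr b = s := by
  refine ⟨secMap F biprod.fst s, secMap F biprod.snd s, ?_⟩
  rw [← secMap_comp, ← secMap_comp, ← secMap_add, biprod.total, secMap_id]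

theorem biprod_sec_ext {A B : 𝒮} {a a' : F.obj A} {b b' : F.obj B}
    (h : secMap F (biprod.inl : A ⟶ A ⊞ B) a + secMap F biprod.inr b =
      secMap F biprod.inl a' + secMap F biprod.inr b') : a = a' ∧ b = b' := by
  constructor
  · simpa only [map_add, secMap_fst_inl, secMap_fst_inr, add_zero] using
      congrArg (secMap F (biprod.fst : A ⊞ B ⟶ A)) h
  · simpa only [map_add, secMap_snd_inl, secMap_snd_inr, zero_add] using
      congrArg (secMap F (biprod.snd : A ⊞ B ⟶ B)) h

theorem secMap_biprod_desc {A B C : 𝒮} (φ : A ⟶ C) (ψ : B ⟶ C) (a : F.obj A) (b : F.obj B) :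
    secMap F (biprod.desc φ ψ) (secMap F biprod.inl a + secMap F biprod.inr b) =
      secMap F φ a + secMap F ψ b := by
  rw [map_add, ← secMap_comp, ← secMap_comp, biprod.inl_desc, biprod.inr_desc]

theorem secMap_hom_inv {A B : 𝒮} (e : A ≅ B) (s : F.obj B) :
    secMap F e.hom (secMap F e.inv s) = s := by
  rw [← secMap_comp, e.inv_hom_id, secMap_id]

theorem secMap_inv_hom {A B : 𝒮} (e : A ≅ B) (s : F.obj A) :
    secMap F e.inv (secMap F e.hom s) = s := by
  rw [← secMap_comp, e.hom_inv_id, secMap_id]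

theorem bijective_secMap_biprod_map {A B A' B' : 𝒮} {φ : A ⟶ A'} {ψ : B ⟶ B'}
    (hφ : Function.Bijective (secMap F φ)) (hψ : Function.Bijective (secMap F ψ)) :
    Function.Bijective (secMap F (biprod.map φ ψ)) := by
  have key : ∀ a b, secMap F (biprod.map φ ψ) (secMap F biprod.inl a + secMap F biprod.inr b) =
      secMap F biprod.inl (secMap F φ a) + secMap F biprod.inr (secMap F ψ b) := fun a b ↦ by
    rw [map_add, ← secMap_comp, ← secMap_comp, biprod.inl_map, biprod.inr_map, secMap_comp,
      secMap_comp]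
  constructor
  · intro s s' h
    obtain ⟨a, b, rfl⟩ := exists_biprod_sec F s
    obtain ⟨a', b', rfl⟩ := exists_biprod_sec F s'
    rw [key, key] at h
    obtain ⟨h1, h2⟩ := biprod_sec_ext F h
    rw [hφ.1 h1, hψ.1 h2]
  · intro s
    obtain ⟨a, b, rfl⟩ := exists_biprod_sec F s
    obtain ⟨a, rfl⟩ := hφ.2 a
    obtain ⟨b, rfl⟩ := hψ.2 b
    exact ⟨_, key a b⟩

variable (T : ℤ → 𝒮) (mulT : L → ∀ m, T (m - 1) ⟶ T m)
  (hT : ∀ x y m, mulT x (m - 1) ≫ mulT y m = mulT y (m - 1) ≫ mulT x m)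

theorem bijective_secMap_mul {y : L} (hy : ∀ m, Function.Bijective (secMap F (mulT y m)))
    (l : List L) (i : ℕ) (m : ℤ) :
    Function.Bijective (secMap F ((koszulComplex T mulT hT l).mul y i m)) := by
  induction l generalizing i m with
  | nil =>
    cases i with
    | zero => exact hy m
    | succ i =>
      have : ∀ s : F.obj (0 : 𝒮), s = 0 := fun s ↦ by
        rw [← secMap_id F s, id_zero, secMap_zero]
      exact ⟨fun s s' _ ↦ (this s).trans (this s').symm, fun s ↦ ⟨0, (map_zero _).trans (this s).symm⟩⟩
  | cons x l ih =>
    cases i with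
    | zero => exact ih 0 m
    | succ i => exact bijective_secMap_biprod_map F (ih (i + 1) m) (ih i (m - 1))

theorem exists_secMap_d_zero {C : MulComplex 𝒮 L} {y : L} (c : C.Contraction y) {m : ℤ}
    (hy : Function.Bijective (secMap F (C.mul y 0 m))) (s : F.obj (C.X 0 m)) :
    ∃ t, secMap F (C.d 0 m) t = s := by
  obtain ⟨s, rfl⟩ := hy.2 s
  refine ⟨secMap F (c.h 0 m) s, ?_⟩
  rw [← secMap_comp, c.h_d_zero]

/-- If `y` is bijective, a cycle is `y` times some s', and s' is again a cycle by injectivity one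
step lower. As `y` is h d + d h, the element h s' bounds the given cycle. -/
theorem exists_secMap_d_succ {C : MulComplex 𝒮 L} {y : L} (c : C.Contraction y) {i : ℕ} {m : ℤ}
    (hy : Function.Bijective (secMap F (C.mul y (i + 1) m)))
    (hy' : Function.Bijective (secMap F (C.mul y i m))) (s : F.obj (C.X (i + 1) m))
    (hs : secMap F (C.d i m) s = 0) :
    ∃ t, secMap F (C.d (i + 1) m) t = s := by
  obtain ⟨s, rfl⟩ := hy.2 s
  rw [← secMap_comp, C.mul_d, secMap_comp] at hs
  have hs' : secMap F (C.d i (m - 1)) s = 0 := hy'.1 (by rw [hs, map_zero])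
  refine ⟨secMap F (c.h (i + 1) m) s, ?_⟩
  rw [← secMap_comp, ← c.h_d, secMap_add, secMap_comp F (C.d i (m - 1)), hs', map_zero, add_zero]

/-- The submodule generated by the operators in a list, in degree `m`. -/
def imageOf (l : List L) (m : ℤ) : AddSubgroup (F.obj (T m)) :=
  match l with
  | [] => ⊥
  | x :: l => imageOf l m ⊔ (secMap F (mulT x m)).range

/-- The term of degree zero of the Koszul complex. -/
def koszulComplexZeroIso : ∀ (l : List L) (m : ℤ), (koszulComplex T mulT hT l).X 0 m ≅ T m
  | [], _ => Iso.refl _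
  | _ :: l, m => koszulComplexZeroIso l m

theorem mul_koszulComplexZeroIso (l : List L) (y : L) (m : ℤ) :
    (koszulComplex T mulT hT l).mul y 0 m ≫ (koszulComplexZeroIso T mulT hT l m).hom =
      (koszulComplexZeroIso T mulT hT l (m - 1)).hom ≫ mulT y m := by
  induction l with
  | nil => exact (Category.comp_id _).trans (Category.id_comp _).symm
  | cons x l ih => exact ih

theorem range_secMap_d (l : List L) (m : ℤ) :
    (secMap F ((koszulComplex T mulT hT l).d 0 m ≫
      (koszulComplexZeroIso T mulT hT l m).hom)).range = imageOf F T mulT l m := by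
  induction l with
  | nil =>
    ext s
    simp only [imageOf, AddMonoidHom.mem_range, AddSubgroup.mem_bot]
    have : (koszulComplex T mulT hT []).d 0 m ≫
      (koszulComplexZeroIso T mulT hT [] m).hom = 0 := zero_comp
    simp only [this, secMap_zero, exists_const, eq_comm]
  | cons x l ih =>
    have key : ∀ a b, secMap F ((koszulComplex T mulT hT (x :: l)).d 0 m ≫
        (koszulComplexZeroIso T mulT hT (x :: l) m).hom)
        (secMap F (biprod.inl : _ ⟶ (koszulComplex T mulT hT l).X 1 m ⊞
          (koszulComplex T mulT hT l).X 0 (m - 1)) a + secMap F biprod.inr b) =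
        secMap F ((koszulComplex T mulT hT l).d 0 m ≫ (koszulComplexZeroIso T mulT hT l m).hom) a +
        secMap F (mulT x m) (secMap F (koszulComplexZeroIso T mulT hT l (m - 1)).hom b) := by
      intro a b
      refine (secMap_comp F _ _ _).trans ((congrArg _ (secMap_biprod_desc F _ _ a b)).trans ?_)
      rw [← secMap_comp F _ (mulT x m), ← mul_koszulComplexZeroIso, secMap_comp, secMap_comp]
      exact map_add _ _ _
    ext s
    rw [imageOf, AddSubgroup.mem_sup]
    constructor
    · rintro ⟨t, rfl⟩
      obtain ⟨a, b, rfl⟩ := exists_biprod_sec F (A := (koszulComplex T mulT hT l).X 1 m)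
        (B := (koszulComplex T mulT hT l).X 0 (m - 1)) t
      exact ⟨_, ih ▸ ⟨a, rfl⟩, _, ⟨_, rfl⟩, (key a b).symm⟩
    · rintro ⟨u, hu, _, ⟨v, rfl⟩, rfl⟩
      rw [← ih] at hu
      obtain ⟨a, rfl⟩ := hu
      refine ⟨_, (key a (secMap F (koszulComplexZeroIso T mulT hT l (m - 1)).inv v)).trans ?_⟩
      rw [secMap_hom_inv]

/-! ### From exactness in degree one to regular sequences -/

/-- The exactness of the sections of a complex in homological degree one. -/
def MulComplex.IsExactAtOne (C : MulComplex 𝒮 L) : Prop :=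
  ∀ m (s : F.obj (C.X 1 m)), secMap F (C.d 0 m) s = 0 → ∃ t, secMap F (C.d 1 m) t = s

theorem MulComplex.IsExactAtOne.exists_of_cone {C : MulComplex 𝒮 L} {x : L}
    (h : (C.cone x).IsExactAtOne F) {m : ℤ} (a : F.obj (C.X 1 m)) (b : F.obj (C.X 0 (m - 1)))
    (hab : secMap F (C.d 0 m) a + secMap F (C.mul x 0 m) b = 0) :
    ∃ (a' : F.obj (C.X 2 m)) (b' : F.obj (C.X 1 (m - 1))),
      secMap F (C.d 1 m) a' + secMap F (C.mul x 1 m) b' = a ∧ -secMap F (C.d 0 (m - 1)) b' = b := by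
  obtain ⟨t, ht⟩ := h m (secMap F (biprod.inl : _ ⟶ C.X 1 m ⊞ C.X 0 (m - 1)) a +
    secMap F biprod.inr b) ((secMap_biprod_desc F _ _ a b).trans hab)
  obtain ⟨a', b', rfl⟩ := exists_biprod_sec F (A := C.X 2 m) (B := C.X 1 (m - 1)) t
  refine ⟨a', b', ?_⟩
  refine biprod_sec_ext F (Eq.trans ?_ ((secMap_biprod_desc F (C.d 1 m ≫ biprod.inl)
    (C.mul x 1 m ≫ biprod.inl - C.d 0 (m - 1) ≫ biprod.inr) a' b').symm.trans ht))
  rw [secMap_sub, secMap_comp, secMap_comp, secMap_comp, map_add, map_neg]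
  abel

/-- Since H₁ of the cone vanishes, multiplication by `x` from degree m - 1 is surjective on H₁ of
`C`. As H₁ is zero in low degrees, induction on the degree kills it everywhere. -/
theorem MulComplex.IsExactAtOne.of_cone {C : MulComplex 𝒮 L} {x : L}
    (h : (C.cone x).IsExactAtOne F) (h0 : ∃ m₀, ∀ m < m₀, ∀ s : F.obj (C.X 1 m), s = 0) :
    C.IsExactAtOne F := by
  obtain ⟨m₀, h0⟩ := h0
  have key : ∀ (k : ℕ) (m : ℤ), m < m₀ + k → ∀ s : F.obj (C.X 1 m), secMap F (C.d 0 m) s = 0 →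
      ∃ t, secMap F (C.d 1 m) t = s := by
    intro k
    induction k with
    | zero =>
      intro m hm s _
      exact ⟨0, by rw [map_zero, h0 m (by simpa using hm) s]⟩
    | succ k ih =>
      intro m hm s hs
      obtain ⟨a, b, rfl, hb⟩ := h.exists_of_cone F s 0 (by rw [hs, map_zero, add_zero])
      rw [neg_eq_zero] at hb
      obtain ⟨b, rfl⟩ := ih (m - 1) (by push_cast at hm; omega) b hb
      refine ⟨a + secMap F (C.mul x 2 m) b, ?_⟩
      rw [map_add, ← secMap_comp, ← secMap_comp, C.mul_d]
  exact fun m s hs ↦ key (m - m₀ + 1).toNat m (by omega) s hs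

/-- The operators in a list form a regular sequence on the sections of a graded object, when
read from right to left. -/
def IsRegularOn : List L → Prop
  | [] => True
  | x :: l => IsRegularOn l ∧ ∀ m s, secMap F (mulT x m) s ∈ imageOf F T mulT l m →
      s ∈ imageOf F T mulT l (m - 1)

theorem sec_koszulComplex_one_eq_zero (l : List L) {m : ℤ}
    (h : ∀ s : F.obj (T (m - 1)), s = 0) (s : F.obj ((koszulComplex T mulT hT l).X 1 m)) :
    s = 0 := by
  induction l with
  | nil =>
    have : 𝟙 (0 : 𝒮) = 0 := id_zero
    exact (secMap_id F (A := (0 : 𝒮)) s).symm.trans (this ▸ secMap_zero F s)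
  | cons x l ih =>
    obtain ⟨a, b, rfl⟩ := exists_biprod_sec F (A := (koszulComplex T mulT hT l).X 1 m)
      (B := (koszulComplex T mulT hT l).X 0 (m - 1)) s
    have hb : b = 0 := by
      rw [← secMap_id F b, ← (koszulComplexZeroIso T mulT hT l (m - 1)).hom_inv_id, secMap_comp,
        h (secMap F _ b), map_zero]
    rw [ih a, hb, map_zero, map_zero, add_zero]
    rfl

/-- If x s is the boundary of a, then (-a, s) is a cycle in the cone of `x`, and exactness makes s
itself a boundary up to sign. Exactness for the tail needs sections bounded below in degree, except
when the tail is empty. -/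
theorem isRegularOn_of_isExactAtOne (l : List L)
    (hl : (koszulComplex T mulT hT l).IsExactAtOne F)
    (h0 : l.length ≤ 1 ∨ ∃ m₀, ∀ m < m₀, ∀ s : F.obj (T m), s = 0) :
    IsRegularOn F T mulT l := by
  induction l with
  | nil => trivial
  | cons x l ih =>
    constructor
    · cases l with
      | nil => trivial
      | cons y l =>
        have h0' := h0.resolve_left (by simp)
        refine ih (MulComplex.IsExactAtOne.of_cone F hl ?_) (Or.inr h0')
        obtain ⟨m₀, h0'⟩ := h0'
        exact ⟨m₀, fun m hm ↦ sec_koszulComplex_one_eq_zero F T mulT hT _ (h0' _ (by omega))⟩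
    · intro m s hs
      rw [← range_secMap_d F T mulT hT] at hs ⊢
      obtain ⟨a, ha⟩ := hs
      obtain ⟨a', b', -, hb⟩ := MulComplex.IsExactAtOne.exists_of_cone F hl (-a)
        (secMap F (koszulComplexZeroIso T mulT hT l (m - 1)).inv s) (by
          have h1 := congrArg (secMap F (koszulComplexZeroIso T mulT hT l m).inv) ha
          rw [secMap_comp, secMap_inv_hom] at h1
          have h2 : (koszulComplexZeroIso T mulT hT l (m - 1)).inv ≫
              (koszulComplex T mulT hT l).mul x 0 m =
              mulT x m ≫ (koszulComplexZeroIso T mulT hT l m).inv := by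
            rw [Iso.eq_comp_inv, Category.assoc, mul_koszulComplexZeroIso, Iso.inv_hom_id_assoc]
          have h3 := (secMap_comp F _ _ s).symm.trans
            ((congrArg (fun φ ↦ secMap F φ s) h2).trans (secMap_comp F _ _ s))
          rw [map_neg, h1, h3, neg_add_cancel])
      refine ⟨-b', ?_⟩
      rw [secMap_comp, map_neg, hb, secMap_hom_inv]

end Sections

/-! ### Vanishing of cohomology -/

section Vanishing

variable (P : 𝒮)

/-- The vanishing of `Ext^j(P, A)`. -/
abbrev ExtVanish [HasExt.{0} 𝒮] (j : ℕ) (A : 𝒮) : Prop := Subsingleton (Ext P A j)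

variable {P} [HasExt.{0} 𝒮]

theorem ExtVanish.of_isZero {A : 𝒮} (h : IsZero A) (j : ℕ) : ExtVanish P j A :=
  subsingleton_of_forall_eq 0 fun x ↦ by
    rw [← Ext.comp_mk₀_id x, h.eq_of_src (𝟙 A) 0, Ext.mk₀_zero, Ext.comp_zero]

theorem extVanish_biprod_iff {A B : 𝒮} {j : ℕ} :
    ExtVanish P j (A ⊞ B) ↔ ExtVanish P j A ∧ ExtVanish P j B := by
  rw [ExtVanish, (Ext.addEquivBiprod (X := P) (Y₁ := A) (Y₂ := B) (n := j)).toEquiv.subsingleton_congr]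
  constructor
  · intro h
    exact ⟨⟨fun a b ↦ (Prod.ext_iff.1 (Subsingleton.elim (a, (0 : Ext P B j)) (b, 0))).1⟩,
      ⟨fun a b ↦ (Prod.ext_iff.1 (Subsingleton.elim ((0 : Ext P A j), a) (0, b))).2⟩⟩
  · rintro ⟨h1, h2⟩
    infer_instance

variable {S : ShortComplex 𝒮} (hS : S.ShortExact)
include hS

theorem ExtVanish.X₂ {j : ℕ} (h1 : ExtVanish P j S.X₁) (h3 : ExtVanish P j S.X₃) :
    ExtVanish P j S.X₂ :=
  subsingleton_of_forall_eq 0 fun x ↦ by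
    obtain ⟨y, rfl⟩ := Ext.covariant_sequence_exact₂ P hS x (Subsingleton.elim _ _)
    rw [Subsingleton.elim y 0, Ext.zero_comp]

theorem ExtVanish.X₃ {j : ℕ} (h2 : ExtVanish P j S.X₂) (h1 : ExtVanish P (j + 1) S.X₁) :
    ExtVanish P j S.X₃ :=
  subsingleton_of_forall_eq 0 fun x ↦ by
    obtain ⟨y, rfl⟩ := Ext.covariant_sequence_exact₃ P hS x rfl (Subsingleton.elim _ _)
    rw [Subsingleton.elim y 0, Ext.zero_comp]

theorem ExtVanish.X₁_succ {j : ℕ} (h3 : ExtVanish P j S.X₃) (h2 : ExtVanish P (j + 1) S.X₂) :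
    ExtVanish P (j + 1) S.X₁ :=
  subsingleton_of_forall_eq 0 fun x ↦ by
    obtain ⟨y, rfl⟩ := Ext.covariant_sequence_exact₁ P hS x (Subsingleton.elim _ _) rfl
    rw [Subsingleton.elim y 0, Ext.zero_comp]

theorem ExtVanish.X₁_zero (h2 : ExtVanish P 0 S.X₂) : ExtVanish P 0 S.X₁ :=
  subsingleton_of_forall_eq 0 fun x ↦ by
    have := hS.mono_f
    exact Ext.postcomp_mk₀_injective_of_mono P S.f (Subsingleton.elim _ _)

omit hS

theorem ext_comp_mk₀_comp_mk₀ {A B D : 𝒮} (t : Ext P A 0) (φ : A ⟶ B) (ψ : B ⟶ D) :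
    (t.comp (Ext.mk₀ φ) (add_zero 0)).comp (Ext.mk₀ ψ) (add_zero 0) =
      t.comp (Ext.mk₀ (φ ≫ ψ)) (add_zero 0) := by
  rw [Ext.comp_assoc _ _ _ (add_zero 0) (add_zero 0) (by simp), Ext.mk₀_comp_mk₀]

/-! ### Exact complexes -/

/-- An exact complex `⋯ → X 1 → X 0 → 0` of finite length. -/
structure ExactComplex (𝒮 : Type 1) [Category.{0} 𝒮] [Abelian 𝒮] where
  /-- the objects -/
  X : ℕ → 𝒮
  /-- the differentials -/
  d : ∀ i, X (i + 1) ⟶ X i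
  d_d : ∀ i, d (i + 1) ≫ d i = 0
  exact : ∀ i, (ShortComplex.mk (d (i + 1)) (d i) (d_d i)).Exact
  epi : Epi (d 0)

namespace ExactComplex

variable (C : ExactComplex 𝒮)

/-- The cycles. -/
def Z : ℕ → 𝒮
  | 0 => C.X 0
  | i + 1 => kernel (C.d i)

/-- The differential, as a map onto the cycles. -/
def toZ : ∀ i, C.X (i + 1) ⟶ C.Z i
  | 0 => C.d 0
  | i + 1 => kernel.lift (C.d i) (C.d (i + 1)) (C.d_d i)

theorem ι_toZ : ∀ i, kernel.ι (C.d i) ≫ C.toZ i = 0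
  | 0 => kernel.condition _
  | i + 1 => by
    have : kernel.ι (C.d (i + 1)) ≫ kernel.lift (C.d i) (C.d (i + 1)) (C.d_d i) = 0 := by
      rw [← cancel_mono (kernel.ι (C.d i)), Category.assoc, kernel.lift_ι, kernel.condition,
        zero_comp]
    exact this

theorem shortExact : ∀ i, (ShortComplex.mk (kernel.ι (C.d i) : C.Z (i + 1) ⟶ C.X (i + 1))
    (C.toZ i) (C.ι_toZ i)).ShortExact
  | 0 =>
    { exact := ShortComplex.exact_of_f_is_kernel _ (kernelIsKernel (C.d 0))
      mono_f := inferInstanceAs (Mono (kernel.ι (C.d 0)))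
      epi_g := C.epi }
  | i + 1 =>
    { exact := ShortComplex.exact_of_f_is_kernel _
        (isKernelOfComp (kernel.ι (C.d i)) _ (kernelIsKernel (C.d (i + 1)))
          (C.ι_toZ (i + 1)) (kernel.lift_ι _ _ _))
      mono_f := inferInstanceAs (Mono (kernel.ι (C.d (i + 1))))
      epi_g := (ShortComplex.exact_iff_epi_kernel_lift _).1 (C.exact i) }

/-- Dimension shifting to the left of the complex: 0 → Z_{i+1} → X_{i+1} → Z_i → 0 trades the j-th
Ext of Z_i for the (j+1)-st of Z_{i+1}. The complex is finite, so this ends at zero. -/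
theorem extVanish_Z_of_le {n : ℕ} (hn : ∀ i > n, IsZero (C.X i)) {j i : ℕ}
    (h : ∀ k, ExtVanish P (j + k) (C.X (i + k + 1))) : ExtVanish P j (C.Z i) := by
  have key : ∀ k j i, n < i + k → (∀ k, ExtVanish P (j + k) (C.X (i + k + 1))) →
      ExtVanish P j (C.Z i) := by
    intro k
    induction k with
    | zero =>
      intro j i hi _
      have : Epi (C.toZ i) := (C.shortExact i).epi_g
      exact .of_isZero (IsZero.of_epi (C.toZ i) (hn (i + 1) (by omega))) j
    | succ k ih =>
      intro j i hi h
      refine .X₃ (C.shortExact i) (h 0) (ih (j + 1) (i + 1) (by omega) fun k' ↦ ?_)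
      have := h (k' + 1)
      rwa [show j + (k' + 1) = j + 1 + k' by omega, show i + (k' + 1) = i + 1 + k' by omega] at this
  exact key (n + 1) j i (by omega) h

/-- Dimension shifting in the opposite direction, lowering both indices. Because j < i, the Ext
index reaches zero while the cycles still embed into a term of the complex, where left exactness
finishes. -/
theorem extVanish_Z_of_lt {j i : ℕ} (hij : j < i)
    (h : ∀ k ≤ j, ExtVanish P (j - k) (C.X (i - k))) : ExtVanish P j (C.Z i) := by
  induction j generalizing i with
  | zero =>
    obtain ⟨i, rfl⟩ := Nat.exists_eq_add_of_lt hij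
    rw [zero_add] at h ⊢
    exact .X₁_zero (C.shortExact i) (h 0 le_rfl)
  | succ j ih =>
    obtain ⟨i, rfl⟩ : ∃ i', i = i' + 1 := ⟨i - 1, by omega⟩
    refine .X₁_succ (C.shortExact i) (ih (by omega) fun k hk ↦ ?_) (h 0 (by omega))
    have := h (k + 1) (by omega)
    rwa [Nat.add_sub_add_right, Nat.add_sub_add_right] at this

theorem extVanish_X_zero {n : ℕ} (hn : ∀ i > n, IsZero (C.X i)) {j : ℕ}
    (h : ∀ k, ExtVanish P (j + k) (C.X (k + 1))) : ExtVanish P j (C.X 0) :=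
  C.extVanish_Z_of_le (i := 0) hn fun k ↦ by rw [zero_add]; exact h k

/-- The last term has no cycles, so it is Z_n, to which downward shifting applies. -/
theorem extVanish_X_last {n : ℕ} (hn : ∀ i > n + 1, IsZero (C.X i)) {j : ℕ} (hj : j < n)
    (h : ∀ k ≤ j, ExtVanish P (j - k) (C.X (n - k))) : ExtVanish P j (C.X (n + 1)) := by
  suffices h0 : IsZero (C.Z (n + 1)) from
    .X₂ (C.shortExact n) (.of_isZero h0 _) (C.extVanish_Z_of_lt hj h)
  have : Epi (C.toZ (n + 1)) := (C.shortExact (n + 1)).epi_g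
  exact IsZero.of_epi (C.toZ (n + 1)) (hn (n + 2) (by omega))

theorem exists_comp_d_zero (h : ExtVanish P 1 (C.Z 1)) (s : Ext P (C.X 0) 0) :
    ∃ t : Ext P (C.X 1) 0, t.comp (Ext.mk₀ (C.d 0)) (add_zero 0) = s :=
  Ext.covariant_sequence_exact₃ P (C.shortExact 0) s rfl (h.elim _ _)

theorem exists_comp_d_one (h : ExtVanish P 1 (C.Z 2)) (s : Ext P (C.X 1) 0)
    (hs : s.comp (Ext.mk₀ (C.d 0)) (add_zero 0) = 0) :
    ∃ t : Ext P (C.X 2) 0, t.comp (Ext.mk₀ (C.d 1)) (add_zero 0) = s := by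
  obtain ⟨u, rfl⟩ := Ext.covariant_sequence_exact₂ P (C.shortExact 0) s hs
  obtain ⟨t, rfl⟩ := Ext.covariant_sequence_exact₃ P (C.shortExact 1) u rfl (h.elim _ _)
  have key : ∀ t : Ext P (C.X 2) 0, t.comp (Ext.mk₀ (C.d 1)) (add_zero 0) =
      (t.comp (Ext.mk₀ (C.toZ 1)) (add_zero 0)).comp
        (Ext.mk₀ (kernel.ι (C.d 0) : C.Z 1 ⟶ C.X 1)) (add_zero 0) := by
    intro t
    refine Eq.trans ?_ (ext_comp_mk₀_comp_mk₀ t (C.toZ 1) (kernel.ι (C.d 0))).symm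
    exact congrArg (fun φ ↦ t.comp (Ext.mk₀ φ) (add_zero 0))
      (kernel.lift_ι (C.d 0) (C.d 1) (C.d_d 0)).symm
  exact ⟨t, key t⟩

end ExactComplex

/-! ### Vanishing for the terms of the Koszul complex -/

variable (T : ℤ → 𝒮) (mulT : L → ∀ m, T (m - 1) ⟶ T m)
  (hT : ∀ x y m, mulT x (m - 1) ≫ mulT y m = mulT y (m - 1) ≫ mulT x m)

theorem isZero_koszulComplex (l : List L) {i : ℕ} (hi : l.length < i) (m : ℤ) :
    IsZero ((koszulComplex T mulT hT l).X i m) := by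
  induction l generalizing i m with
  | nil =>
    obtain ⟨i, rfl⟩ : ∃ i', i = i' + 1 := ⟨i - 1, by simp at hi; omega⟩
    exact isZero_zero _
  | cons x l ih =>
    obtain ⟨i, rfl⟩ : ∃ i', i = i' + 1 := ⟨i - 1, by simp at hi; omega⟩
    rw [List.length_cons] at hi
    refine (biprod_isZero_iff _ _).2 ⟨ih (by omega) m, ih (by omega) _⟩

/-- The i-th term is a direct sum of copies of T (m - i). -/
theorem extVanish_koszulComplex (l : List L) {i j : ℕ} {m k : ℤ} (hk : k = m - i)
    (h : ExtVanish P j (T k)) : ExtVanish P j ((koszulComplex T mulT hT l).X i m) := by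
  induction l generalizing i m with
  | nil =>
    cases i with
    | zero =>
      obtain rfl : k = m := by simpa using hk
      exact h
    | succ i => exact .of_isZero (isZero_zero _) j
  | cons x l ih =>
    cases i with
    | zero => exact ih hk
    | succ i =>
      exact extVanish_biprod_iff.2 ⟨ih hk, ih (by rw [hk]; push_cast; ring)⟩

/-- In the top term, the iterated second summand is a copy of T (m - length). -/
theorem ExtVanish.of_koszulComplex (l : List L) {j : ℕ} {m k : ℤ} (hk : k = m - l.length)
    (h : ExtVanish P j ((koszulComplex T mulT hT l).X l.length m)) : ExtVanish P j (T k) := by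
  induction l generalizing m with
  | nil =>
    obtain rfl : k = m := by simpa using hk
    exact h
  | cons x l ih =>
    exact ih (by rw [hk, List.length_cons]; push_cast; ring) (extVanish_biprod_iff.1 h).2

end Vanishing

end Koszul

end UlrichKoszul

end

noncomputable section

namespace UlrichKoszul

open Opposite Limits Abelian

/-! ### Sheaves of abelian groups -/

section AbSheaf

variable (X : TopCat.{0})

/-- The category of sheaves of abelian groups. -/
abbrev AbSheaf : Type 1 := Sheaf (Opens.grothendieckTopology X) AddCommGrpCat.{0}

/-- The sections over `V`. -/
abbrev secFunctor (V : Opens X) : AbSheaf X ⥤ AddCommGrpCat.{0} :=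
  sheafToPresheaf _ _ ⋙ (evaluation _ _).obj (op V)

variable {X}

theorem injective_secMap_of_mono {A B : AbSheaf X} (φ : A ⟶ B) [Mono φ] (V : Opens X) :
    Function.Injective (secMap (secFunctor X V) φ) :=
  (AddCommGrpCat.mono_iff_injective ((secFunctor X V).map φ)).1 inferInstance

theorem epi_of_locally_surjective {A B : AbSheaf X} (φ : A ⟶ B)
    (h : ∀ x : X, ∃ U : Opens X, x ∈ U ∧ ∀ V ≤ U, ∀ s : (secFunctor X V).obj B,
      ∃ t, secMap (secFunctor X V) φ t = s) : Epi φ := by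
  rw [← Sheaf.isLocallySurjective_iff_epi']
  refine (TopCat.Presheaf.isLocallySurjective_iff φ.hom).2 fun U t x hx ↦ ?_
  obtain ⟨U', hx', h'⟩ := h x
  obtain ⟨s, hs⟩ := h' (U ⊓ U') inf_le_right (B.obj.map (homOfLE inf_le_left).op t)
  exact ⟨U ⊓ U', inf_le_left, ⟨s, hs⟩, hx, hx'⟩

theorem exact_of_locally_exact (S : ShortComplex (AbSheaf X))
    (h : ∀ x : X, ∃ U : Opens X, x ∈ U ∧ ∀ V ≤ U, ∀ s : (secFunctor X V).obj S.X₂,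
      secMap (secFunctor X V) S.g s = 0 → ∃ t, secMap (secFunctor X V) S.f t = s) : S.Exact := by
  rw [ShortComplex.exact_iff_epi_kernel_lift]
  refine epi_of_locally_surjective _ fun x ↦ ?_
  obtain ⟨U, hxU, hU⟩ := h x
  refine ⟨U, hxU, fun V hV s ↦ ?_⟩
  obtain ⟨t, ht⟩ := hU V hV (secMap (secFunctor X V) (kernel.ι S.g) s) (by
    rw [← secMap_comp, kernel.condition, secMap_zero])
  refine ⟨t, injective_secMap_of_mono (kernel.ι S.g) V ?_⟩
  rw [← secMap_comp, kernel.lift_ι, ht]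

theorem ExtVanish.of_iso {P A B : AbSheaf X} {j : ℕ} (e : A ≅ B) (h : ExtVanish P j A) :
    ExtVanish P j B :=
  subsingleton_of_forall_eq 0 fun x ↦ by
    rw [← Ext.comp_mk₀_id x, ← e.inv_hom_id, ← Ext.mk₀_comp_mk₀,
      ← Ext.comp_assoc _ _ _ (add_zero j) (add_zero 0) (by simp),
      Subsingleton.elim (x.comp (Ext.mk₀ e.inv) (add_zero j)) 0, Ext.zero_comp]

variable (X) in
/-- The object that represents the global sections. -/
abbrev constSheaf : AbSheaf X :=
  (constantSheaf (Opens.grothendieckTopology X) AddCommGrpCat.{0}).obj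
    (AddCommGrpCat.of (ULift ℤ))

/-- Global sections as elements of an `Ext` group. -/
def globalEquiv (A : AbSheaf X) : Ext (constSheaf X) A 0 ≃+ (secFunctor X ⊤).obj A :=
  Sheaf.H.equiv₀ A isTerminalTop

theorem globalEquiv_comp {A B : AbSheaf X} (φ : A ⟶ B) (s : Ext (constSheaf X) A 0) :
    globalEquiv B (s.comp (Ext.mk₀ φ) (add_zero 0)) =
      secMap (secFunctor X ⊤) φ (globalEquiv A s) :=
  (Sheaf.H.equiv₀_naturality isTerminalTop φ s).symm

theorem global_eq_zero {A : AbSheaf X} (h : ExtVanish (constSheaf X) 0 A)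
    (s : (secFunctor X ⊤).obj A) : s = 0 := by
  obtain ⟨s, rfl⟩ := (globalEquiv A).surjective s
  rw [Subsingleton.elim s 0, map_zero]

theorem ExactComplex.exists_global_d_zero (C : ExactComplex (AbSheaf X))
    (h : ExtVanish (constSheaf X) 1 (C.Z 1)) (s : (secFunctor X ⊤).obj (C.X 0)) :
    ∃ t, secMap (secFunctor X ⊤) (C.d 0) t = s := by
  obtain ⟨s, rfl⟩ := (globalEquiv _).surjective s
  obtain ⟨t, rfl⟩ := C.exists_comp_d_zero h s
  exact ⟨globalEquiv _ t, (globalEquiv_comp _ _).symm⟩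

theorem ExactComplex.exists_global_d_one (C : ExactComplex (AbSheaf X))
    (h : ExtVanish (constSheaf X) 1 (C.Z 2)) (s : (secFunctor X ⊤).obj (C.X 1))
    (hs : secMap (secFunctor X ⊤) (C.d 0) s = 0) :
    ∃ t, secMap (secFunctor X ⊤) (C.d 1) t = s := by
  obtain ⟨s, rfl⟩ := (globalEquiv _).surjective s
  obtain ⟨t, rfl⟩ := C.exists_comp_d_one h s ((globalEquiv _).injective (by
    rw [globalEquiv_comp, hs, map_zero]))
  exact ⟨globalEquiv _ t, (globalEquiv_comp _ _).symm⟩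

/-! ### Castelnuovo-Mumford regularity -/

variable {L : Type} (T : ℤ → AbSheaf X) (mulT : L → ∀ m, T (m - 1) ⟶ T m)
  (hT : ∀ x y m, mulT x (m - 1) ≫ mulT y m = mulT y (m - 1) ≫ mulT x m)

/-- The Koszul complex of operators that are invertible locally. -/
def exactKoszulComplex (l : List L)
    (h : ∀ x : X, ∃ U : Opens X, x ∈ U ∧ ∃ y ∈ l, ∀ V ≤ U, ∀ m,
      Function.Bijective (secMap (secFunctor X V) (mulT y m))) (m : ℤ) :
    ExactComplex (AbSheaf X) where
  X i := (koszulComplex T mulT hT l).X i m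
  d i := (koszulComplex T mulT hT l).d i m
  d_d i := (koszulComplex T mulT hT l).d_d i m
  exact i := by
    refine exact_of_locally_exact _ fun x ↦ ?_
    obtain ⟨U, hxU, y, hy, hU⟩ := h x
    refine ⟨U, hxU, fun V hV s hs ↦ ?_⟩
    obtain ⟨c⟩ := nonempty_contraction T mulT hT hy
    exact exists_secMap_d_succ _ c (bijective_secMap_mul _ T mulT hT (hU V hV) l _ m)
      (bijective_secMap_mul _ T mulT hT (hU V hV) l _ m) s hs
  epi := by
    refine epi_of_locally_surjective _ fun x ↦ ?_
    obtain ⟨U, hxU, y, hy, hU⟩ := h x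
    refine ⟨U, hxU, fun V hV s ↦ ?_⟩
    obtain ⟨c⟩ := nonempty_contraction T mulT hT hy
    exact exists_secMap_d_zero _ c (bijective_secMap_mul _ T mulT hT (hU V hV) l _ m) s

variable {T mulT} {l : List L}
  (h : ∀ x : X, ∃ U : Opens X, x ∈ U ∧ ∃ y ∈ l, ∀ V ≤ U, ∀ m,
      Function.Bijective (secMap (secFunctor X V) (mulT y m)))

include hT h

/-- Mumford's argument: T m is the right end of the exact Koszul complex, so vanishing for (j, m)
follows from vanishing for all (j + k, m - k - 1). The sum of the two indices drops by one, whence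
the induction on q = m + j. -/
theorem extVanish_of_regular
    (hreg : ∀ j : ℕ, 0 < j → ExtVanish (constSheaf X) j (T (-j))) {j : ℕ} (hj : 0 < j) {m : ℤ}
    (hm : -j ≤ m) : ExtVanish (constSheaf X) j (T m) := by
  have key : ∀ (q : ℕ) (j : ℕ), 0 < j → ∀ m : ℤ, m = -j + q →
      ExtVanish (constSheaf X) j (T m) := by
    intro q
    induction q with
    | zero =>
      intro j hj m hm
      obtain rfl : m = -j := by simpa using hm
      exact hreg j hj
    | succ q ih =>
      intro j hj m hm
      refine ExtVanish.of_iso (koszulComplexZeroIso T mulT hT l m) ?_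
      refine (exactKoszulComplex T mulT hT l h m).extVanish_X_zero (n := l.length)
        (fun i hi ↦ isZero_koszulComplex T mulT hT l hi m) fun k ↦ ?_
      exact extVanish_koszulComplex T mulT hT l rfl
        (ih (j + k) (by omega) _ (by push_cast at hm ⊢; omega))
  exact key (m + j).toNat j hj m (by omega)

/-- The mirror image: T m is the left end of the complex in twist m + n + 1, so vanishing for (j, m)
follows from vanishing for all (j - k, m + k + 1) with k ≤ j. The induction is on q = -j - 1 - m. -/
theorem extVanish_of_left {n : ℕ} (hn : l.length = n + 1)
    (hleft : ∀ j : ℕ, j < n → ExtVanish (constSheaf X) j (T (-j - 1))) {j : ℕ} (hj : j < n) {m : ℤ}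
    (hm : m ≤ -j - 1) : ExtVanish (constSheaf X) j (T m) := by
  have key : ∀ (q : ℕ) (j : ℕ), j < n → ∀ m : ℤ, m = -j - 1 - q →
      ExtVanish (constSheaf X) j (T m) := by
    intro q
    induction q with
    | zero =>
      intro j hj m hm
      obtain rfl : m = -j - 1 := by simpa using hm
      exact hleft j hj
    | succ q ih =>
      intro j hj m hm
      refine ExtVanish.of_koszulComplex T mulT hT l (m := m + l.length) (by simp) ?_
      have := (exactKoszulComplex T mulT hT l h (m + l.length)).extVanish_X_last
        (P := constSheaf X) (n := n)
        (fun i hi ↦ isZero_koszulComplex T mulT hT l (by omega) _) hj fun k hk ↦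
          extVanish_koszulComplex T mulT hT l rfl (ih (j - k) (by omega) _ (by
            push_cast [hn, hk, (by omega : k ≤ n)] at hm ⊢; omega))
      rw [hn]
      exact hn ▸ this
  exact key (-j - 1 - m).toNat j hj m (by omega)

/-- The obstruction is H^1 of the first cycles, controlled by H^{k+1}(T (m - k - 2)). These twists
lie in the regular range exactly when m ≥ 1. -/
theorem mem_imageOf_of_regular
    (hreg : ∀ j : ℕ, 0 < j → ExtVanish (constSheaf X) j (T (-j))) {m : ℤ} (hm : 0 < m)
    (s : (secFunctor X ⊤).obj (T m)) : s ∈ imageOf (secFunctor X ⊤) T mulT l m := by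
  rw [← range_secMap_d _ T mulT hT]
  have := (exactKoszulComplex T mulT hT l h m).exists_global_d_zero
    (ExactComplex.extVanish_Z_of_le _ (n := l.length)
      (fun i hi ↦ isZero_koszulComplex T mulT hT l hi m) fun k ↦
      extVanish_koszulComplex T mulT hT l rfl
        (extVanish_of_regular hT h hreg (by omega) (by push_cast; omega)))
  obtain ⟨t, ht⟩ := this (secMap _ (koszulComplexZeroIso T mulT hT l m).inv s)
  refine ⟨t, (secMap_comp _ _ _ _).trans ((congrArg _ ht).trans ?_)⟩
  exact secMap_hom_inv _ _ s

/-- Exactness in homological degree one is obstructed by H^1 of the second cycles, controlled by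
H^{k+1} of the term of index k + 3. For k + 1 < n the two vanishing ranges together cover every
twist; for larger k that term is zero, the complex having length n + 1. -/
theorem isRegularOn_of_regular {n : ℕ} (hn : l.length = n + 1)
    (hreg : ∀ j : ℕ, 0 < j → ExtVanish (constSheaf X) j (T (-j)))
    (hleft : ∀ j : ℕ, j < n → ExtVanish (constSheaf X) j (T (-j - 1))) :
    IsRegularOn (secFunctor X ⊤) T mulT l := by
  refine isRegularOn_of_isExactAtOne _ T mulT hT l (fun m s hs ↦ ?_) ?_
  · refine (exactKoszulComplex T mulT hT l h m).exists_global_d_one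
      (ExactComplex.extVanish_Z_of_le _ (n := l.length)
      (fun i hi ↦ isZero_koszulComplex T mulT hT l hi m) fun k ↦ ?_) s hs
    by_cases hk : k + 1 < n
    · refine extVanish_koszulComplex T mulT hT l rfl ?_
      by_cases hm : -((1 + k : ℕ) : ℤ) ≤ m - ((2 + k + 1 : ℕ) : ℤ)
      · exact extVanish_of_regular hT h hreg (by omega) hm
      · exact extVanish_of_left hT h hn hleft (by omega) (by omega)
    · exact .of_isZero (isZero_koszulComplex T mulT hT l (by omega) m) _
  -- For n = 0 there is a single form; otherwise sections vanish in all negative twists.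
  · rcases Nat.eq_zero_or_pos n with rfl | h0
    · exact Or.inl (by omega)
    · exact Or.inr ⟨0, fun m hm ↦ global_eq_zero
        (extVanish_of_left hT h hn hleft h0 (by simpa using Int.le_sub_one_of_lt hm))⟩

end AbSheaf

end UlrichKoszul

end

noncomputable section

namespace UlrichKoszul

open Opposite Limits Abelian DirectSum

/-! ### Direct sums of subgroups as graded modules -/

section DirectSumGrading

variable {A M : Type} [CommRing A] [AddCommGroup M] [Module A M] (𝓐 : ℕ → AddSubgroup A)
  [SetLike.GradedMonoid 𝓐] (𝓜 : ℕ → AddSubgroup M) [SetLike.GradedSMul 𝓐 𝓜]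

/-- The homogeneous part of degree `m` of a direct sum. -/
abbrev pieces (m : ℕ) : AddSubgroup (⨁ i, 𝓜 i) := (of (fun i ↦ 𝓜 i) m).range

variable {𝓐 𝓜}

theorem coe_of_component {i : ℕ} (s : 𝓜 i) (j : ℕ) :
    (((of (fun i ↦ 𝓜 i) i s) j : 𝓜 j) : M) = if i = j then (s : M) else 0 := by
  rw [coe_of_apply]
  split_ifs <;> rfl

theorem coe_component_congr (y : ⨁ i, 𝓜 i) {i j : ℕ} (h : i = j) :
    ((y i : 𝓜 i) : M) = (y j : 𝓜 j) := by
  subst h; rfl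

theorem coe_of_smul_apply {a : ℕ} (r : 𝓐 a) (y : ⨁ i, 𝓜 i) (j : ℕ) :
    (((of (fun i ↦ 𝓐 i) a r • y) j : 𝓜 j) : M) =
      if a ≤ j then (r : A) • ((y (j - a) : 𝓜 (j - a)) : M) else 0 := by
  induction y using DirectSum.induction_on with
  | zero => simp
  | add y z hy hz =>
    rw [smul_add, DirectSum.add_apply, AddSubgroup.coe_add, hy, hz]
    split_ifs <;> simp
  | of i s =>
    rw [Gmodule.of_smul_of, coe_of_component, coe_of_component]
    by_cases h : a + i = j
    · subst h
      rw [if_pos (vadd_eq_add a i), if_pos (by omega), if_pos (by omega)]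
      rfl
    · rw [if_neg fun h' ↦ h ((vadd_eq_add a i).symm.trans h')]
      split_ifs with h1 h2
      · omega
      · rw [smul_zero]
      · rfl

theorem coe_of_mul_apply' {a : ℕ} (r : 𝓐 a) (y : ⨁ i, 𝓐 i) (j : ℕ) :
    (((of (fun i ↦ 𝓐 i) a r * y) j : 𝓐 j) : A) =
      if a ≤ j then (r : A) * ((y (j - a) : 𝓐 (j - a)) : A) else 0 := by
  split_ifs with h
  · obtain ⟨i, rfl⟩ := Nat.exists_eq_add_of_le h
    rw [Nat.add_sub_cancel_left, coe_of_mul_apply_add]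
  · exact coe_of_mul_apply_of_not_le _ r y j h

theorem of_component_eq_iff {i : ℕ} {m : ⨁ i, 𝓜 i} :
    m ∈ pieces 𝓜 i ↔ of (fun i ↦ 𝓜 i) i (m i) = m := by
  constructor
  · rintro ⟨s, rfl⟩
    rw [of_eq_same]
  · exact fun h ↦ ⟨_, h⟩

theorem exists_sum_of_component (m : ⨁ i, 𝓜 i) :
    ∃ n, ∀ k ≥ n, ∑ i ∈ Finset.range k, of (fun i ↦ 𝓜 i) i (m i) = m := by
  classical
  refine ⟨m.support.sup id + 1, fun k hk ↦ ?_⟩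
  conv_rhs => rw [← DirectSum.sum_support_of m]
  refine (Finset.sum_subset (fun i hi ↦ ?_) fun i _ hi ↦ ?_).symm
  · have := Finset.le_sup (f := id) hi
    simp only [id] at this
    exact Finset.mem_range.2 (by omega)
  · rw [DFinsupp.notMem_support_iff.1 hi, map_zero]

theorem of_component_component (i j : ℕ) (m : ⨁ i, 𝓜 i) :
    of (fun i ↦ 𝓜 i) i (of (fun i ↦ 𝓜 i) j (m j) i) =
      if i = j then of (fun i ↦ 𝓜 i) j (m j) else 0 := by
  split_ifs with h
  · subst h; rw [of_eq_same]
  · rw [of_eq_of_ne _ _ _ h, map_zero]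

theorem ext_coe {m m' : ⨁ i, 𝓜 i} (h : ∀ i, ((m i : 𝓜 i) : M) = (m' i : 𝓜 i)) : m = m' :=
  DFinsupp.ext fun i ↦ Subtype.ext (h i)

variable (𝓐 𝓜) in
/-- The grading of a direct sum. -/
def directSumGrading : ModuleGrading (pieces 𝓐) (⨁ i, 𝓜 i) where
  proj i := (of (fun i ↦ 𝓜 i) i).comp
    { toFun := fun m ↦ m i, map_zero' := rfl, map_add' := fun _ _ ↦ rfl }
  proj_proj := of_component_component
  exists_sum := exists_sum_of_component
  proj_smul_add := by
    rintro a _ ⟨r, rfl⟩ i m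
    refine ext_coe fun j ↦ ?_
    change ((of (fun i ↦ 𝓜 i) (a + i) ((of (fun i ↦ 𝓐 i) a r • m) (a + i)) j : 𝓜 j) : M) =
      ((of (fun i ↦ 𝓐 i) a r • of (fun i ↦ 𝓜 i) i (m i)) j : 𝓜 j)
    rw [coe_of_component, coe_of_smul_apply, coe_of_smul_apply, coe_of_component]
    by_cases h : a + i = j
    · subst h
      rw [if_pos rfl, if_pos (by omega), if_pos (by omega), if_pos (by omega),
        Nat.add_sub_cancel_left]
    · rw [if_neg h]
      split_ifs with h1 h2
      · omega
      · simp
      · rfl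
  proj_smul_of_lt := by
    rintro a _ ⟨r, rfl⟩ j hj m
    change of (fun i ↦ 𝓜 i) j ((of (fun i ↦ 𝓐 i) a r • m) j) = 0
    have : (of (fun i ↦ 𝓐 i) a r • m) j = 0 :=
      Subtype.ext ((coe_of_smul_apply r m j).trans (if_neg (by omega)))
    rw [this, map_zero]

variable (𝓐) in
/-- The grading of a direct sum of subgroups of a ring. -/
def directSumRingGrading (h : ∀ r ∈ 𝓐 0, r ≠ 0 → ∃ s ∈ 𝓐 0, r * s = 1) :
    RingGrading (pieces 𝓐) where
  proj i := (of (fun i ↦ 𝓐 i) i).comp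
    { toFun := fun m ↦ m i, map_zero' := rfl, map_add' := fun _ _ ↦ rfl }
  proj_proj := of_component_component
  exists_sum := exists_sum_of_component
  proj_smul_add := by
    rintro a _ ⟨r, rfl⟩ i m
    refine ext_coe fun j ↦ ?_
    change ((of (fun i ↦ 𝓐 i) (a + i) ((of (fun i ↦ 𝓐 i) a r * m) (a + i)) j : 𝓐 j) : A) =
      ((of (fun i ↦ 𝓐 i) a r * of (fun i ↦ 𝓐 i) i (m i)) j : 𝓐 j)
    rw [coe_of_component, coe_of_mul_apply', coe_of_mul_apply', coe_of_component]
    by_cases h : a + i = j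
    · subst h
      rw [if_pos rfl, if_pos (by omega), if_pos (by omega), if_pos (by omega),
        Nat.add_sub_cancel_left]
    · rw [if_neg h]
      split_ifs with h1 h2
      · omega
      · simp
      · rfl
  proj_smul_of_lt := by
    rintro a _ ⟨r, rfl⟩ j hj m
    change of (fun i ↦ 𝓐 i) j ((of (fun i ↦ 𝓐 i) a r * m) j) = 0
    have : (of (fun i ↦ 𝓐 i) a r * m) j = 0 :=
      Subtype.ext ((coe_of_mul_apply' r m j).trans (if_neg (by omega)))
    rw [this, map_zero]
  mem_iff := of_component_eq_iff
  one_mem := ⟨1, rfl⟩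
  exists_inv := by
    rintro _ ⟨r, rfl⟩ hr
    obtain ⟨s, hs, hrs⟩ := h r r.2 fun h0 ↦ hr (by
      rw [show r = 0 from Subtype.ext h0, map_zero])
    refine ⟨of (fun i ↦ 𝓐 i) 0 ⟨s, hs⟩, ⟨_, rfl⟩, ?_⟩
    refine ext_coe fun j ↦ ?_
    have h1 : (1 : ⨁ i, 𝓐 i) = of (fun i ↦ 𝓐 i) 0 ⟨1, SetLike.GradedOne.one_mem⟩ := rfl
    rw [coe_of_mul_apply', h1, coe_of_component, coe_of_component, if_pos (Nat.zero_le j), Nat.sub_zero]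
    split_ifs
    · exact hrs
    · exact mul_zero _

/-! ### Regular lists on a direct sum -/

variable (T : ℤ → AddSubgroup M)

/-- The part of degree `m` of the submodule that is generated by the elements of a list of elements
of degree one. -/
def spanAt (m : ℤ) : List A → AddSubgroup M
  | [] => ⊥
  | x :: l => spanAt m l ⊔ (T (m - 1)).map (DistribSMul.toAddMonoidHom M x)

theorem mem_spanAt_cons {m : ℤ} {x : A} {l : List A} {s : M} :
    s ∈ spanAt T m (x :: l) ↔ ∃ u ∈ spanAt T m l, ∃ v ∈ T (m - 1), u + x • v = s := by
  simp [spanAt, AddSubgroup.mem_sup]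

variable {T} (hT : ∀ i : ℕ, 𝓜 i = T i)
include hT

theorem component_mem_spanAt {l : List (𝓐 1)} {y : ⨁ i, 𝓜 i}
    (hy : y ∈ smulSpan (⨁ i, 𝓜 i) (l.map (of (fun i ↦ 𝓐 i) 1))) (i : ℕ) :
    ((y i : 𝓜 i) : M) ∈ spanAt T i (l.map Subtype.val) := by
  induction l generalizing y with
  | nil =>
    have : y = 0 := hy
    rw [this]
    exact zero_mem _
  | cons x l ih =>
    obtain ⟨u, hu, v, rfl⟩ := mem_smulSpan_cons.1 hy
    rw [List.map_cons, mem_spanAt_cons, DirectSum.add_apply, AddSubgroup.coe_add, coe_of_smul_apply]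
    cases i with
    | zero => exact ⟨_, ih hu, 0, zero_mem _, by simp⟩
    | succ i =>
      refine ⟨_, ih hu, v i, ?_, by simp⟩
      have := (hT i).le (v i).2
      simpa using this

variable (hmul : ∀ (x : 𝓐 1) (m : ℤ), ∀ s ∈ T (m - 1), (x : A) • s ∈ T m)
include hmul

omit [SetLike.GradedMonoid 𝓐] [SetLike.GradedSMul 𝓐 𝓜] hT in
theorem spanAt_le (l : List (𝓐 1)) (m : ℤ) : spanAt T m (l.map Subtype.val) ≤ T m := by
  induction l with
  | nil => exact bot_le
  | cons x l ih =>
    refine sup_le ih ?_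
    rintro _ ⟨s, hs, rfl⟩
    exact hmul x m s hs

/-- `T` is indexed by all integers but the direct sum only by natural numbers. The single mismatch
is in degree zero, where `spanAt` may use `T (-1)`; `hi` excludes this. -/
theorem of_mem_smulSpan {l : List (𝓐 1)} {i : ℕ} (hi : 0 < i ∨ l = [] ∨ T (-1) = ⊥) (s : 𝓜 i)
    (hs : (s : M) ∈ spanAt T i (l.map Subtype.val)) :
    of (fun i ↦ 𝓜 i) i s ∈ smulSpan (⨁ i, 𝓜 i) (l.map (of (fun i ↦ 𝓐 i) 1)) := by
  induction l generalizing s with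
  | nil =>
    have : s = 0 := Subtype.ext hs
    rw [this, map_zero]
    exact zero_mem _
  | cons x l ih =>
    rw [List.map_cons, mem_spanAt_cons] at hs
    obtain ⟨u, hu, v, hv, hs⟩ := hs
    have hi' : 0 < i ∨ l = [] ∨ T (-1) = ⊥ :=
      hi.imp_right fun h ↦ Or.inr (h.resolve_left (List.cons_ne_nil _ _))
    have hu' : u ∈ 𝓜 i := hT i ▸ spanAt_le hmul l i hu
    have hv' : x.1 • v ∈ 𝓜 i := hT i ▸ hmul x i v hv
    rw [show s = ⟨u, hu'⟩ + ⟨x.1 • v, hv'⟩ from Subtype.ext hs.symm, map_add]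
    refine add_mem (Submodule.mem_sup_left (ih hi' ⟨u, hu'⟩ hu)) ?_
    cases i with
    | zero =>
      have hv0 : v = 0 := by
        have := (hi.resolve_left (lt_irrefl 0)).resolve_left (List.cons_ne_nil _ _)
        rwa [Nat.cast_zero, zero_sub, this, AddSubgroup.mem_bot] at hv
      rw [show (⟨x.1 • v, hv'⟩ : 𝓜 0) = 0 from Subtype.ext ((congrArg (x.1 • ·) hv0).trans (smul_zero _)),
        map_zero]
      exact zero_mem _
    | succ i =>
      have hv1 : v ∈ 𝓜 i := by
        rw [hT]; simpa using hv
      refine Submodule.mem_sup_right ⟨of (fun i ↦ 𝓜 i) i ⟨v, hv1⟩, ?_⟩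
      refine ext_coe fun j ↦ ?_
      rw [LinearMap.lsmul_apply, coe_of_smul_apply, coe_of_component, coe_of_component]
      by_cases h : i + 1 = j
      · subst h
        rw [if_pos rfl, if_pos (by omega), if_pos (by omega)]
      · rw [if_neg h]
        split_ifs with h1 h2
        · omega
        · rw [smul_zero]
        · rfl

variable (T) in
omit hT hmul in
/-- The elements of a list form a regular sequence, when read from right to left. -/
def IsRegularAt : List A → Prop
  | [] => True
  | x :: l => IsRegularAt l ∧ ∀ m, ∀ s ∈ T (m - 1), x • s ∈ spanAt T m l → s ∈ spanAt T (m - 1) l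

/-- Membership in the submodules is tested on homogeneous components. At each step either the tail
is empty or `T (-1)` is zero, so the mismatch in degree zero does no harm. -/
theorem isRegularList_of_isRegularAt {l : List (𝓐 1)} (hl : IsRegularAt T (l.map Subtype.val))
    (h0 : l.length ≤ 1 ∨ T (-1) = ⊥) (hA : ∀ x ∈ l, ∀ a : A, (x : A) * a = 0 → a = 0) :
    IsRegularList (pieces 𝓐) (⨁ i, 𝓜 i) (l.map (of (fun i ↦ 𝓐 i) 1)) := by
  induction l with
  | nil => trivial
  | cons x l ih =>
    refine ⟨ih hl.1 (h0.imp_left fun h ↦ ?_) fun y hy ↦ hA y (List.mem_cons_of_mem _ hy),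
      ⟨x, rfl⟩, fun r hr ↦ ?_, fun m hm ↦ ?_⟩
    · rw [List.length_cons] at h
      omega
    · refine ext_coe fun j ↦ hA x List.mem_cons_self _ ?_
      have := congrArg (fun r : ⨁ i, 𝓐 i ↦ ((r (1 + j) : 𝓐 (1 + j)) : A)) hr
      simp only [coe_of_mul_apply', if_pos (Nat.le_add_right 1 j)] at this
      rwa [coe_component_congr r (Nat.add_sub_cancel_left 1 j)] at this
    · refine (directSumGrading 𝓐 𝓜).mem_of_proj_mem _ fun i ↦ ?_
      refine of_mem_smulSpan hT hmul (Or.inr (h0.imp_left fun h ↦ ?_)) _ ?_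
      · rw [List.length_cons] at h
        exact List.length_eq_zero_iff.1 (by omega)
      · have h1 := component_mem_spanAt hT hm (1 + i)
        rw [coe_of_smul_apply, if_pos (by omega),
          coe_component_congr m (Nat.add_sub_cancel_left 1 i)] at h1
        have e : ((1 + i : ℕ) : ℤ) - 1 = i := by push_cast; ring
        have h2 := hl.2 (1 + i : ℕ) (m i) (e.symm ▸ hT i ▸ (m i).2) h1
        exact e ▸ h2

theorem directSumGrading_proj_mem_smulSpan {l : List (𝓐 1)}
    (h : ∀ m : ℤ, 0 < m → T m ≤ spanAt T m (l.map Subtype.val)) (i : ℕ) (m : ⨁ i, 𝓜 i) :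
    (directSumGrading 𝓐 𝓜).proj (i + 1) m ∈
      smulSpan (⨁ i, 𝓜 i) (l.map (of (fun i ↦ 𝓐 i) 1)) := by
  refine of_mem_smulSpan hT hmul (Or.inl (by omega)) _ (h _ (by omega) ?_)
  rw [← hT]
  exact (m (i + 1)).2

end DirectSumGrading

end UlrichKoszul

end

noncomputable section

namespace UlrichKoszul

open Opposite Limits Abelian

/-! ### Multiplication by linear forms -/

section Twist

variable {N : ℕ} {X : Scheme.{0}} (f : X ⟶ projSpace N) (E : X.Modules)

/-- The twists, in the category of abelian sheaves. -/
abbrev twistAb (m : ℤ) : AbSheaf X := twist f E m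

/-- The coordinates of a section of `𝒪(1)`, restricted to `V`. -/
def localCoord (a : ringPiece f 1) (V : X.Opens) (k : Fin (N + 1)) : Γ(X, V ⊓ chart f k) :=
  resFun (inf_le_inf_right (chart f k) (le_top : V ≤ ⊤)) (a.1 k)

theorem resFun_localCoord (a : ringPiece f 1) {V W : X.Opens} (h : W ≤ V) (k : Fin (N + 1)) :
    resFun (inf_le_inf_right (chart f k) h) (localCoord f a V k) = localCoord f a W k :=
  resFun_resFun _ _ _

theorem resFun_self {U : X.Opens} (h : U ≤ U) (a : Γ(X, U)) : resFun h a = a :=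
  congrArg (fun φ ↦ φ.hom a) (X.presheaf.map_id _)

theorem localCoord_top (a : ringPiece f 1) (k : Fin (N + 1)) : localCoord f a ⊤ k = a.1 k :=
  resFun_self _ _

theorem localCoord_overlap (a : ringPiece f 1) (V : X.Opens) (k l : Fin (N + 1)) :
    resFun (overlap_le_left f V k l) (localCoord f a V k) =
      transition f 1 V k l * resFun (overlap_le_right f V k l) (localCoord f a V l) := by
  have h := congrArg (resFun (inf_le_inf_right (overlap f k l) (le_top : V ≤ ⊤))) (a.2 k l)
  rw [map_mul, resFun_resFun, resFun_resFun] at h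
  rw [localCoord, localCoord, resFun_resFun, resFun_resFun]
  exact h.trans (congrArg (· * _) (map_transition f 1 le_top k l))

theorem transition_sub_one_mul (m : ℤ) (V : X.Opens) (k l : Fin (N + 1)) :
    transition f (m - 1) V k l * transition f 1 V k l = transition f m V k l := by
  rw [← transition_add, sub_add_cancel]

/-- Multiplication by a section of `𝒪(1)`. -/
def mulSections (a : ringPiece f 1) (m : ℤ) (V : X.Opens) :
    twistSections f E (m - 1) V →+ twistSections f E m V where
  toFun s := ⟨fun k ↦ localCoord f a V k • s.1 k, fun k l ↦ by
    rw [resMod_smul, resMod_smul, localCoord_overlap f a V k l, s.2 k l,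
      ← transition_sub_one_mul f m V, smul_smul, smul_smul]
    congr 1
    ring⟩
  map_zero' := Subtype.ext (funext fun k ↦ smul_zero (localCoord f a V k))
  map_add' s t := Subtype.ext (funext fun k ↦ smul_add (localCoord f a V k) (s.1 k) (t.1 k))

theorem mulSections_comm (a b : ringPiece f 1) (m : ℤ) (V : X.Opens)
    (s : twistSections f E (m - 1 - 1) V) :
    mulSections f E a m V (mulSections f E b (m - 1) V s) =
      mulSections f E b m V (mulSections f E a (m - 1) V s) :=
  Subtype.ext (funext fun k ↦ smul_comm (localCoord f a V k) (localCoord f b V k) (s.1 k))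

theorem mulSections_restrict (a : ringPiece f 1) (m : ℤ) {V W : X.Opens} (h : W ≤ V)
    (s : twistSections f E (m - 1) V) :
    mulSections f E a m W ⟨_, restrict_mem f E h s.2⟩ =
      ⟨_, restrict_mem f E h (mulSections f E a m V s).2⟩ := by
  refine Subtype.ext (funext fun k ↦ ?_)
  have := resMod_smul E (inf_le_inf_right (chart f k) h) (localCoord f a V k) (s.1 k)
  rw [resFun_localCoord f a h] at this
  exact this.symm

/-- Multiplication by a section of `𝒪(1)`, as a map of sheaves. -/
def mulTwist (a : ringPiece f 1) (m : ℤ) : twistAb f E (m - 1) ⟶ twistAb f E m where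
  hom :=
    { app := fun V ↦ AddCommGrpCat.ofHom (mulSections f E a m V.unop)
      naturality := fun _ _ i ↦ AddCommGrpCat.hom_ext (AddMonoidHom.ext fun s ↦
        mulSections_restrict f E a m i.unop.le s) }

theorem mulTwist_comm (a b : ringPiece f 1) (m : ℤ) :
    mulTwist f E a (m - 1) ≫ mulTwist f E b m = mulTwist f E b (m - 1) ≫ mulTwist f E a m := by
  apply Sheaf.hom_ext
  apply NatTrans.ext
  funext V
  exact AddCommGrpCat.hom_ext (AddMonoidHom.ext fun s ↦ mulSections_comm f E b a m V.unop s)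

/-! ### Invertibility of linear forms on their nonvanishing loci -/

theorem isUnit_of_le_basicOpen (a : ringPiece f 1) {k : Fin (N + 1)} {V : X.Opens}
    (hV : V ≤ X.basicOpen (a.1 k)) (l : Fin (N + 1)) :
    IsUnit (localCoord f a V l) := by
  have hk : V ≤ chart f k := (hV.trans (X.basicOpen_le _)).trans inf_le_right
  have hle : V ⊓ chart f l ≤ V ⊓ overlap f k l := le_inf inf_le_left (fun x hx ↦ ⟨hk hx.1, hx.2⟩)
  have h1 := localCoord_overlap f a V k l
  have h2 : IsUnit (resFun (overlap_le_left f V k l) (localCoord f a V k)) := by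
    have : IsUnit (resFun (X.basicOpen_le (a.1 k)) (a.1 k)) :=
      RingedSpace.isUnit_res_basicOpen X.toRingedSpace (a.1 k)
    have := this.map (resFun (X := X) ((inf_le_left : V ⊓ overlap f k l ≤ V).trans hV))
    rw [resFun_resFun] at this
    rw [localCoord, resFun_resFun]
    exact this
  -- In different charts the coordinates of the form differ by a transition factor, so invertibility
  -- passes from chart `k` to chart `l`.
  rw [h1] at h2
  have h3 := (isUnit_of_mul_isUnit_right h2).map (resFun (X := X) hle)
  rw [resFun_resFun] at h3
  rwa [resFun_self] at h3

/-- The inverse divides chart by chart; the inverse coordinates glue with the inverse transition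
functions, so the quotients form a section of the twist by m - 1. -/
theorem bijective_mulSections {a : ringPiece f 1} {V : X.Opens}
    (ha : ∀ l, IsUnit (localCoord f a V l)) (m : ℤ) :
    Function.Bijective (mulSections f E a m V) := by
  constructor
  · intro s t h
    refine Subtype.ext (funext fun k ↦ ?_)
    have : localCoord f a V k • s.1 k = localCoord f a V k • t.1 k :=
      congrFun (congrArg Subtype.val h) k
    exact (ha k).smul_left_cancel.1 this
  · intro s
    choose u hu using ha
    refine ⟨⟨fun k ↦ (↑(u k)⁻¹ : Γ(X, V ⊓ chart f k)) • s.1 k, fun k l ↦ ?_⟩, ?_⟩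
    · have h1 := localCoord_overlap f a V k l
      rw [← hu, ← hu] at h1
      refine ((u k).isUnit.map (resFun (overlap_le_left f V k l))).smul_left_cancel.1 ?_
      have e1 : resFun (overlap_le_left f V k l) (u k : Γ(X, V ⊓ chart f k)) *
        resFun (overlap_le_left f V k l) (↑(u k)⁻¹ : Γ(X, V ⊓ chart f k)) = 1 := by
        rw [← map_mul, Units.mul_inv, map_one]
      have e2 : resFun (overlap_le_right f V k l) (u l : Γ(X, V ⊓ chart f l)) *
        resFun (overlap_le_right f V k l) (↑(u l)⁻¹ : Γ(X, V ⊓ chart f l)) = 1 := by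
        rw [← map_mul, Units.mul_inv, map_one]
      rw [resMod_smul, resMod_smul, smul_smul, e1, one_smul, s.2 k l, h1,
        ← transition_sub_one_mul f m V, smul_smul, smul_smul]
      congr 1
      linear_combination (transition f (m - 1) V k l * transition f 1 V k l) * (- e2)
    · refine Subtype.ext (funext fun k ↦ ?_)
      change localCoord f a V k • (↑(u k)⁻¹ : Γ(X, V ⊓ chart f k)) • s.1 k = s.1 k
      rw [← hu, smul_smul, Units.mul_inv, one_smul]

theorem exists_bijective_mulTwist {l : List (ringPiece f 1)}
    (hl : ∀ x : X, ∃ a ∈ l, ∃ k, x ∈ X.basicOpen (a.1 k)) (x : X) :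
    ∃ U : X.Opens, x ∈ U ∧ ∃ a ∈ l, ∀ V ≤ U, ∀ m,
      Function.Bijective (secMap (secFunctor X V) (mulTwist f E a m)) := by
  obtain ⟨a, ha, k, hk⟩ := hl x
  exact ⟨_, hk, a, ha, fun V hV m ↦
    bijective_mulSections f E (isUnit_of_le_basicOpen f a hV) m⟩

theorem coe_mulSections_top (a : ringPiece f 1) (m : ℤ) (s : twistSections f E (m - 1) ⊤) :
    (mulSections f E a m ⊤ s : ChartModule f E) = (a : ChartRing f) • (s : ChartModule f E) := by
  refine funext fun k ↦ ?_
  change localCoord f a ⊤ k • s.1 k = a.1 k • s.1 k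
  rw [localCoord_top]

theorem mem_imageOf_iff (l : List (ringPiece f 1)) (m : ℤ) (s : twistSections f E m ⊤) :
    s ∈ imageOf (secFunctor X ⊤) (twistAb f E) (mulTwist f E) l m ↔
      (s : ChartModule f E) ∈ spanAt (twistSections f E · ⊤) m (l.map Subtype.val) := by
  induction l generalizing s with
  | nil => exact Subtype.ext_iff
  | cons a l ih =>
    rw [List.map_cons, mem_spanAt_cons, imageOf]
    refine AddSubgroup.mem_sup.trans ⟨?_, ?_⟩
    · rintro ⟨u, hu, _, ⟨v, rfl⟩, rfl⟩
      exact ⟨_, (ih u).1 hu, v.1, v.2, congrArg (u.1 + ·) (coe_mulSections_top f E a m v).symm⟩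
    · rintro ⟨u, hu, v, hv, h⟩
      have hu' : u ∈ twistSections f E m ⊤ := by
        rw [eq_sub_of_add_eq h]
        refine sub_mem s.2 ?_
        rw [← coe_mulSections_top f E a m ⟨v, hv⟩]
        exact (mulSections f E a m ⊤ ⟨v, hv⟩).2
      exact ⟨⟨u, hu'⟩, (ih ⟨u, hu'⟩).2 hu, _, ⟨⟨v, hv⟩, rfl⟩,
        Subtype.ext ((congrArg (u + ·) (coe_mulSections_top f E a m ⟨v, hv⟩)).trans h)⟩

theorem isRegularAt_of_isRegularOn {l : List (ringPiece f 1)}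
    (hl : IsRegularOn (secFunctor X ⊤) (twistAb f E) (mulTwist f E) l) :
    IsRegularAt (twistSections f E · ⊤) (l.map Subtype.val) := by
  induction l with
  | nil => trivial
  | cons a l ih =>
    refine ⟨ih hl.1, fun m s hs h ↦ ?_⟩
    rw [← coe_mulSections_top f E a m ⟨s, hs⟩, ← mem_imageOf_iff] at h
    exact (mem_imageOf_iff f E l (m - 1) ⟨s, hs⟩).1 (hl.2 m ⟨s, hs⟩ h)

theorem smul_mem_twistSections (a : ringPiece f 1) (m : ℤ) {s : ChartModule f E}
    (hs : s ∈ twistSections f E (m - 1) ⊤) : (a : ChartRing f) • s ∈ twistSections f E m ⊤ :=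
  coe_mulSections_top f E a m ⟨s, hs⟩ ▸ (mulSections f E a m ⊤ ⟨s, hs⟩).2

/-- The Ulrich condition makes linear forms without common zeros a regular sequence. -/
theorem isKoszulModule_iff_of_ulrich {l : List (ringPiece f 1)} {n : ℕ} (hn : l.length = n + 1)
    (hdim : (n : WithBot ℕ∞) ≤ topologicalKrullDim X) (hU : IsUlrich f E)
    (hl : ∀ x : X, ∃ a ∈ l, ∃ k, x ∈ X.basicOpen (a.1 k))
    (hreg : ∀ a ∈ l, ∀ b : ChartRing f, a.1 * b = 0 → b = 0)
    (hR : ∀ r ∈ ringPiece f 0, r ≠ 0 → ∃ s ∈ ringPiece f 0, r * s = 1)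
    (hM : ∃ s ∈ modulePiece f E 0, s ≠ 0) :
    IsKoszulModule (sectionRingGrading f) (sectionModuleGrading f E) ↔
      IsKoszulAlgebra (sectionRingGrading f) := by
  have hbij := exists_bijective_mulTwist f E hl
  have hright : ∀ j : ℕ, 0 < j → ExtVanish (constSheaf X) j (twistAb f E (-j)) := hU.regular
  have hleft : ∀ j : ℕ, j < n → ExtVanish (constSheaf X) j (twistAb f E (-j - 1)) := fun j hj ↦
    hU.cohomology_eq_zero j (lt_of_lt_of_le (by exact_mod_cast hj) hdim)
  have hT : ∀ i : ℕ, modulePiece f E i = twistSections f E i ⊤ := fun _ ↦ rfl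
  -- With more than one form n is positive, and then H^0(E(-1)) = 0.
  have h0 : l.length ≤ 1 ∨ twistSections f E (-1) ⊤ = ⊥ := by
    rcases Nat.eq_zero_or_pos n with rfl | h0
    · exact Or.inl (by omega)
    · refine Or.inr ((AddSubgroup.eq_bot_iff_forall _).2 fun s hs ↦ ?_)
      exact congrArg Subtype.val (global_eq_zero
        (extVanish_of_left (mulTwist_comm f E) hbij hn hleft h0 (m := -1) (by simp)) ⟨s, hs⟩)
  refine isKoszulModule_iff_isKoszulAlgebra (directSumRingGrading (ringPiece f) hR)
    (directSumGrading (ringPiece f) (modulePiece f E)) (sectionModuleGrading f E)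
    (fun _ ↦ of_component_eq_iff)
    (isRegularList_of_isRegularAt (T := (twistSections f E · ⊤)) hT
      (fun a m s hs ↦ smul_mem_twistSections f E a m hs)
      (isRegularAt_of_isRegularOn f E
        (isRegularOn_of_regular (mulTwist_comm f E) hbij hn hright hleft)) h0 hreg)
    (directSumGrading_proj_mem_smulSpan (T := (twistSections f E · ⊤)) hT
      (fun a m s hs ↦ smul_mem_twistSections f E a m hs) fun m hm s hs ↦ ?_) ?_
  · exact (mem_imageOf_iff f E l m ⟨s, hs⟩).1
      (mem_imageOf_of_regular (mulTwist_comm f E) hbij hright hm _)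
  · obtain ⟨s, hs, hs0⟩ := hM
    refine ⟨DirectSum.of (fun i ↦ modulePiece f E i) 0 ⟨s, hs⟩, ⟨_, rfl⟩, fun h ↦ hs0 ?_⟩
    have := congrArg (fun y : sectionModule f E ↦ ((y 0 : modulePiece f E 0) : ChartModule f E)) h
    rwa [DirectSum.of_eq_same] at this

end Twist

end UlrichKoszul

end

noncomputable section

namespace UlrichKoszul

open Opposite Limits

/-! ### Vector bundles are locally retracts of free modules -/

section Retract

theorem exists_sum_comp_eq_id {C : Type*} [Category C] [Preadditive C] (A : C) (r : ℕ)
    [HasCoproduct fun _ : Fin r ↦ A] :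
    ∃ (p : Fin r → ((∐ fun _ : Fin r ↦ A) ⟶ A)) (i : Fin r → (A ⟶ ∐ fun _ : Fin r ↦ A)),
      ∑ j, p j ≫ i j = 𝟙 _ := by
  refine ⟨fun j ↦ Sigma.desc fun k ↦ if k = j then 𝟙 A else 0, fun j ↦ Sigma.ι (fun _ ↦ A) j, ?_⟩
  refine Sigma.hom_ext _ _ fun k ↦ ?_
  rw [Preadditive.comp_sum, Finset.sum_eq_single k]
  · simp
  · intro j _ hj
    simp [hj.symm]
  · simp

theorem exists_retract_of_iso_free {Y : Scheme.{0}} {F : Y.Modules} {r : ℕ}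
    (e : F ≅ SheafOfModules.free (R := Y.ringCatSheaf) (Fin r)) :
    ∃ (p : Fin r → (F ⟶ structureModule Y)) (i : Fin r → (structureModule Y ⟶ F)),
      ∑ j, p j ≫ i j = 𝟙 F := by
  obtain ⟨G, e, p, i, h⟩ : ∃ (G : Y.Modules) (_ : F ≅ G) (p : Fin r → (G ⟶ structureModule Y))
      (i : Fin r → (structureModule Y ⟶ G)), ∑ j, p j ≫ i j = 𝟙 G := by
    obtain ⟨p, i, h⟩ := exists_sum_comp_eq_id (SheafOfModules.unit Y.ringCatSheaf) r
    exact ⟨_, e, p, i, h⟩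
  refine ⟨fun j ↦ e.hom ≫ p j, fun j ↦ i j ≫ e.inv, ?_⟩
  calc ∑ j, (e.hom ≫ p j) ≫ i j ≫ e.inv = e.hom ≫ (∑ j, p j ≫ i j) ≫ e.inv := by
        simp [Preadditive.sum_comp, Preadditive.comp_sum]
    _ = 𝟙 F := by rw [h]; simp

variable {X : Scheme.{0}} (E : X.Modules)

/-- The sections of `E` over the open subsets of `U` are a retract of those of a free module. -/
structure LocalRetract (U : X.Opens) where
  /-- the rank of the free module -/
  r : ℕ
  /-- the coordinates -/
  p : Fin r → ∀ V ≤ U, Γ(E, V) →+ Γ(X, V)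
  /-- the generators -/
  i : Fin r → ∀ V ≤ U, Γ(X, V) →+ Γ(E, V)
  p_smul : ∀ j V hV (a : Γ(X, V)) (s : Γ(E, V)), p j V hV (a • s) = a * p j V hV s
  i_mul : ∀ j V hV (a b : Γ(X, V)), i j V hV (a * b) = a • i j V hV b
  p_res : ∀ j V hV W (h : W ≤ V) s, p j W (h.trans hV) (resMod E h s) = resFun h (p j V hV s)
  i_res : ∀ j V hV W (h : W ≤ V) s, i j W (h.trans hV) (resFun h s) = resMod E h (i j V hV s)
  sum_eq : ∀ V hV s, ∑ j, i j V hV (p j V hV s) = s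

variable {E}

theorem app_restrict_smul {U : X.Opens} {F : U.toScheme.Modules} (φ : E.restrict U.ι ⟶ F)
    (V : U.toScheme.Opens) (a : Γ(X, U.ι ''ᵁ V)) (s : Γ(E, U.ι ''ᵁ V)) :
    φ.app V (a • s : Γ(E, U.ι ''ᵁ V)) = (show Γ(U, V) from a) • φ.app V s := by
  refine Eq.trans ?_ (φ.app_smul (U := V) (show Γ(U, V) from a) s)
  congr 1
  have : (U.ι.appIso V).inv (show Γ(U, V) from a) = a := by
    rw [Scheme.Opens.ι_appIso]; rfl
  exact congrArg (· • s) this.symm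

theorem app_restrict_smul' {U : X.Opens} {F : U.toScheme.Modules} (φ : F ⟶ E.restrict U.ι)
    (V : U.toScheme.Opens) (a : Γ(X, U.ι ''ᵁ V)) (s : Γ(F, V)) :
    φ.app V ((show Γ(U, V) from a) • s) = (a • (show Γ(E, U.ι ''ᵁ V) from φ.app V s) :
      Γ(E, U.ι ''ᵁ V)) := by
  refine (φ.app_smul (U := V) (show Γ(U, V) from a) s).trans ?_
  have : (U.ι.appIso V).inv (show Γ(U, V) from a) = a := by
    rw [Scheme.Opens.ι_appIso]; rfl
  exact congrArg (· • (show Γ(E, U.ι ''ᵁ V) from φ.app V s)) this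

theorem exists_localRetract (hE : IsVectorBundle E) (x : X) :
    ∃ U : X.Opens, x ∈ U ∧ Nonempty (LocalRetract E U) := by
  obtain ⟨U, hx, r, ⟨e⟩⟩ := hE x
  obtain ⟨p, i, h⟩ := exists_retract_of_iso_free e
  -- For V ≤ U the image of the preimage of V is V, though not definitionally; these two inclusions
  -- provide the restriction maps back and forth.
  have hle : ∀ {V : X.Opens}, V ≤ U → V ≤ U.ι ''ᵁ (U.ι ⁻¹ᵁ V) := fun {V} hV ↦ by
    rw [Scheme.Hom.image_preimage_eq_opensRange_inf, Scheme.Opens.opensRange_ι]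
    exact le_inf hV le_rfl
  have hge : ∀ {V : X.Opens}, U.ι ''ᵁ (U.ι ⁻¹ᵁ V) ≤ V := fun {V} ↦ by
    rw [Scheme.Hom.image_preimage_eq_opensRange_inf]
    exact inf_le_right
  let P : ∀ (j : Fin r) (V : X.Opens), Γ(E, U.ι ''ᵁ (U.ι ⁻¹ᵁ V)) →+ Γ(X, U.ι ''ᵁ (U.ι ⁻¹ᵁ V)) :=
    fun j V ↦ ((p j).app (U.ι ⁻¹ᵁ V)).hom
  let I : ∀ (j : Fin r) (V : X.Opens), Γ(X, U.ι ''ᵁ (U.ι ⁻¹ᵁ V)) →+ Γ(E, U.ι ''ᵁ (U.ι ⁻¹ᵁ V)) :=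
    fun j V ↦ ((i j).app (U.ι ⁻¹ᵁ V)).hom
  have hP : ∀ j V a s, P j V (a • s) = a * P j V s := fun j V a s ↦ app_restrict_smul (p j) _ a s
  have hI : ∀ j V a s, I j V (a * s) = a • I j V s := fun j V a s ↦ app_restrict_smul' (i j) _ a s
  have hPres : ∀ j V W (h : W ≤ V) (s : Γ(E, U.ι ''ᵁ (U.ι ⁻¹ᵁ V))),
      P j W (resMod E (U.ι.image_mono (U.ι.preimage_mono h)) s) =
        resFun (U.ι.image_mono (U.ι.preimage_mono h)) (P j V s) := fun j V W h s ↦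
    congrArg (fun φ ↦ φ.hom s)
      ((p j).mapPresheaf.naturality (homOfLE (U.ι.preimage_mono h)).op)
  have hIres : ∀ j V W (h : W ≤ V) (s : Γ(X, U.ι ''ᵁ (U.ι ⁻¹ᵁ V))),
      I j W (resFun (U.ι.image_mono (U.ι.preimage_mono h)) s) =
        resMod E (U.ι.image_mono (U.ι.preimage_mono h)) (I j V s) := fun j V W h s ↦
    congrArg (fun φ ↦ φ.hom s)
      ((i j).mapPresheaf.naturality (homOfLE (U.ι.preimage_mono h)).op)
  have hsum : ∀ V s, ∑ j, I j V (P j V s) = s := fun V s ↦ by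
    let Ψ : (E.restrict U.ι ⟶ E.restrict U.ι) →+ Γ(E.restrict U.ι, U.ι ⁻¹ᵁ V) :=
      { toFun := fun φ ↦ (φ.app (U.ι ⁻¹ᵁ V)).hom s
        map_zero' := rfl
        map_add' := fun _ _ ↦ rfl }
    exact (map_sum Ψ _ _).symm.trans (congrArg Ψ h)
  refine ⟨U, hx, ⟨⟨r,
    fun j V hV ↦ ((resFun (hle hV)).toAddMonoidHom.comp (P j V)).comp (resMod E hge),
    fun j V hV ↦ ((resMod E (hle hV)).comp (I j V)).comp (resFun hge).toAddMonoidHom,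
    fun j V hV a s ↦ ?_, fun j V hV a b ↦ ?_, fun j V hV W h s ↦ ?_, fun j V hV W h s ↦ ?_,
    fun V hV s ↦ ?_⟩⟩⟩
  · change resFun _ (P j V (resMod E hge (a • s))) = a * resFun _ (P j V (resMod E hge s))
    rw [resMod_smul, hP, map_mul, resFun_resFun, resFun_self]
  · change resMod E _ (I j V (resFun hge (a * b))) = a • resMod E _ (I j V (resFun hge b))
    rw [map_mul, hI, resMod_smul, resFun_resFun, resFun_self]
  · change resFun _ (P j W (resMod E hge (resMod E h s))) =
      resFun h (resFun _ (P j V (resMod E hge s)))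
    rw [resFun_resFun, ← resFun_resFun (U.ι.image_mono (U.ι.preimage_mono h)) (hle (h.trans hV)),
      ← hPres j V W h, resMod_resMod, resMod_resMod]
  · change resMod E _ (I j W (resFun hge (resFun h s))) =
      resMod E h (resMod E _ (I j V (resFun hge s)))
    rw [resMod_resMod, ← resMod_resMod E (U.ι.image_mono (U.ι.preimage_mono h))
      (hle (h.trans hV)), ← hIres j V W h, resFun_resFun, resFun_resFun]
  · change ∑ j, resMod E _ (I j V (resFun hge (resFun _ (P j V (resMod E hge s))))) = s
    simp only [resFun_resFun, resFun_self]
    rw [← map_sum, hsum, resMod_resMod, resMod_self]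

end Retract

/-! ### Vector bundles on integral schemes -/

section Integral

variable {X : Scheme.{0}} [IsIntegral X]

theorem resFun_injective {U V : X.Opens} (h : V ≤ U) (hV : (V : Set X).Nonempty) :
    Function.Injective (resFun h) := by
  have : Nonempty V := hV.to_subtype
  exact map_injective_of_isIntegral X (homOfLE h)

theorem inf_nonempty {U V : X.Opens} (hU : (U : Set X).Nonempty) (hV : (V : Set X).Nonempty) :
    ((U ⊓ V : X.Opens) : Set X).Nonempty :=
  nonempty_preirreducible_inter U.2 V.2 hU hV

theorem subsingleton_of_eq_empty (E : X.Modules) {V : X.Opens} (hV : ¬ (V : Set X).Nonempty) :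
    Subsingleton Γ(E, V) :=
  ⟨fun _ _ ↦ resMod_eq_of_cover E (ι := Empty) (fun _ ↦ ⊥) (fun _ ↦ bot_le)
    (fun x hx ↦ (hV ⟨x, hx⟩).elim) fun a ↦ a.elim⟩

/-- A vector bundle on an integral scheme is torsion-free. -/
theorem resMod_injective {E : X.Modules} (hE : IsVectorBundle E) {U V : X.Opens} (h : V ≤ U)
    (O : X.Opens) (hO : (O : Set X).Nonempty) (hV : U ⊓ O ≤ V) :
    Function.Injective (resMod E h) := by
  refine (injective_iff_map_eq_zero _).2 fun s hs ↦ ?_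
  choose W hxW hW using exists_localRetract hE
  refine resMod_eq_of_cover E (fun x ↦ U ⊓ W x) (fun _ ↦ inf_le_left)
    (fun x hx ↦ Opens.mem_iSup.2 ⟨x, hx, hxW x⟩) fun x ↦ ?_
  rw [map_zero]
  obtain ⟨L⟩ := hW x
  by_cases hne : ((U ⊓ W x : X.Opens) : Set X).Nonempty
  · rw [← L.sum_eq _ inf_le_right (resMod E _ s)]
    refine Finset.sum_eq_zero fun j _ ↦ ?_
    have hle : U ⊓ W x ⊓ O ≤ U ⊓ W x := inf_le_left
    -- The coordinates of `s` are regular functions on an integral scheme that vanish on a nonempty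
    -- open subset.
    have : L.p j _ inf_le_right (resMod E (inf_le_left : U ⊓ W x ≤ U) s) = 0 := by
      refine resFun_injective hle (inf_nonempty hne hO) ?_
      rw [map_zero, ← L.p_res, resMod_resMod,
        ← resMod_resMod E h ((inf_le_inf_right O inf_le_left).trans hV), hs, map_zero, map_zero]
    rw [this, map_zero]
  · exact (subsingleton_of_eq_empty E hne).elim _ _

theorem exists_section_ne_zero {E : X.Modules} (hE0 : ¬ IsZero E) :
    ∃ (V : X.Opens) (e : Γ(E, V)), e ≠ 0 := by
  by_contra! h
  refine hE0 ((IsZero.iff_id_eq_zero E).2 (Scheme.Modules.hom_ext _ _ fun U ↦ ?_))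
  ext s
  exact h U s

/-- Sections of vector bundles over basic open subsets of small affine open subsets extend, up to
powers. -/
theorem LocalRetract.exists_extend {E : X.Modules} {U : X.Opens} (L : LocalRetract E U)
    {W : X.Opens} (hW : IsAffineOpen W) (hWU : W ≤ U) (g : Γ(X, W)) (t : Γ(E, X.basicOpen g)) :
    ∃ (m₀ : ℕ), ∀ m ≥ m₀, ∃ w : Γ(E, W), resMod E (X.basicOpen_le g) w =
      resFun (X.basicOpen_le g) g ^ m • t := by
  have := hW.isLocalization_basicOpen g
  -- Functions on the basic open set are a localization, so each coordinate of `t` extends after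
  -- multiplication by a power of `g`. The largest of these finitely many exponents serves all
  -- coordinates.
  have key : ∀ j, ∃ (m : ℕ) (u : Γ(X, W)), resFun (X.basicOpen_le g) u =
      resFun (X.basicOpen_le g) g ^ m * L.p j _ ((X.basicOpen_le g).trans hWU) t := by
    intro j
    obtain ⟨m, u, hu⟩ := IsLocalization.Away.surj g (L.p j _ ((X.basicOpen_le g).trans hWU) t)
    exact ⟨m, u, hu.symm.trans (mul_comm _ _)⟩
  choose m u hu using key
  refine ⟨Finset.univ.sup m, fun k hk ↦ ⟨∑ j, L.i j W hWU (g ^ (k - m j) * u j), ?_⟩⟩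
  rw [map_sum]
  refine Eq.trans ?_ (congrArg (resFun (X.basicOpen_le g) g ^ k • ·)
    (L.sum_eq _ ((X.basicOpen_le g).trans hWU) t))
  rw [Finset.smul_sum]
  refine Finset.sum_congr rfl fun j hj ↦ ?_
  rw [← L.i_res, map_mul, hu, map_pow, ← mul_assoc, ← pow_add,
    Nat.sub_add_cancel ((Finset.le_sup hj).trans hk), L.i_mul]

end Integral

end UlrichKoszul

end

noncomputable section

namespace UlrichKoszul

open Opposite Limits

/-! ### Regular functions on the standard affine open sets -/

section ProjSpace

variable {N : ℕ}

theorem ext_stdOpen {k : Fin (N + 1)} {a b : Γ(projSpace N, stdOpen N k)}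
    (h : ∀ p : stdOpen N k, (a.1 p).val = (b.1 p).val) : a = b :=
  Subtype.ext (funext fun p ↦ HomogeneousLocalization.val_injective _ (h p))

theorem dehomog_coord_self (k : Fin (N + 1)) : dehomog k 1 (coord k) = 1 := by
  refine ext_stdOpen fun p ↦ ?_
  have : p.1.asHomogeneousIdeal.toIdeal.IsPrime := p.1.isPrime
  refine (dehomog_val k 1 (coord k) p).trans (Eq.trans ?_ HomogeneousLocalization.val_one.symm)
  rw [← Localization.mk_one, Localization.mk_eq_mk_iff, Localization.r_iff_exists]
  exact ⟨1, by simp [coord]⟩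

theorem dehomog_mul (k : Fin (N + 1)) {a b : ℕ} (F : polyGrading N a) (G : polyGrading N b)
    (H : polyGrading N (a + b)) (h : H.1 = F.1 * G.1) :
    dehomog k (a + b) H = dehomog k a F * dehomog k b G := by
  refine ext_stdOpen fun p ↦ ?_
  have : p.1.asHomogeneousIdeal.toIdeal.IsPrime := p.1.isPrime
  refine (dehomog_val k _ H p).trans (Eq.trans ?_ ((HomogeneousLocalization.val_mul _ _).trans
    (congrArg₂ (· * ·) (dehomog_val k _ F p) (dehomog_val k _ G p))).symm)
  rw [Localization.mk_mul, h, pow_add]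

theorem dehomog_add (k : Fin (N + 1)) {a : ℕ} (F G : polyGrading N a) :
    dehomog k a (F + G) = dehomog k a F + dehomog k a G := by
  refine ext_stdOpen fun p ↦ ?_
  have : p.1.asHomogeneousIdeal.toIdeal.IsPrime := p.1.isPrime
  refine (dehomog_val k _ _ p).trans (Eq.trans ?_ ((HomogeneousLocalization.val_add _ _).trans
    (congrArg₂ (· + ·) (dehomog_val k _ F p) (dehomog_val k _ G p))).symm)
  rw [Localization.add_mk_self]
  rfl

/-- The constant `c` as a form of degree zero. -/
def constForm (N : ℕ) (c : ℂ) : polyGrading N 0 :=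
  ⟨MvPolynomial.C c, MvPolynomial.isHomogeneous_C _ c⟩

theorem dehomog_constForm_one (k : Fin (N + 1)) : dehomog k 0 (constForm N 1) = 1 := by
  refine ext_stdOpen fun p ↦ ?_
  have : p.1.asHomogeneousIdeal.toIdeal.IsPrime := p.1.isPrime
  refine (dehomog_val k 0 _ p).trans (Eq.trans ?_ HomogeneousLocalization.val_one.symm)
  rw [← Localization.mk_one, Localization.mk_eq_mk_iff, Localization.r_iff_exists]
  exact ⟨1, by simp [constForm]⟩

theorem dehomog_smul (k : Fin (N + 1)) {a : ℕ} (c : ℂ) (F : polyGrading N a) :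
    dehomog k a (c • F) = dehomog k 0 (constForm N c) * dehomog k a F := by
  have key : ∀ b, b = a → ∀ G : polyGrading N b, G.1 = c • F.1 →
      dehomog k b G = dehomog k a (c • F) := by
    rintro b rfl G hG
    exact congrArg _ (Subtype.ext hG)
  have h := dehomog_mul k (constForm N c) F ⟨c • F.1, by rw [zero_add]; exact (c • F).2⟩
    (MvPolynomial.smul_eq_C_mul _ _)
  exact (key _ (zero_add a) _ rfl).symm.trans h

theorem exists_dehomog (k : Fin (N + 1)) (g : Γ(projSpace N, stdOpen N k)) :
    ∃ (d : ℕ) (F : polyGrading N d), dehomog k d F = g := by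
  have hk : (MvPolynomial.X k : MvPolynomial (Fin (N + 1)) ℂ) ∈ polyGrading N 1 :=
    MvPolynomial.isHomogeneous_X ℂ k
  have hs : Function.Surjective (Proj.awayToSection (polyGrading N) (MvPolynomial.X k)).hom :=
    ((ConcreteCategory.bijective_of_isIso
      (Proj.basicOpenIsoAway (polyGrading N) (MvPolynomial.X k) hk one_pos).hom).2)
  obtain ⟨z, rfl⟩ := hs g
  obtain ⟨d, F, hF, rfl⟩ := HomogeneousLocalization.Away.mk_surjective (polyGrading N) hk z
  exact ⟨d, ⟨F, by simpa using hF⟩, rfl⟩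

theorem basicOpen_dehomog_coord_le (k l : Fin (N + 1)) :
    (projSpace N).basicOpen (dehomog l 1 (coord k)) ≤ stdOpen N k := by
  intro p hp
  have hpl : p ∈ stdOpen N l := (projSpace N).basicOpen_le _ hp
  have hu : IsUnit ((((projSpace N).presheaf.map
      (homOfLE ((projSpace N).basicOpen_le (dehomog l 1 (coord k)))).op).hom
      (dehomog l 1 (coord k)))) := RingedSpace.isUnit_res_basicOpen _ _
  obtain ⟨H, hH⟩ := hu.exists_right_inv
  have h1 := congrArg (fun s : Γ(projSpace N, _) ↦ (s.1 ⟨p, hp⟩).val) hH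
  have : p.asHomogeneousIdeal.toIdeal.IsPrime := p.isPrime
  have h2 : ((dehomog l 1 (coord k)).1 ⟨p, hpl⟩).val * (H.1 ⟨p, hp⟩).val = 1 :=
    (HomogeneousLocalization.val_mul _ _).symm.trans (h1.trans HomogeneousLocalization.val_one)
  have h3 := dehomog_val l 1 (coord k) ⟨p, hpl⟩
  have h4 := IsUnit.of_mul_eq_one _ h2
  rw [show ((dehomog l 1 (coord k)).1 ⟨p, hpl⟩).val = _ from h3, Localization.mk_eq_mk',
    IsLocalization.AtPrime.isUnit_mk'_iff _ p.asHomogeneousIdeal.toIdeal] at h4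
  exact h4

theorem adjoin_range_X :
    Algebra.adjoin (polyGrading N 0)
      (Set.range (MvPolynomial.X : Fin (N + 1) → MvPolynomial (Fin (N + 1)) ℂ)) = ⊤ := by
  refine eq_top_iff.2 fun p _ ↦ ?_
  induction p using MvPolynomial.induction_on with
  | C c => exact (Algebra.adjoin _ _).algebraMap_mem (constForm N c)
  | add p q hp hq => exact add_mem (hp trivial) (hq trivial)
  | mul_X p n hp => exact mul_mem (hp trivial) (Algebra.subset_adjoin ⟨n, rfl⟩)

theorem exists_mem_stdOpen (p : projSpace N) : ∃ k, p ∈ stdOpen N k := by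
  have := Proj.iSup_basicOpen_eq_top' (polyGrading N)
    (fun k : Fin (N + 1) ↦ (MvPolynomial.X k : MvPolynomial (Fin (N + 1)) ℂ))
    (fun k ↦ ⟨1, MvPolynomial.isHomogeneous_X ℂ k⟩) adjoin_range_X
  exact Opens.mem_iSup.1 (this.ge (Set.mem_univ p))

instance : CompactSpace (projSpace N) := by
  have : Algebra.FiniteType (polyGrading N 0) (MvPolynomial (Fin (N + 1)) ℂ) :=
    ⟨(Subalgebra.fg_def).2 ⟨_, Set.finite_range _, adjoin_range_X⟩⟩
  exact QuasiCompact.compactSpace_of_compactSpace (Proj.toSpecZero (polyGrading N))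

/-- X is locally of finite type over ℂ, and compact as a closed subset of the compact space ℙ^N. -/
theorem isNoetherian_of_isClosedImmersion {X : Scheme.{0}} (f : X ⟶ projSpace N)
    [IsClosedImmersion f] [Smooth (f ≫ projSpaceToSpec N)] : IsNoetherian X :=
  { LocallyOfFiniteType.isLocallyNoetherian (f ≫ projSpaceToSpec N) with
    isCompact_univ := f.isClosedEmbedding.compactSpace.isCompact_univ }

end ProjSpace

/-! ### Nonvanishing loci of forms -/

section Forms

variable {N : ℕ} {X : Scheme.{0}} (f : X ⟶ projSpace N)

theorem exists_mem_chart (x : X) : ∃ k, x ∈ chart f k := exists_mem_stdOpen (f x)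

theorem restrictForm_apply {m : ℕ} (F : polyGrading N m) (k : Fin (N + 1)) :
    (restrictForm f m F).1 k = resFun inf_le_right ((f.app (stdOpen N k)).hom (dehomog k m F)) :=
  rfl

theorem restrictForm_coord_self (k : Fin (N + 1)) : (restrictForm f 1 (coord k)).1 k = 1 := by
  rw [restrictForm_apply, dehomog_coord_self, map_one, map_one]

theorem basicOpen_resFun {U V : X.Opens} (h : V ≤ U) (a : Γ(X, U)) :
    X.basicOpen (resFun h a) = V ⊓ X.basicOpen a :=
  X.basicOpen_res a (homOfLE h).op

theorem basicOpen_restrictForm_coord_le (k l : Fin (N + 1)) :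
    X.basicOpen ((restrictForm f 1 (coord k)).1 l) ≤ chart f k := by
  rw [restrictForm_apply, basicOpen_resFun]
  refine inf_le_right.trans ?_
  exact (Scheme.preimage_basicOpen f (dehomog l 1 (coord k))).ge.trans
    (f.preimage_mono (basicOpen_dehomog_coord_le k l))

theorem basicOpen_le_of_mem_ringPiece {d : ℕ} {a : ChartRing f} (ha : a ∈ ringPiece f d)
    (k l : Fin (N + 1)) : X.basicOpen (a k) ⊓ chart f l ≤ X.basicOpen (a l) := by
  have h := congrArg X.basicOpen (ha k l)
  have ht : IsUnit (transition f d ⊤ k l) := (Units.isUnit _).map _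
  rw [Scheme.basicOpen_mul, basicOpen_resFun, basicOpen_resFun, X.basicOpen_of_isUnit ht] at h
  intro x hx
  have hx' : x ∈ ((⊤ ⊓ overlap f k l) ⊓ X.basicOpen (a k) : X.Opens) :=
    ⟨⟨trivial, (X.basicOpen_le _ hx.1).2, hx.2⟩, hx.1⟩
  rw [h] at hx'
  exact hx'.2.2

/-- The open subset where a form does not vanish. -/
def locus (a : ChartRing f) : X.Opens := ⨆ k, X.basicOpen (a k)

theorem locus_inf_chart {d : ℕ} {a : ChartRing f} (ha : a ∈ ringPiece f d) (k : Fin (N + 1)) :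
    locus f a ⊓ chart f k = X.basicOpen (a k) := by
  refine le_antisymm ?_ (le_inf (le_iSup (fun k ↦ X.basicOpen (a k)) k)
    ((X.basicOpen_le _).trans inf_le_right))
  rw [locus, iSup_inf_eq]
  exact iSup_le fun l ↦ basicOpen_le_of_mem_ringPiece f ha l k

/-- Closed immersions are surjective on functions over affine opens, so a basic open neighbourhood
in a chart is cut out by F / x_k ^ d for a form F. The extra factor x_k keeps the nonvanishing locus
inside that chart. -/
theorem exists_locus_le [IsClosedImmersion f] {V : X.Opens} {x : X} (hx : x ∈ V) :
    ∃ (d : ℕ) (a : ChartRing f), a ∈ ringPiece f d ∧ x ∈ locus f a ∧ locus f a ≤ V := by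
  obtain ⟨k, hk⟩ := exists_mem_chart f x
  have hP : IsAffineOpen (stdOpen N k) :=
    Proj.isAffineOpen_basicOpen (polyGrading N) _ (MvPolynomial.isHomogeneous_X ℂ k) one_pos
  obtain ⟨g, hgV, hxg⟩ := (hP.preimage f).exists_basicOpen_le ⟨x, hx⟩ hk
  obtain ⟨G, rfl⟩ := f.app_surjective _ hP g
  obtain ⟨d, F, rfl⟩ := exists_dehomog k G
  set b := restrictForm f d F
  set c := restrictForm f 1 (coord k)
  have hb : X.basicOpen (b.1 k) ≤ V := by
    rw [restrictForm_apply, basicOpen_resFun]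
    exact inf_le_right.trans hgV
  have hxb : x ∈ X.basicOpen (b.1 k) := by
    rw [restrictForm_apply, basicOpen_resFun]
    exact ⟨⟨trivial, hk⟩, hxg⟩
  have hl : ∀ l, X.basicOpen ((b.1 * c.1) l) ≤ X.basicOpen (b.1 k) := fun l ↦ by
    rw [Pi.mul_apply, Scheme.basicOpen_mul]
    exact (inf_le_inf_left _ (basicOpen_restrictForm_coord_le f k l)).trans
      (basicOpen_le_of_mem_ringPiece f b.2 l k)
  refine ⟨d + 1, b.1 * c.1, SetLike.mul_mem_graded b.2 c.2, ?_, iSup_le fun l ↦ (hl l).trans hb⟩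
  refine Opens.mem_iSup.2 ⟨k, ?_⟩
  rw [Pi.mul_apply, restrictForm_coord_self, mul_one]
  exact hxb

/-- Functions of degree zero are constants. -/
theorem exists_inv_of_mem_ringPiece_zero (hf : IsProjectivelyNormal f) (r : ChartRing f)
    (hr : r ∈ ringPiece f 0) (h0 : r ≠ 0) : ∃ s ∈ ringPiece f 0, r * s = 1 := by
  obtain ⟨F, hF⟩ := hf 0 ⟨r, hr⟩
  obtain ⟨c, hc⟩ : ∃ c, F = constForm N c :=
    ⟨_, Subtype.ext (MvPolynomial.totalDegree_eq_zero_iff_eq_C.1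
      (Nat.le_zero.1 ((MvPolynomial.mem_homogeneousSubmodule _ _).1 F.2).totalDegree_le))⟩
  subst hc
  have hr' : ∀ k, r k = (restrictForm f 0 (constForm N c)).1 k := fun k ↦ by rw [hF]
  have hc0 : c ≠ 0 := by
    rintro rfl
    refine h0 (funext fun k ↦ ?_)
    have h1 := dehomog_add k (constForm N 0) (constForm N 0)
    rw [show constForm N 0 + constForm N 0 = constForm N 0 from
      Subtype.ext (by simp [constForm])] at h1
    rw [hr', restrictForm_apply, left_eq_add.1 h1, map_zero, map_zero]
    rfl
  refine ⟨_, (restrictForm f 0 (constForm N c⁻¹)).2, funext fun k ↦ ?_⟩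
  rw [Pi.mul_apply, hr', restrictForm_apply, restrictForm_apply, ← map_mul, ← map_mul,
    ← dehomog_smul, show c • constForm N c⁻¹ = constForm N 1 from
      Subtype.ext (by simp [constForm, MvPolynomial.smul_eq_C_mul, ← map_mul, hc0]),
    dehomog_constForm_one, map_one, map_one]
  rfl

end Forms

end UlrichKoszul

end

noncomputable section

namespace UlrichKoszul

open Opposite Limits Abelian

/-! ### Sections of the twists of a vector bundle -/

section Sections

variable {N : ℕ} {X : Scheme.{0}} [IsIntegral X] {f : X ⟶ projSpace N} {E : X.Modules}

/-- The local extensions agree on the nonempty open subset `O`, hence on all overlaps because E is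
torsion-free, and so they glue. -/
theorem exists_extend_of_locally (hE : IsVectorBundle E) {U O : X.Opens}
    (hO : (O : Set X).Nonempty) (e : Γ(E, U ⊓ O))
    (h : ∀ y ∈ U, ∃ (W : X.Opens) (hW : W ≤ U), y ∈ W ∧ ∃ w : Γ(E, W),
      resMod E (inf_le_left : W ⊓ O ≤ W) w = resMod E (inf_le_inf_right O hW) e) :
    ∃ s : Γ(E, U), resMod E (inf_le_left : U ⊓ O ≤ U) s = e := by
  choose W hW hyW w hw using fun y : U ↦ h y y.2
  obtain ⟨s, hs⟩ := exists_glue E W hW (fun y hy ↦ Opens.mem_iSup.2 ⟨⟨y, hy⟩, hyW _⟩) w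
    fun a b ↦ by
      refine resMod_injective hE (inf_le_left : W a ⊓ W b ⊓ O ≤ _) O hO le_rfl ?_
      have ha := congrArg (resMod E (inf_le_inf_right O (inf_le_left : W a ⊓ W b ≤ W a))) (hw a)
      have hb := congrArg (resMod E (inf_le_inf_right O (inf_le_right : W a ⊓ W b ≤ W b))) (hw b)
      simp only [resMod_resMod] at ha hb ⊢
      exact ha.trans hb.symm
  refine ⟨s, resMod_eq_of_cover E (fun y ↦ W y ⊓ O) (fun y ↦ inf_le_inf_right O (hW y))
    (fun y hy ↦ Opens.mem_iSup.2 ⟨⟨y, hy.1⟩, hyW _, hy.2⟩) fun y ↦ ?_⟩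
  rw [← hw, ← hs y, resMod_resMod, resMod_resMod]

theorem exists_local_extend (hE : IsVectorBundle E) {d : ℕ} {a : ChartRing f}
    (ha : a ∈ ringPiece f d) (e : Γ(E, locus f a)) (y : X) :
    ∃ (W : X.Opens) (k : Fin (N + 1)) (hW : W ≤ ⊤ ⊓ chart f k), y ∈ W ∧ ∃ m₀ : ℕ, ∀ m ≥ m₀,
      ∃ w : Γ(E, W), resMod E (inf_le_left : W ⊓ locus f a ≤ W) w =
        resFun ((inf_le_left : W ⊓ locus f a ≤ W).trans hW) (a k) ^ m •
          resMod E (inf_le_right : W ⊓ locus f a ≤ locus f a) e := by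
  obtain ⟨k, hk⟩ := exists_mem_chart f y
  obtain ⟨U, hyU, ⟨L⟩⟩ := exists_localRetract hE y
  obtain ⟨_, ⟨W, hW, rfl⟩, hyW, hWU⟩ := X.isBasis_affineOpens.exists_subset_of_mem_open
    (show y ∈ U ⊓ (⊤ ⊓ chart f k) from ⟨hyU, trivial, hk⟩) (U ⊓ (⊤ ⊓ chart f k)).2
  have hWU' : W ≤ U ⊓ (⊤ ⊓ chart f k) := hWU
  have hWk : W ≤ ⊤ ⊓ chart f k := hWU'.trans inf_le_right
  have hg : X.basicOpen (resFun hWk (a k)) = W ⊓ locus f a := by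
    rw [basicOpen_resFun, ← locus_inf_chart f ha k]
    exact le_antisymm (inf_le_inf_left _ inf_le_left)
      (le_inf inf_le_left (le_inf inf_le_right ((inf_le_left.trans hWk).trans inf_le_right)))
  refine ⟨W, k, hWk, hyW, ?_⟩
  obtain ⟨m₀, hm⟩ := L.exists_extend hW (hWU'.trans inf_le_left) (resFun hWk (a k))
    (resMod E (hg.le.trans inf_le_right) e)
  refine ⟨m₀, fun m hm' ↦ ?_⟩
  obtain ⟨w, hw⟩ := hm m hm'
  refine ⟨w, ?_⟩
  have := congrArg (resMod E hg.ge) hw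
  rwa [resMod_smul, map_pow, resFun_resFun, resFun_resFun, resMod_resMod, resMod_resMod] at this

/-- Sections over the nonvanishing locus of a form extend to twists. -/
theorem exists_twistSection [CompactSpace X] (hE : IsVectorBundle E) {d : ℕ} {a : ChartRing f}
    (ha : a ∈ ringPiece f d) (hO : (locus f a : Set X).Nonempty) (e : Γ(E, locus f a)) :
    ∃ (m : ℕ), ∃ s ∈ modulePiece f E (m • d), ∀ k,
      resMod E (inf_le_left : ⊤ ⊓ chart f k ⊓ locus f a ≤ _) (s k) =
        resFun (inf_le_left : ⊤ ⊓ chart f k ⊓ locus f a ≤ _) (a k) ^ m • resMod E inf_le_right e := by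
  choose W κ hW hyW m₀ hm₀ using exists_local_extend hE ha e
  obtain ⟨t, ht⟩ := CompactSpace.elim_nhds_subcover (fun y ↦ (W y : Set X))
    fun y ↦ (W y).2.mem_nhds (hyW y)
  -- Compactness leaves finitely many local extensions, so one exponent suffices for all of them.
  set m := t.sup m₀
  have hw : ∀ z ∈ t, ∃ w : Γ(E, W z), resMod E (inf_le_left : W z ⊓ locus f a ≤ W z) w =
      resFun ((inf_le_left : W z ⊓ locus f a ≤ W z).trans (hW z)) (a (κ z)) ^ m •
        resMod E (inf_le_right : W z ⊓ locus f a ≤ locus f a) e :=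
    fun z hz ↦ hm₀ z m (Finset.le_sup hz)
  have hpow : ∀ {V : X.Opens} (k l : Fin (N + 1)) (hV : V ≤ ⊤ ⊓ overlap f k l),
      resFun (hV.trans (overlap_le_left f ⊤ k l)) (a k) ^ m =
        resFun hV (transition f ((m • d : ℕ) : ℤ) ⊤ k l) *
          resFun (hV.trans (overlap_le_right f ⊤ k l)) (a l) ^ m := fun k l hV ↦ by
    have h := congrArg (resFun hV) (SetLike.pow_mem_graded m ha k l)
    rwa [map_mul, resFun_resFun, resFun_resFun, Pi.pow_apply, Pi.pow_apply, map_pow,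
      map_pow] at h
  have key : ∀ k, ∃ s : Γ(E, ⊤ ⊓ chart f k),
      resMod E (inf_le_left : ⊤ ⊓ chart f k ⊓ locus f a ≤ _) s =
        resFun (inf_le_left : ⊤ ⊓ chart f k ⊓ locus f a ≤ _) (a k) ^ m • resMod E inf_le_right e := by
    intro k
    refine exists_extend_of_locally hE hO _ fun y hy ↦ ?_
    obtain ⟨z, hz, hyz⟩ : ∃ z ∈ t, y ∈ W z := by simpa using ht.ge (Set.mem_univ y)
    obtain ⟨w, hw⟩ := hw z hz
    have hV : ⊤ ⊓ chart f k ⊓ W z ≤ ⊤ ⊓ overlap f k (κ z) :=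
      fun p hp ↦ ⟨trivial, hp.1.2, (hW z hp.2).2⟩
    -- The local extension was found with the coordinate of `a` in chart `κ z`; the transition
    -- function of weight m d turns it into an extension for chart `k`.
    refine ⟨⊤ ⊓ chart f k ⊓ W z, inf_le_left, ⟨hy, hyz⟩,
      resFun hV (transition f ((m • d : ℕ) : ℤ) ⊤ k (κ z)) • resMod E inf_le_right w, ?_⟩
    have h1 := congrArg (resMod E (inf_le_inf_right (locus f a)
      (inf_le_right : ⊤ ⊓ chart f k ⊓ W z ≤ W z))) hw
    rw [resMod_smul, map_pow, resFun_resFun, resMod_resMod, resMod_resMod] at h1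
    rw [resMod_smul, resFun_resFun, resMod_resMod, h1, resMod_smul, map_pow, resFun_resFun,
      resMod_resMod, smul_smul, hpow k (κ z) (inf_le_left.trans hV)]
  choose s hs using key
  refine ⟨m, s, fun k l ↦ ?_, hs⟩
  refine resMod_injective hE (inf_le_left : ⊤ ⊓ overlap f k l ⊓ locus f a ≤ _) _ hO le_rfl ?_
  have hk := congrArg (resMod E (inf_le_inf_right (locus f a) (overlap_le_left f ⊤ k l))) (hs k)
  have hl := congrArg (resMod E (inf_le_inf_right (locus f a) (overlap_le_right f ⊤ k l))) (hs l)
  rw [resMod_smul, map_pow, resFun_resFun, resMod_resMod, resMod_resMod] at hk hl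
  rw [resMod_smul, resMod_resMod, resMod_resMod, hk, hl, smul_smul, hpow k l inf_le_left]

/-- A nonzero local section is restricted to the nonvanishing locus of a form `a` and extended after
multiplication by a power of `a`. If the extension were zero, the section would vanish where `a` is
invertible, hence everywhere by torsion-freeness. -/
theorem exists_twistSection_ne_zero [CompactSpace X] [IsClosedImmersion f]
    (hE : IsVectorBundle E) (hE0 : ¬ IsZero E) :
    ∃ (m : ℕ), ∃ s ∈ modulePiece f E m, s ≠ 0 := by
  obtain ⟨V, e, he⟩ := exists_section_ne_zero hE0
  obtain ⟨x, hx⟩ : (V : Set X).Nonempty := by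
    by_contra h
    exact he ((subsingleton_of_eq_empty E h).elim _ _)
  obtain ⟨d, a, ha, hxa, haV⟩ := exists_locus_le f hx
  have hO : (locus f a : Set X).Nonempty := ⟨x, hxa⟩
  obtain ⟨m, s, hs, h⟩ := exists_twistSection hE ha hO (resMod E haV e)
  refine ⟨_, s, hs, ?_⟩
  rintro rfl
  obtain ⟨k, hk⟩ := Opens.mem_iSup.1 hxa
  have hB : X.basicOpen (a k) ≤ ⊤ ⊓ chart f k ⊓ locus f a :=
    le_inf (X.basicOpen_le _) (le_iSup (fun k ↦ X.basicOpen (a k)) k)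
  have h1 := congrArg (resMod E hB) (h k)
  rw [resMod_smul, map_pow, resFun_resFun, resMod_resMod, resMod_resMod, Pi.zero_apply,
    map_zero] at h1
  have hu : IsUnit (resFun (X.basicOpen_le (a k)) (a k)) :=
    RingedSpace.isUnit_res_basicOpen X.toRingedSpace (a k)
  have h2 := (hu.pow m).smul_eq_zero.1 h1.symm
  rw [resMod_resMod] at h2
  exact he (resMod_injective hE _ (X.basicOpen (a k)) ⟨x, hk⟩ inf_le_right
    (h2.trans (map_zero _).symm))

theorem spanAt_eq_bot {A M : Type} [CommRing A] [AddCommGroup M] [Module A M]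
    {T : ℤ → AddSubgroup M} {m : ℤ} (h : T (m - 1) = ⊥) (l : List A) : spanAt T m l = ⊥ := by
  induction l with
  | nil => rfl
  | cons a l ih =>
    refine (AddSubgroup.eq_bot_iff_forall _).2 fun s hs ↦ ?_
    obtain ⟨u, hu, v, hv, rfl⟩ := (mem_spanAt_cons T).1 hs
    rw [ih] at hu
    rw [h] at hv
    rw [AddSubgroup.mem_bot.1 hu, AddSubgroup.mem_bot.1 hv, smul_zero, add_zero]

/-- Each positive degree is generated by the degree below it, so if H^0(E) vanished, all H^0(E(m))
with m ≥ 0 would. -/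
theorem exists_section_zero_ne_zero {l : List (ringPiece f 1)} (hU : IsUlrich f E)
    (hl : ∀ x : X, ∃ a ∈ l, ∃ k, x ∈ X.basicOpen (a.1 k))
    (h : ∃ (m : ℕ), ∃ s ∈ modulePiece f E m, s ≠ 0) : ∃ s ∈ modulePiece f E 0, s ≠ 0 := by
  by_contra! h0
  obtain ⟨m, s, hs, hs0⟩ := h
  refine hs0 (AddSubgroup.mem_bot.1 ((?_ : modulePiece f E m = ⊥) ▸ hs))
  clear s hs hs0
  induction m with
  | zero => exact (AddSubgroup.eq_bot_iff_forall _).2 h0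
  | succ m ih =>
    refine (AddSubgroup.eq_bot_iff_forall _).2 fun s hs ↦ ?_
    have hmem := (mem_imageOf_iff f E l ((m + 1 : ℕ) : ℤ) ⟨s, hs⟩).1
      (mem_imageOf_of_regular (mulTwist_comm f E) (exists_bijective_mulTwist f E hl) hU.regular
        (by positivity) _)
    rw [spanAt_eq_bot] at hmem
    · exact hmem
    · rw [Nat.cast_succ, add_sub_cancel_right]
      exact ih

end Sections

end UlrichKoszul

end

noncomputable section

namespace UlrichKoszul

/-! ### Systems of parameters -/

/-- On a Noetherian space whose finite subsets are each contained in one member of a family of open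
subsets, finitely many members of the family cover a closed subset; their number can be
`dim + 1`. -/
theorem exists_list_cover {α L : Type*} [TopologicalSpace α] [NoetherianSpace α] [QuasiSober α]
    (D : L → Opens α) (hD : ∀ s : Finset α, ∃ a, ∀ x ∈ s, x ∈ D a) (y : α) (d : ℕ) (Z : Set α)
    (hZ : IsClosed Z)
    (hdim : ∀ p : LTSeries (IrreducibleCloseds α), (p.last : Set α) ⊆ Z → p.length < d) :
    ∃ l : List L, l.length = d ∧ (∀ a ∈ l, y ∈ D a) ∧ ∀ x ∈ Z, ∃ a ∈ l, x ∈ D a := by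
  classical
  induction d generalizing Z with
  | zero =>
    refine ⟨[], rfl, by simp, fun x hx ↦ ?_⟩
    exact (Nat.not_lt_zero _ (hdim
      (RelSeries.singleton _ ⟨closure {x}, isIrreducible_singleton.closure, isClosed_closure⟩)
      (hZ.closure_subset_iff.2 (Set.singleton_subset_iff.2 hx)))).elim
  | succ d ih =>
    obtain ⟨S, hS, hSc, hSi, rfl⟩ := NoetherianSpace.exists_finite_set_isClosed_irreducible hZ
    have hgen : ∀ t ∈ S, ∃ x ∈ t, closure {x} = t := fun t ht ↦ by
      obtain ⟨x, hx⟩ := QuasiSober.sober (hSi t ht) (hSc t ht)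
      exact ⟨x, hx.mem, hx⟩
    have : Nonempty α := ⟨y⟩
    choose! g hgt hg using hgen
    -- The new open set contains `y` and the generic points of all components of the closed set, so
    -- its complement contains none of these components.
    obtain ⟨a, ha⟩ := hD (insert y (hS.toFinset.image g))
    obtain ⟨l, hl, hly, hlZ⟩ := ih (⋃₀ S ∩ (D a : Set α)ᶜ) (hZ.inter (D a).2.isClosed_compl)
      fun p hp ↦ by
        obtain ⟨t, ht, hpt⟩ := isIrreducible_iff_sUnion_isClosed.1 p.last.isIrreducible hS.toFinset
          (fun t ht ↦ hSc t (hS.mem_toFinset.1 ht))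
          (by rw [hS.coe_toFinset]; exact hp.trans Set.inter_subset_left)
        have htS := hS.mem_toFinset.1 ht
        -- A chain in what remains can be prolonged by the component containing its top member,
        -- strictly because the generic point of that component was removed. Thus the bound on
        -- chains drops by one.
        have hlt : p.last < (⟨t, hSi t htS, hSc t htS⟩ : IrreducibleCloseds α) := by
          refine lt_of_le_of_ne hpt fun h ↦ ?_
          have : g t ∈ (p.last : Set α) := by
            rw [h]
            exact hgt t htS
          exact (hp this).2 (ha _ (Finset.mem_insert_of_mem (Finset.mem_image_of_mem g ht)))
        have := hdim (p.snoc _ hlt) (by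
          rw [RelSeries.last_snoc]
          exact Set.subset_sUnion_of_mem htS)
        simpa using this
    refine ⟨a :: l, by simp [hl], ?_, fun x hx ↦ ?_⟩
    · rintro b (_ | ⟨_, hb⟩)
      · exact ha y (Finset.mem_insert_self _ _)
      · exact hly b hb
    · by_cases hxa : x ∈ D a
      · exact ⟨a, List.mem_cons_self, hxa⟩
      · obtain ⟨b, hb, hxb⟩ := hlZ x ⟨hx, hxa⟩
        exact ⟨b, List.mem_cons_of_mem a hb, hxb⟩

/-! ### Linear systems of parameters on X, and the final assembly -/

section Parameters

variable {N : ℕ} {X : Scheme.{0}} (f : X ⟶ projSpace N)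

theorem mem_locus_restrictForm_coord {k : Fin (N + 1)} {x : X} (hx : x ∈ chart f k) :
    x ∈ locus f (restrictForm f 1 (coord k)).1 := by
  refine Opens.mem_iSup.2 ⟨k, ?_⟩
  rw [restrictForm_coord_self, X.basicOpen_of_isUnit isUnit_one]
  exact ⟨trivial, hx⟩

/-- Finitely many points lie off a hyperplane. -/
theorem exists_linearForm_ne_zero (s : Finset X) :
    ∃ a : ringPiece f 1, ∀ x ∈ s, x ∈ locus f a.1 := by
  classical
  choose κ hκ using exists_mem_chart f
  have hκ' : ∀ x, x ∈ ⊤ ⊓ chart f (κ x) := fun x ↦ ⟨trivial, hκ x⟩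
  let φ : ∀ x : X, Γ(X, ⊤ ⊓ chart f (κ x)) →+* X.residueField x := fun x ↦
    (X.evaluation _ x (hκ' x)).hom
  let W : X → Subspace ℂ (polyGrading N 1) := fun x ↦
    { carrier := {F | φ x ((restrictForm f 1 F).1 (κ x)) = 0}
      add_mem' := fun {F G} hF hG ↦ by
        rw [Set.mem_ofPred_eq, restrictForm_apply] at hF hG ⊢
        rw [dehomog_add, map_add, map_add, map_add, hF, hG, add_zero]
      zero_mem' := by
        have h := dehomog_add (κ x) (0 : polyGrading N 1) 0
        rw [add_zero] at h
        rw [Set.mem_ofPred_eq, restrictForm_apply, left_eq_add.1 h, map_zero, map_zero, map_zero]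
      smul_mem' := fun c F hF ↦ by
        rw [Set.mem_ofPred_eq, restrictForm_apply] at hF ⊢
        rw [dehomog_smul, map_mul, map_mul, map_mul, hF, mul_zero] }
  have hW : ∀ x, W x ≠ ⊤ := fun x h ↦ by
    have : φ x ((restrictForm f 1 (coord (κ x))).1 (κ x)) = 0 :=
      (h.ge trivial : coord (κ x) ∈ W x)
    rw [restrictForm_coord_self, map_one] at this
    exact one_ne_zero this
  -- `W x` is the space of linear forms vanishing at `x`, proper because some coordinate does not.
  -- Over an infinite field, finitely many proper subspaces do not cover the whole space.
  have hne := Subspace.biUnion_ne_univ_of_top_notMem (s := s.image W)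
    fun h ↦ by
      obtain ⟨x, -, hx⟩ := Finset.mem_image.1 h
      exact hW x hx
  obtain ⟨F, hF⟩ := (Set.ne_univ_iff_exists_notMem _).1 hne
  refine ⟨restrictForm f 1 F, fun x hx ↦ Opens.mem_iSup.2 ⟨κ x, ?_⟩⟩
  refine (Scheme.evaluation_ne_zero_iff_mem_basicOpen X x (hκ' x) _).1 fun h ↦ hF ?_
  exact Set.mem_iUnion₂.2 ⟨W x, Finset.mem_image_of_mem W hx, h⟩

variable [IsIntegral X]

theorem genericPoint_mem {U : X.Opens} {x : X} (hx : x ∈ U) : genericPoint X ∈ U :=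
  (genericPoint_specializes x).mem_open U.2 hx

/-- By irreducibility the nonvanishing locus of `a` meets every nonempty chart, so `a` is nonzero
there and can be cancelled in the domain of functions on that chart. On empty charts there is
nothing to show. -/
theorem eq_zero_of_mul_eq_zero {a : ringPiece f 1} {x : X} (hx : x ∈ locus f a.1)
    {b : ChartRing f} (h : a.1 * b = 0) : b = 0 := by
  funext l
  by_cases hne : ((⊤ ⊓ chart f l : X.Opens) : Set X).Nonempty
  · have : Nonempty (⊤ ⊓ chart f l : X.Opens) := hne.to_subtype
    refine (mul_eq_zero.1 (congrFun h l)).resolve_left fun h0 ↦ ?_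
    obtain ⟨k, hk⟩ := Opens.mem_iSup.1 hx
    have hV := inf_nonempty (U := X.basicOpen (a.1 k)) ⟨x, hk⟩ hne
    have hu := isUnit_of_le_basicOpen f a (le_refl (X.basicOpen (a.1 k))) l
    have : Nonempty (X.basicOpen (a.1 k) ⊓ chart f l : X.Opens) :=
      let ⟨y, hy⟩ := hV
      ⟨⟨y, hy.1, hy.2.2⟩⟩
    rw [localCoord, show a.1 l = 0 from h0, map_zero] at hu
    exact not_isUnit_zero hu
  · exact (subsingleton_of_eq_empty (structureModule X) hne).elim _ _

/-- There are `dim X + 1` linear forms without common zeros on `X`; if `dim X` is infinite, read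
this as some positive number of linear forms. -/
theorem exists_parameters [NoetherianSpace X] :
    ∃ (n : ℕ) (l : List (ringPiece f 1)), l.length = n + 1 ∧
      (n : WithBot ℕ∞) ≤ topologicalKrullDim X ∧ (∀ a ∈ l, genericPoint X ∈ locus f a.1) ∧
        ∀ x : X, ∃ a ∈ l, x ∈ locus f a.1 := by
  classical
  have hbot : topologicalKrullDim X ≠ ⊥ := by
    have : Nonempty (IrreducibleCloseds X) :=
      ⟨⟨closure {genericPoint X}, isIrreducible_singleton.closure, isClosed_closure⟩⟩
    exact Order.krullDim_ne_bot_iff.2 this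
  obtain ⟨D, hD⟩ := WithBot.ne_bot_iff_exists.1 hbot
  induction D using ENat.recTopCoe with
  | top =>
    -- The bound by the dimension is automatic in this case, so any finite list without common zeros
    -- will do: the coordinates that do not vanish identically on X. The last index is `l.length -
    -- 1`, and the list is nonempty because some form is nonzero at the generic point.
    let l := ((List.finRange (N + 1)).map fun k ↦ restrictForm f 1 (coord k)).filter
      fun a ↦ genericPoint X ∈ locus f a.1
    have hl : ∀ x : X, ∃ a ∈ l, x ∈ locus f a.1 := fun x ↦ by
      obtain ⟨k, hk⟩ := exists_mem_chart f x
      have hx := mem_locus_restrictForm_coord f hk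
      exact ⟨_, List.mem_filter.2 ⟨List.mem_map_of_mem (List.mem_finRange k),
        decide_eq_true (genericPoint_mem hx)⟩, hx⟩
    refine ⟨l.length - 1, l, ?_, ?_, fun a ha ↦ of_decide_eq_true (List.mem_filter.1 ha).2, hl⟩
    · obtain ⟨a, ha, -⟩ := hl (genericPoint X)
      have := List.length_pos_of_mem ha
      omega
    · rw [← hD]
      exact le_top
  | coe n =>
    obtain ⟨l, h1, h2, h3⟩ := exists_list_cover (fun a : ringPiece f 1 ↦ locus f a.1)
      (exists_linearForm_ne_zero f) (genericPoint X) (n + 1) Set.univ isClosed_univ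
      fun p _ ↦ by
        have := (Order.LTSeries.length_le_krullDim p).trans_eq hD.symm
        exact Nat.lt_succ_of_le (by exact_mod_cast this)
    exact ⟨n, l, h1, hD.le, h2, fun x ↦ h3 x trivial⟩

theorem isKoszulModule_sectionModule_iff [IsClosedImmersion f] [Smooth (f ≫ projSpaceToSpec N)]
    (hX : IsProjectivelyNormal f) (E : X.Modules) (hE : IsVectorBundle E)
    (hE0 : ¬ Limits.IsZero E) (hU : IsUlrich f E) :
    IsKoszulModule (sectionRingGrading f) (sectionModuleGrading f E) ↔
      IsKoszulAlgebra (sectionRingGrading f) := by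
  have := isNoetherian_of_isClosedImmersion f
  obtain ⟨n, l, hn, hdim, hgen, hl⟩ := exists_parameters f
  have hl' : ∀ x : X, ∃ a ∈ l, ∃ k, x ∈ X.basicOpen (a.1 k) := fun x ↦ by
    obtain ⟨a, ha, hx⟩ := hl x
    exact ⟨a, ha, Opens.mem_iSup.1 hx⟩
  exact isKoszulModule_iff_of_ulrich f E hn hdim hU hl'
    (fun a ha b ↦ eq_zero_of_mul_eq_zero f (hgen a ha))
    (exists_inv_of_mem_ringPiece_zero f hX)
    (exists_section_zero_ne_zero hU hl' (exists_twistSection_ne_zero hE hE0))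

end Parameters

end UlrichKoszul

end

theorem theorem3 (N : ℕ) (X : Scheme.{0}) (f : X ⟶ UlrichKoszul.projSpace N)
    [IsClosedImmersion f] [IsIntegral X] [Smooth (f ≫ UlrichKoszul.projSpaceToSpec N)]
    (hX : UlrichKoszul.IsACM f)
    (E : X.Modules) (hE : UlrichKoszul.IsVectorBundle E) (hE0 : ¬ Limits.IsZero E)
    (hU : UlrichKoszul.IsUlrich f E) :
    UlrichKoszul.IsKoszulModule (UlrichKoszul.sectionRingGrading f)
        (UlrichKoszul.sectionModuleGrading f E) ↔
      UlrichKoszul.IsKoszulAlgebra (UlrichKoszul.sectionRingGrading f) :=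
  UlrichKoszul.isKoszulModule_sectionModule_iff f hX.projectivelyNormal E hE hE0 hU
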